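/- **Model.** Let $M=Td$ with integers $T,d\ge 1$. In the $T$-round online setting, $n$ clean i.i.d. samples are drawn from a distribution $X$ on $\mathbb R^M$ with unknown mean $\mu^*$; an adversary who sees all of them replaces at most $\epsilon n$ of them by arbitrary points, giving $x^{(1)},\dots,x^{(n)}$ (the samples may also be relabelled). Write $x^{(i)}=(x^{(i)}_1,\dots,x^{(i)}_T)$ with batches $x^{(i)}_t\in\mathbb R^d$. In round $t$ the vectors $x^{(1)}_t,\dots,x^{(n)}_t$ are revealed, and the algorithm must output $\mu_t\in\mathbb R^d$ from the batches revealed so far and the parameters $n,d,T,\epsilon$. With $\mu=(\mu_1,\dots,\mu_T)$, the algorithm has error $\epsilon'$ with failure probability $\tau$ if, except with probability at most $\tau$ over the clean samples, $\|\mu-\mu^*\|_2\le\epsilon'$ for every choice of the adversary. Algorithms are programs of a real-number random access machine (unit-cost field operations and comparisons on reals, rational constants; addition and subtraction of natural-number registers that index arrays of reals). For $K>0$ call $X$ *$K$-subgaussian* if $\Pr[|\langle v,X-\mu^*\rangle|>q]\le 2\exp(-q^2/(2K^2))$ for every unit vector $v$ and every $q>0$. **Theorem 1.3.** There are universal constants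 $\epsilon_0>0$, $C>0$ and $k\in\mathbb N$ such that for every $K>0$ there are a constant $C_K>0$, depending only on $K$, and a single deterministic online algorithm with the following properties, for all integers $T,d\ge1$, with $M=Td$, and all $0<\epsilon\le\epsilon_0$. * (Efficiency) For every $n\ge1$ and every dataset of $n$ points in $\mathbb R^M$, the algorithm halts in every round, and its total running time over the $T$ rounds is at most $C\,(nM/\epsilon)^k$. * (Bounded covariance) If $X$ is a distribution on $\mathbb R^M$ with finite second moments and covariance $\Sigma_X\preceq I$, then for every $n\ge C\,(M/\epsilon)^k$ the algorithm estimates the mean of $X$ under $\epsilon$-corruption in the $T$-round online setting with failure probability $1/10$ and error at most $C\sqrt{\epsilon}\,(1+\log T)$. * (Subgaussian) If $X$ is a $K$-subgaussian distribution on $\mathbb R^M$ with covariance $\Sigma_X=I$, then for every $n\ge C_K\,(M/\epsilon)^k$ the algorithm estimates the mean of $X$ under $\epsilon$-corruption in the $T$-round online setting with failure probability $1/10$ and error at most $C_K\,\epsilon\sqrt{\log(1/\epsilon)}\,(1+\log T)$. In particular, for $T\ge 2$ the errors are $O(\sqrt\epsilon\log T)$ and $O(\epsilon\sqrt{\log(1/\epsilon)}\log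 T)$. -/

import Mathlib

/-! ## A real-number random access machine

Programs of a small imperative language whose memory consists of registers holding natural
numbers (used as counters and array indices) and finitely many named two-dimensional arrays of
real numbers. Every arithmetic operation, memory access, comparison and assignment is charged one
unit of time. On natural numbers only addition and truncated subtraction are available; on real
numbers only the four field operations and comparison, with rational constants. A real number
cannot be converted into a natural number. -/

namespace RealRAM

/-- Expressions for natural numbers: constants, registers, sums and truncated differences. -/
inductive NExpr : Type
  | const (k : ℕ)
  | reg (r : ℕ)
  | add (e₁ e₂ : NExpr)
  | sub (e₁ e₂ : NExpr)

/-- Expressions for real numbers: rational constants, array entries and field operations. -/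
inductive RExpr : Type
  | const (q : ℚ)
  | entry (a : ℕ) (i j : NExpr)
  | add (e₁ e₂ : RExpr)
  | sub (e₁ e₂ : RExpr)
  | mul (e₁ e₂ : RExpr)
  | div (e₁ e₂ : RExpr)

/-- Boolean tests. -/
inductive BExpr : Type
  | natLt (e₁ e₂ : NExpr)
  | realLt (e₁ e₂ : RExpr)
  | not (b : BExpr)
  | and (b₁ b₂ : BExpr)

/-- Programs. -/
inductive Cmd : Type
  | skip
  | setNat (r : ℕ) (e : NExpr)
  | setReal (a : ℕ) (i j : NExpr) (e : RExpr)
  | seq (c₁ c₂ : Cmd)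
  | ite (b : BExpr) (c₁ c₂ : Cmd)
  | while (b : BExpr) (c : Cmd)

/-- A memory state: `nat r` is the content of register `r`, and `real a i j` is the entry in row
`i` and column `j` of array `a`. -/
@[ext]
structure State : Type where
  nat : ℕ → ℕ
  real : ℕ → ℕ → ℕ → ℝ

/-- The all-zero memory. -/
def State.blank : State where
  nat := fun _ => 0
  real := fun _ _ _ => 0

/-- The value of a natural-number expression. -/
def NExpr.eval (s : State) : NExpr → ℕ
  | .const k => k
  | .reg r => s.nat r
  | .add e₁ e₂ => e₁.eval s + e₂.eval s
  | .sub e₁ e₂ => e₁.eval s - e₂.eval s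

/-- The time to evaluate a natural-number expression. -/
def NExpr.cost : NExpr → ℕ
  | .const _ => 1
  | .reg _ => 1
  | .add e₁ e₂ => e₁.cost + e₂.cost + 1
  | .sub e₁ e₂ => e₁.cost + e₂.cost + 1

/-- The value of a real expression (division by zero returns zero). -/
noncomputable def RExpr.eval (s : State) : RExpr → ℝ
  | .const q => (q : ℝ)
  | .entry a i j => s.real a (i.eval s) (j.eval s)
  | .add e₁ e₂ => e₁.eval s + e₂.eval s
  | .sub e₁ e₂ => e₁.eval s - e₂.eval s
  | .mul e₁ e₂ => e₁.eval s * e₂.eval s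
  | .div e₁ e₂ => e₁.eval s / e₂.eval s

/-- The time to evaluate a real expression. -/
def RExpr.cost : RExpr → ℕ
  | .const _ => 1
  | .entry _ i j => i.cost + j.cost + 1
  | .add e₁ e₂ => e₁.cost + e₂.cost + 1
  | .sub e₁ e₂ => e₁.cost + e₂.cost + 1
  | .mul e₁ e₂ => e₁.cost + e₂.cost + 1
  | .div e₁ e₂ => e₁.cost + e₂.cost + 1

/-- The truth value of a test. -/
def BExpr.eval (s : State) : BExpr → Prop
  | .natLt e₁ e₂ => e₁.eval s < e₂.eval s
  | .realLt e₁ e₂ => e₁.eval s < e₂.eval s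
  | .not b => ¬ b.eval s
  | .and b₁ b₂ => b₁.eval s ∧ b₂.eval s

/-- The time to evaluate a test. -/
def BExpr.cost : BExpr → ℕ
  | .natLt e₁ e₂ => e₁.cost + e₂.cost + 1
  | .realLt e₁ e₂ => e₁.cost + e₂.cost + 1
  | .not b => b.cost + 1
  | .and b₁ b₂ => b₁.cost + b₂.cost + 1

/-- The state after writing `v` into register `r`. -/
def State.setNat (s : State) (r v : ℕ) : State where
  nat := Function.update s.nat r v
  real := s.real

/-- The state after writing `v` into row `i` and column `j` of array `a`. -/
noncomputable def State.setReal (s : State) (a i j : ℕ) (v : ℝ) : State where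
  nat := s.nat
  real := fun a' i' j' => if a' = a ∧ i' = i ∧ j' = j then v else s.real a' i' j'

/-- `Exec c s m s'`: started in the state `s`, the program `c` halts after exactly `m` units of
time in the state `s'`. -/
inductive Exec : Cmd → State → ℕ → State → Prop
  | skip (s : State) : Exec .skip s 1 s
  | setNat (r : ℕ) (e : NExpr) (s : State) :
      Exec (.setNat r e) s (e.cost + 1) (s.setNat r (e.eval s))
  | setReal (a : ℕ) (i j : NExpr) (e : RExpr) (s : State) :
      Exec (.setReal a i j e) s (i.cost + j.cost + e.cost + 1)
        (s.setReal a (i.eval s) (j.eval s) (e.eval s))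
  | seq {c₁ c₂ : Cmd} {s s' s'' : State} {m₁ m₂ : ℕ}
      (h₁ : Exec c₁ s m₁ s') (h₂ : Exec c₂ s' m₂ s'') :
      Exec (.seq c₁ c₂) s (m₁ + m₂) s''
  | iteTrue {b : BExpr} {c₁ c₂ : Cmd} {s s' : State} {m : ℕ}
      (hb : b.eval s) (h : Exec c₁ s m s') :
      Exec (.ite b c₁ c₂) s (b.cost + 1 + m) s'
  | iteFalse {b : BExpr} {c₁ c₂ : Cmd} {s s' : State} {m : ℕ}
      (hb : ¬ b.eval s) (h : Exec c₂ s m s') :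
      Exec (.ite b c₁ c₂) s (b.cost + 1 + m) s'
  | whileTrue {b : BExpr} {c : Cmd} {s s' s'' : State} {m₁ m₂ : ℕ}
      (hb : b.eval s) (h₁ : Exec c s m₁ s') (h₂ : Exec (.while b c) s' m₂ s'') :
      Exec (.while b c) s (b.cost + 1 + m₁ + m₂) s''
  | whileFalse {b : BExpr} {c : Cmd} {s : State} (hb : ¬ b.eval s) :
      Exec (.while b c) s (b.cost + 1) s

/-- The machine is deterministic: a program has at most one halting execution from a state. -/
theorem Exec.unique {c : Cmd} {s s₁ s₂ : State} {m₁ m₂ : ℕ}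
    (h₁ : Exec c s m₁ s₁) (h₂ : Exec c s m₂ s₂) : m₁ = m₂ ∧ s₁ = s₂ := by
  induction h₁ generalizing m₂ s₂ with
  | skip s => cases h₂; exact ⟨rfl, rfl⟩
  | setNat r e s => cases h₂; exact ⟨rfl, rfl⟩
  | setReal a i j e s => cases h₂; exact ⟨rfl, rfl⟩
  | seq _ _ ih₁ ih₂ =>
    cases h₂ with
    | seq g₁ g₂ =>
      obtain ⟨rfl, rfl⟩ := ih₁ g₁
      obtain ⟨rfl, rfl⟩ := ih₂ g₂
      exact ⟨rfl, rfl⟩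
  | iteTrue hb _ ih =>
    cases h₂ with
    | iteTrue _ g => obtain ⟨rfl, rfl⟩ := ih g; exact ⟨rfl, rfl⟩
    | iteFalse hb' _ => exact absurd hb hb'
  | iteFalse hb _ ih =>
    cases h₂ with
    | iteTrue hb' _ => exact absurd hb' hb
    | iteFalse _ g => obtain ⟨rfl, rfl⟩ := ih g; exact ⟨rfl, rfl⟩
  | whileTrue hb _ _ ih₁ ih₂ =>
    cases h₂ with
    | whileTrue _ g₁ g₂ =>
      obtain ⟨rfl, rfl⟩ := ih₁ g₁
      obtain ⟨rfl, rfl⟩ := ih₂ g₂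
      exact ⟨rfl, rfl⟩
    | whileFalse hb' => exact absurd hb hb'
  | whileFalse hb =>
    cases h₂ with
    | whileTrue hb' _ _ => exact absurd hb' hb
    | whileFalse _ => exact ⟨rfl, rfl⟩

end RealRAM

/-! ## Online robust mean estimation -/

namespace OnlineMean

open RealRAM MeasureTheory ProbabilityTheory

/-- `ℝ^M` with `M = T * d`, the coordinates being divided into `T` batches of size `d`:
the coordinate `(t, j)` of a point is the `j`-th coordinate of its `t`-th batch. -/
abbrev Space (T d : ℕ) : Type := EuclideanSpace ℝ (Fin T × Fin d)

/-- The memory at the beginning of a round, where `s` is the memory at the end of the preceding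
one. Registers `0, 1, 2, 3` receive the number of samples `n`, the batch size `d`, the number of
rounds `T` and the number `t` of the round (counted from `0`), array `0` receives the batch
revealed in this round (row `i` belongs to sample `i`), and array `1` the corruption level `ε`.
All other cells keep their contents. -/
noncomputable def reveal {n d : ℕ} (T t : ℕ) (ε : ℝ) (batch : Fin n → Fin d → ℝ) (s : State) :
    State where
  nat := fun r =>
    if r = 0 then n else if r = 1 then d else if r = 2 then T else if r = 3 then t else s.nat r
  real := fun a i j =>
    if a = 0 then (if h : i < n ∧ j < d then batch ⟨i, h.1⟩ ⟨j, h.2⟩ else 0)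
    else if a = 1 then ε else s.real a i j

/-- `OnlineRun prog ε x y m`: the online algorithm `prog`, run on the dataset `x` with corruption
level `ε`, halts in every round, outputs the estimates `y` and uses `m` units of time in total.
The program is executed once per round, with access to the batch of that round and to the memory
left by the earlier rounds, hence to nothing but the batches revealed so far; when it halts in
round `t`, the `t`-th batch of `y` is read from row `0` of array `2`. -/
def OnlineRun {n T d : ℕ} (prog : Cmd) (ε : ℝ) (x : Fin n → Space T d) (y : Space T d) (m : ℕ) :
    Prop :=
  ∃ (s : ℕ → State) (cost : ℕ → ℕ),
    s 0 = State.blank ∧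
    (∀ t : Fin T,
      Exec prog (reveal T (t : ℕ) ε (fun i j => x i (t, j)) (s (t : ℕ))) (cost (t : ℕ))
        (s ((t : ℕ) + 1)) ∧
      ∀ j : Fin d, y (t, j) = (s ((t : ℕ) + 1)).real 2 0 (j : ℕ)) ∧
    m = ∑ t ∈ Finset.range T, cost t

/-- `x` is an `ε`-corrupted version of `c`: up to the order of the samples, it results from `c` by
replacing at most `ε * n` of the `n` samples by arbitrary points. -/
def IsCorruption {n : ℕ} {E : Type*} (ε : ℝ) (c x : Fin n → E) : Prop :=
  ∃ σ : Equiv.Perm (Fin n), (({i | x i ≠ c (σ i)} : Set (Fin n)).ncard : ℝ) ≤ ε * n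

/-- The mean of a distribution. -/
noncomputable def mean {T d : ℕ} (P : Measure (Space T d)) : Space T d := ∫ z, z ∂P

/-- The covariance matrix of a distribution. -/
noncomputable def covMatrix {T d : ℕ} (P : Measure (Space T d)) :
    Matrix (Fin T × Fin d) (Fin T × Fin d) ℝ :=
  Matrix.of fun p q => cov[fun z : Space T d => z p, fun z : Space T d => z q; P]

/-- Sub-Gaussian distributions with parameter `K`: all one-dimensional projections along unit
vectors have sub-Gaussian tails around their means. -/
def IsSubgaussian {T d : ℕ} (K : ℝ) (P : Measure (Space T d)) : Prop :=
  ∀ v : Space T d, ‖v‖ = 1 → ∀ q : ℝ, 0 < q →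
    P.real {z | q < |inner ℝ v (z - mean P)|} ≤ 2 * Real.exp (-q ^ 2 / (2 * K ^ 2))

/-- With `n` i.i.d. samples from `P`, the online algorithm `prog` estimates the mean of `P` under
`ε`-corruption with error `err` and failure probability `τ`: except with probability at most `τ`
over the clean samples `c`, whatever `ε`-corrupted version `x` of them the adversary chooses, the
outputs of `prog` on `x` are within distance `err` of the mean. -/
def EstimatesMean {T d : ℕ} (prog : Cmd) (n : ℕ) (ε : ℝ) (P : Measure (Space T d))
    (err : ℝ) (τ : ENNReal) : Prop :=
  Measure.pi (fun _ : Fin n => P)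
    {c | ¬ ∀ x : Fin n → Space T d, IsCorruption ε c x →
      ∃ (y : Space T d) (m : ℕ), OnlineRun prog ε x y m ∧ ‖y - mean P‖ ≤ err} ≤ τ

end OnlineMean

/-! The algorithm keeps one vector of removed weights `z` with entries in [0,1] through all rounds
and only increases it. In each round it filters on the coordinates revealed so far: while the
weighted covariance about the weighted mean reaches 1+10Λ in some direction `v` (all covariances
being normalized by `n`), every sample loses a fraction of its remaining weight proportional to its
score in direction `v`. The output is the new batch of the weighted mean.

Why filtering works. With high probability the corrupted data contain a set `G`, missing at most 2εn
samples, whose projections in every direction have small mean, controlled second moment and a light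
upper tail, at a scale `L`: constant for bounded covariance, of order ε log(1/ε) for sub-Gaussian
distributions. If the test fails, most of the surplus comes from outside `G`, so no more mass is
removed from `G` than from its complement (`Stable.scores_good_le`), and the removed mass stays
O(εn). If the test passes, then by `Stable.regular` the weighted mean is within O(√(εL)) of the
truth, and moreover every family of weights `u ≤ 1 - z` of mass O(εn) has second moment O(Ln) in
every direction.

Why the online error is only logarithmically worse. Batch `t` is estimated with the weights of round
`t`, not with the final ones. For rounds `s ≤ e` put `u = z_e - z_s`. On the coordinates known in
round `s`, Cauchy-Schwarz and the second-moment bound give that the squared norm of `∑ u_i (x_i -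
μ)` is at most 41 L n times the mass removed between `s` and `e` (`normSq_light_sum_le`). Such
masses are additive and total at most 8εn, so a dyadic argument of Rademacher-Menshov type
(`dyadic_sum_le`) bounds the sum over all batches by O(log² T) n² εL. Division by the total weight,
at least n/2, gives the error (`sum_sq_error_le`).

Why one program serves both classes. It starts in a sub-Gaussian mode with Λ = min(2εθ, 6) and
scores cut off at 2θ. On a sub-Gaussian sample with 2εθ ≤ 6 the removed mass never exceeds 4εn and
some score is always positive when the test fails. If either property breaks, the program switches
for good to Λ = 6 and no cutoff, having lost at most 4εn of good mass. When 2εθ > 6, the guarantee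
for bounded covariance is already strong enough. The number θ is a rational `q`, the only place
where `K` enters, times the sum of 1/(j+nε), which replaces log(1/ε).

Why the machine can do it in polynomial time. Positive definiteness is decided by Gram-Schmidt
orthogonalization, which needs no roots or eigenvectors, and a failed test yields an explicit bad
direction. Each removal step takes all weight from some sample, so `n + 2` steps per round suffice.
The program is written in a small language of array assignments with bounded sums and suprema,
compiled correctly with a polynomial time bound (`ArrayProg.exec_compile`, `ArrayProg.time_le`).

The existence of `G` comes from second-moment bounds on all coordinates and their products (after
truncation for bounded covariance), and for the sub-Gaussian tail from a Chernoff bound on a grid.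
-/

namespace RealRAM

/-! ### A language with bounded sums and suprema, and its compilation -/

/-- The counting loop: register `r` runs through the numbers below the content of register `N`. -/
def forLoop (r N : ℕ) (c : Cmd) : Cmd :=
  .seq (.setNat r (.const 0))
    (.while (.natLt (.reg r) (.reg N)) (.seq c (.setNat r (.add (.reg r) (.const 1)))))

/-- `I i` describes the state just before pass `i`, with the counter already equal to `i`; this is
why the body must establish `I (i + 1)` only after the increment. Each pass pays 4 for the test and
4 for the increment; the 6 pays for the initialization and the failing test. -/
theorem exec_forLoop {r N n b : ℕ} {c : Cmd} (I : ℕ → State → Prop) (s : State)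
    (h0 : I 0 (s.setNat r 0))
    (hr : ∀ i s, I i s → s.nat r = i ∧ s.nat N = n)
    (hstep : ∀ i < n, ∀ s, I i s → ∃ m s', Exec c s m s' ∧ m ≤ b ∧ s'.nat r = i ∧
      I (i + 1) (s'.setNat r (i + 1))) :
    ∃ m s', Exec (forLoop r N c) s m s' ∧ m ≤ n * (b + 8) + 6 ∧ I n s' := by
  have main : ∀ k i, i + k = n → ∀ s, I i s → ∃ m s',
      Exec (.while (.natLt (.reg r) (.reg N)) (.seq c (.setNat r (.add (.reg r) (.const 1)))))
        s m s' ∧ m ≤ k * (b + 8) + 4 ∧ I n s' := by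
    intro k
    induction k with
    | zero =>
      intro i hi s hs
      obtain rfl : i = n := by omega
      refine ⟨_, s, .whileFalse ?_, ?_, hs⟩
      · have := hr _ _ hs
        simp [BExpr.eval, NExpr.eval, this.1, this.2]
      · simp [BExpr.cost, NExpr.cost]
    | succ k ih =>
      intro i hi s hs
      obtain ⟨m, s', he, hm, hri, hI⟩ := hstep i (by omega) s hs
      obtain ⟨m2, s2, he2, hm2, hI2⟩ := ih (i + 1) (by omega) _ hI
      have h := hr _ _ hs
      have e1 : Exec (.seq c (.setNat r (.add (.reg r) (.const 1)))) s
          (m + (NExpr.cost (.add (.reg r) (.const 1)) + 1)) (s'.setNat r (i + 1)) := by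
        refine .seq he ?_
        have := Exec.setNat r (.add (.reg r) (.const 1)) s'
        simpa [NExpr.eval, hri] using this
      refine ⟨_, s2, .whileTrue ?_ e1 he2, ?_, hI2⟩
      · simp only [BExpr.eval, NExpr.eval, h.1, h.2]; omega
      · simp only [BExpr.cost, NExpr.cost]
        have : (k + 1) * (b + 8) = k * (b + 8) + (b + 8) := by ring
        omega
  obtain ⟨m, s', he, hm, hI⟩ := main n 0 (by omega) _ h0
  refine ⟨_, s', .seq (.setNat r (.const 0) s) he, ?_, hI⟩
  simp only [NExpr.cost]; omega

/-- All registers of the expression are below `m`. -/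
def NExpr.Below (m : ℕ) : NExpr → Prop
  | .const _ => True
  | .reg r => r < m
  | .add e₁ e₂ => e₁.Below m ∧ e₂.Below m
  | .sub e₁ e₂ => e₁.Below m ∧ e₂.Below m

theorem NExpr.eval_congr {m : ℕ} {s s' : State} (h : ∀ r < m, s.nat r = s'.nat r) :
    ∀ e : NExpr, e.Below m → e.eval s = e.eval s'
  | .const _, _ => rfl
  | .reg _, hr => h _ hr
  | .add e₁ e₂, he => by
    simp only [NExpr.eval, eval_congr h e₁ he.1, eval_congr h e₂ he.2]
  | .sub e₁ e₂, he => by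
    simp only [NExpr.eval, eval_congr h e₁ he.1, eval_congr h e₂ he.2]

/-- The maximum of `0` and the first values of a sequence. -/
noncomputable def runningMax (f : ℕ → ℝ) : ℕ → ℝ
  | 0 => 0
  | k + 1 => max (runningMax f k) (f k)

/-- Real expressions with bounded sums, bounded suprema and case distinctions. -/
inductive SExpr : Type
  | const (q : ℚ)
  | entry (a : ℕ) (i j : NExpr)
  | add (e₁ e₂ : SExpr)
  | sub (e₁ e₂ : SExpr)
  | mul (e₁ e₂ : SExpr)
  | div (e₁ e₂ : SExpr)
  | sum (r N : ℕ) (e : SExpr)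
  | sup (r N : ℕ) (e : SExpr)
  | iteNat (i j : NExpr) (e₁ e₂ : SExpr)
  | iteReal (a b e₁ e₂ : SExpr)

/-- The array that holds intermediate results. -/
abbrev scratch : ℕ := 100

namespace SExpr

/-- The value of an expression. -/
noncomputable def eval : SExpr → State → ℝ
  | .const q, _ => (q : ℝ)
  | .entry a i j, s => s.real a (i.eval s) (j.eval s)
  | .add e₁ e₂, s => e₁.eval s + e₂.eval s
  | .sub e₁ e₂, s => e₁.eval s - e₂.eval s
  | .mul e₁ e₂, s => e₁.eval s * e₂.eval s
  | .div e₁ e₂, s => e₁.eval s / e₂.eval s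
  | .sum r N e, s => ∑ i ∈ Finset.range (s.nat N), e.eval (s.setNat r i)
  | .sup r N e, s => runningMax (fun i => e.eval (s.setNat r i)) (s.nat N)
  | .iteNat i j e₁ e₂, s => if i.eval s < j.eval s then e₁.eval s else e₂.eval s
  | .iteReal a b e₁ e₂, s => if a.eval s < b.eval s then e₁.eval s else e₂.eval s

/-- Free registers are below `m`, binders use the registers from `m` on in the order of nesting,
and the scratch array and the arrays outside `A` are not read. -/
def Wf (A : List ℕ) : SExpr → ℕ → Prop
  | .const _, _ => True
  | .entry a i j, m => a ∈ A ∧ i.Below m ∧ j.Below m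
  | .add e₁ e₂, m => e₁.Wf A m ∧ e₂.Wf A m
  | .sub e₁ e₂, m => e₁.Wf A m ∧ e₂.Wf A m
  | .mul e₁ e₂, m => e₁.Wf A m ∧ e₂.Wf A m
  | .div e₁ e₂, m => e₁.Wf A m ∧ e₂.Wf A m
  | .sum r N e, m => r = m ∧ N < m ∧ e.Wf A (m + 1)
  | .sup r N e, m => r = m ∧ N < m ∧ e.Wf A (m + 1)
  | .iteNat i j e₁ e₂, m => i.Below m ∧ j.Below m ∧ e₁.Wf A m ∧ e₂.Wf A m
  | .iteReal a b e₁ e₂, m => a.Wf A m ∧ b.Wf A m ∧ e₁.Wf A m ∧ e₂.Wf A m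

/-- Two states agree on the registers below `m` and the arrays in `A`. -/
def Agree (A : List ℕ) (m : ℕ) (s s' : State) : Prop :=
  (∀ r < m, s.nat r = s'.nat r) ∧ ∀ a ∈ A, s.real a = s'.real a

theorem Agree.setNat {A : List ℕ} {m : ℕ} {s s' : State} (h : Agree A m s s') (i : ℕ) :
    Agree A (m + 1) (s.setNat m i) (s'.setNat m i) := by
  refine ⟨fun r hr => ?_, h.2⟩
  rcases eq_or_ne r m with rfl | hne
  · simp [State.setNat]
  · simpa [State.setNat, Function.update_of_ne hne] using h.1 r (by omega)

theorem eval_congr {A : List ℕ} : ∀ (e : SExpr) {m : ℕ} {s s' : State}, e.Wf A m →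
    Agree A m s s' → e.eval s = e.eval s'
  | .const _, _, _, _, _, _ => rfl
  | .entry a i j, _, _, _, he, h => by
    simp only [eval, NExpr.eval_congr h.1 i he.2.1, NExpr.eval_congr h.1 j he.2.2, h.2 a he.1]
  | .add e₁ e₂, _, _, _, he, h => by
    simp only [eval, eval_congr e₁ he.1 h, eval_congr e₂ he.2 h]
  | .sub e₁ e₂, _, _, _, he, h => by
    simp only [eval, eval_congr e₁ he.1 h, eval_congr e₂ he.2 h]
  | .mul e₁ e₂, _, _, _, he, h => by
    simp only [eval, eval_congr e₁ he.1 h, eval_congr e₂ he.2 h]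
  | .div e₁ e₂, _, _, _, he, h => by
    simp only [eval, eval_congr e₁ he.1 h, eval_congr e₂ he.2 h]
  | .sum r N e, _, _, _, he, h => by
    obtain ⟨rfl, hN, he⟩ := he
    simp only [eval, h.1 N hN, eval_congr e he (h.setNat _)]
  | .sup r N e, _, _, _, he, h => by
    obtain ⟨rfl, hN, he⟩ := he
    simp only [eval, h.1 N hN, eval_congr e he (h.setNat _)]
  | .iteNat i j e₁ e₂, _, _, _, he, h => by
    simp only [eval, NExpr.eval_congr h.1 i he.1, NExpr.eval_congr h.1 j he.2.1,
      eval_congr e₁ he.2.2.1 h, eval_congr e₂ he.2.2.2 h]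
  | .iteReal a b e₁ e₂, _, _, _, he, h => by
    simp only [eval, eval_congr a he.1 h, eval_congr b he.2.1 h,
      eval_congr e₁ he.2.2.1 h, eval_congr e₂ he.2.2.2 h]

/-- The cell of the scratch array in row `k`. -/
def cell (k : ℕ) : RExpr := .entry scratch (.const k) (.const 0)

/-- Assignment to the cell of the scratch array in row `k`. -/
def setCell (k : ℕ) (e : RExpr) : Cmd := .setReal scratch (.const k) (.const 0) e

/-- A program that computes the value of an expression into row `k` of the scratch array, using
only the later rows for intermediate results. -/
def compile : SExpr → ℕ → Cmd
  | .const q, k => setCell k (.const q)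
  | .entry a i j, k => setCell k (.entry a i j)
  | .add e₁ e₂, k => .seq (e₁.compile k)
      (.seq (e₂.compile (k + 1)) (setCell k (.add (cell k) (cell (k + 1)))))
  | .sub e₁ e₂, k => .seq (e₁.compile k)
      (.seq (e₂.compile (k + 1)) (setCell k (.sub (cell k) (cell (k + 1)))))
  | .mul e₁ e₂, k => .seq (e₁.compile k)
      (.seq (e₂.compile (k + 1)) (setCell k (.mul (cell k) (cell (k + 1)))))
  | .div e₁ e₂, k => .seq (e₁.compile k)
      (.seq (e₂.compile (k + 1)) (setCell k (.div (cell k) (cell (k + 1)))))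
  | .sum r N e, k => .seq (setCell k (.const 0)) (forLoop r N (.seq (e.compile (k + 1))
      (setCell k (.add (cell k) (cell (k + 1))))))
  | .sup r N e, k => .seq (setCell k (.const 0)) (forLoop r N (.seq (e.compile (k + 1))
      (.ite (.realLt (cell k) (cell (k + 1))) (setCell k (cell (k + 1))) .skip)))
  | .iteNat i j e₁ e₂, k => .ite (.natLt i j) (e₁.compile k) (e₂.compile k)
  | .iteReal a b e₁ e₂, k => .seq (a.compile k) (.seq (b.compile (k + 1))
      (.ite (.realLt (cell k) (cell (k + 1))) (e₁.compile k) (e₂.compile k)))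

/-- A bound for the time to compute an expression when all registers are at most `B`. -/
def time (B : ℕ) : SExpr → ℕ
  | .const _ => 4
  | .entry _ i j => i.cost + j.cost + 4
  | .add e₁ e₂ => e₁.time B + e₂.time B + 10
  | .sub e₁ e₂ => e₁.time B + e₂.time B + 10
  | .mul e₁ e₂ => e₁.time B + e₂.time B + 10
  | .div e₁ e₂ => e₁.time B + e₂.time B + 10
  | .sum _ _ e => B * (e.time B + 22) + 10
  | .sup _ _ e => B * (e.time B + 22) + 10
  | .iteNat i j e₁ e₂ => i.cost + j.cost + 2 + e₁.time B + e₂.time B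
  | .iteReal a b e₁ e₂ => a.time B + b.time B + e₁.time B + e₂.time B + 8

/-- The effect of computing an expression of value `v` into row `k` of the scratch array. -/
structure Computes (c : Cmd) (m k b : ℕ) (v : ℝ) (s s' : State) : Prop where
  exec : ∃ t, Exec c s t s' ∧ t ≤ b
  nat : ∀ r < m, s'.nat r = s.nat r
  real : ∀ a, a ≠ scratch → s'.real a = s.real a
  old : ∀ i < k, s'.real scratch i = s.real scratch i
  val : s'.real scratch k 0 = v

theorem computes_setCell (m k : ℕ) (e : RExpr) (s : State) :
    Computes (setCell k e) m k (e.cost + 3) (e.eval s) s (s.setReal scratch k 0 (e.eval s)) where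
  exec := ⟨_, Exec.setReal scratch (.const k) (.const 0) e s, by simp [NExpr.cost]; omega⟩
  nat := fun _ _ => rfl
  real := fun a ha => by funext i j; simp [State.setReal, ha]
  old := fun i hi => by funext j; simp [State.setReal, hi.ne]
  val := by simp [State.setReal]

theorem Computes.agree {A : List ℕ} (hA : scratch ∉ A) {c : Cmd} {m k b : ℕ} {v : ℝ}
    {s s' : State} (h : Computes c m k b v s s') : Agree A m s s' :=
  ⟨fun r hr => (h.nat r hr).symm, fun a ha => (h.real a (by rintro rfl; exact hA ha)).symm⟩

theorem Computes.seq_of {c₁ c₂ : Cmd} {m k k₁ b₁ b₂ : ℕ} {v₁ v₂ : ℝ} {s s₁ s₂ : State}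
    (h₁ : Computes c₁ m k₁ b₁ v₁ s s₁) (h₂ : Computes c₂ m k b₂ v₂ s₁ s₂) (hk : k ≤ k₁) :
    Computes (.seq c₁ c₂) m k (b₁ + b₂) v₂ s s₂ := by
  obtain ⟨t₁, e₁, l₁⟩ := h₁.exec
  obtain ⟨t₂, e₂, l₂⟩ := h₂.exec
  exact ⟨⟨_, .seq e₁ e₂, by omega⟩, fun r hr => (h₂.nat r hr).trans (h₁.nat r hr),
    fun a ha => (h₂.real a ha).trans (h₁.real a ha),
    fun i hi => (h₂.old i hi).trans (h₁.old i (by omega)), h₂.val⟩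

theorem Computes.mono {c : Cmd} {m k b b' : ℕ} {v : ℝ} {s s' : State}
    (h : Computes c m k b v s s') (hb : b ≤ b') : Computes c m k b' v s s' := by
  obtain ⟨t, e, l⟩ := h.exec
  exact ⟨⟨t, e, l.trans hb⟩, h.nat, h.real, h.old, h.val⟩

theorem Computes.binary {c₁ c₂ : Cmd} {m k b₁ b₂ : ℕ} {v₁ v₂ : ℝ} {s s₁ s₂ : State}
    (h₁ : Computes c₁ m k b₁ v₁ s s₁) (h₂ : Computes c₂ m (k + 1) b₂ v₂ s₁ s₂)
    (e : RExpr) (v : ℝ) (hcost : e.cost ≤ 7)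
    (hv : ∀ u : State, u.real scratch k 0 = v₁ → u.real scratch (k + 1) 0 = v₂ → e.eval u = v) :
    ∃ s', Computes (.seq c₁ (.seq c₂ (setCell k e))) m k (b₁ + b₂ + 10) v s s' := by
  have h := computes_setCell m k e s₂
  rw [hv s₂ (by rw [h₂.old k (by omega), h₁.val]) h₂.val] at h
  exact ⟨_, (h₁.seq_of (h₂.seq_of h (by omega)) le_rfl).mono (by omega)⟩

/-- The common core of sums and suprema: `c` computes the next term into row `k + 1`, `cm` merges it
into the partial result `g i` in row `k`. Merging costs at most 14 and the loop 8 per pass, hence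
the 22. -/
theorem exec_accumulate {m k B b : ℕ} {N : ℕ} (c cm : Cmd) (f : ℕ → ℝ) (g : ℕ → ℝ) (s : State)
    (hN : N < m) (hB : s.nat N ≤ B) (hg : g 0 = 0)
    (hc : ∀ i < s.nat N, ∀ u : State, (∀ r < m, u.nat r = s.nat r) → u.nat m = i →
      (∀ a, a ≠ scratch → u.real a = s.real a) →
      ∃ u', Computes c (m + 1) (k + 1) b (f i) u u')
    (hcm : ∀ i < s.nat N, ∀ u : State, u.real scratch k 0 = g i →
      u.real scratch (k + 1) 0 = f i → ∃ u', Computes cm (m + 1) k 14 (g (i + 1)) u u') :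
    ∃ s', Computes (.seq (setCell k (.const 0)) (forLoop m N (.seq c cm))) m k
      (B * (b + 22) + 10) (g (s.nat N)) s s' := by
  have h1 := computes_setCell m k (.const 0) s
  set s1 := s.setReal scratch k 0 (RExpr.eval s (.const 0)) with hs1
  let I : ℕ → State → Prop := fun i u => (∀ r < m, u.nat r = s.nat r) ∧ u.nat m = i ∧
    (∀ a, a ≠ scratch → u.real a = s.real a) ∧ (∀ i < k, u.real scratch i = s.real scratch i) ∧
    u.real scratch k 0 = g i
  have key : ∃ t s', Exec (forLoop m N (.seq c cm)) s1 t s' ∧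
      t ≤ s.nat N * (b + 14 + 8) + 6 ∧ I (s.nat N) s' := by
    refine exec_forLoop I s1 ?_ ?_ ?_
    · show I 0 _
      refine ⟨fun r hr => ?_, ?_, h1.real, h1.old, ?_⟩
      · simp [State.setNat, Function.update_of_ne hr.ne, hs1, State.setReal]
      · simp [State.setNat]
      · rw [hg]; have := h1.val; simpa [RExpr.eval, State.setNat] using this
    · intro i u hu
      exact ⟨hu.2.1, hu.1 N hN⟩
    · intro i hi u hu
      obtain ⟨u1, hu1⟩ := hc i hi u hu.1 hu.2.1 hu.2.2.1
      obtain ⟨u2, hu2⟩ := hcm i hi u1 (by rw [hu1.old k (by omega), hu.2.2.2.2]) hu1.val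
      have h := hu1.seq_of hu2 (by omega)
      obtain ⟨t, et, lt⟩ := h.exec
      refine ⟨t, u2, et, lt, by rw [h.nat m (by omega), hu.2.1], ?_⟩
      refine ⟨fun r hr => ?_, by simp [State.setNat], fun a ha => ?_, fun j hj => ?_, h.val⟩
      · simp only [State.setNat, Function.update_of_ne hr.ne]
        rw [h.nat r (by omega), hu.1 r hr]
      · exact (h.real a ha).trans (hu.2.2.1 a ha)
      · exact (h.old j hj).trans (hu.2.2.2.1 j hj)
  obtain ⟨t, s', he, ht, hI⟩ := key
  obtain ⟨t1, e1, l1⟩ := h1.exec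
  refine ⟨s', ⟨⟨_, .seq e1 he, ?_⟩, hI.1, hI.2.2.1, hI.2.2.2.1, hI.2.2.2.2⟩⟩
  have := Nat.mul_le_mul_right (b + 22) hB
  simp only [RExpr.cost] at l1
  have ht' : t ≤ s.nat N * (b + 22) + 6 := ht
  omega

theorem computes_loop_body {A : List ℕ} (hA : scratch ∉ A) {B r N : ℕ} {e : SExpr} {k : ℕ}
    {s : State} (hN : N < r) (he : e.Wf A (r + 1)) (hB : ∀ i < r, s.nat i ≤ B)
    (ih : ∀ u : State, (∀ j < r + 1, u.nat j ≤ B) →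
      ∃ u', Computes (e.compile (k + 1)) (r + 1) (k + 1) (e.time B) (e.eval u) u u') :
    ∀ i < s.nat N, ∀ u : State, (∀ j < r, u.nat j = s.nat j) → u.nat r = i →
      (∀ a, a ≠ scratch → u.real a = s.real a) →
      ∃ u', Computes (e.compile (k + 1)) (r + 1) (k + 1) (e.time B)
        (e.eval (s.setNat r i)) u u' := by
  intro i hi u h1 h2 h3
  have hag : Agree A (r + 1) (s.setNat r i) u := by
    refine ⟨fun j hj => ?_, fun a ha => (h3 a (by rintro rfl; exact hA ha)).symm⟩
    rcases eq_or_ne j r with rfl | hne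
    · simp [State.setNat, h2]
    · simp [State.setNat, Function.update_of_ne hne, h1 j (by omega)]
  have hu : ∀ j < r + 1, u.nat j ≤ B := fun j hj => by
    rcases eq_or_ne j r with rfl | hne
    · have := hB N hN
      omega
    · rw [h1 j (by omega)]
      exact hB j (by omega)
  rw [eval_congr e he hag]
  exact ih u hu

/-- Induction on the expression. The first operand waits in row `k` while the second is computed
using only later rows, and binders touch only registers from `m` on, so the second operand still
sees the original memory in everything that it reads. -/
theorem compile_computes {A : List ℕ} (hA : scratch ∉ A) {B : ℕ} (e : SExpr) :
    ∀ {m : ℕ} (k : ℕ) (s : State), e.Wf A m → (∀ r < m, s.nat r ≤ B) →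
      ∃ s', Computes (e.compile k) m k (e.time B) (e.eval s) s s' := by
  induction e with
  | const q => exact fun k s _ _ => ⟨_, computes_setCell _ k (.const q) s⟩
  | entry a i j =>
    exact fun k s _ _ => ⟨_, (computes_setCell _ k (.entry a i j) s).mono (by simp only [RExpr.cost, time]; omega)⟩
  | add e₁ e₂ ih₁ ih₂ =>
    intro m k s he hB
    obtain ⟨s1, h1⟩ := ih₁ k s he.1 hB
    obtain ⟨s2, h2⟩ := ih₂ (k + 1) s1 he.2
      (fun r hr => (h1.nat r hr).trans_le (hB r hr))
    rw [← eval_congr e₂ he.2 (h1.agree hA)] at h2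
    exact h1.binary h2 _ _ (by simp [RExpr.cost, cell, NExpr.cost])
      (fun u hu hu' => by simp [RExpr.eval, cell, NExpr.eval, hu, hu', eval])
  | sub e₁ e₂ ih₁ ih₂ =>
    intro m k s he hB
    obtain ⟨s1, h1⟩ := ih₁ k s he.1 hB
    obtain ⟨s2, h2⟩ := ih₂ (k + 1) s1 he.2
      (fun r hr => (h1.nat r hr).trans_le (hB r hr))
    rw [← eval_congr e₂ he.2 (h1.agree hA)] at h2
    exact h1.binary h2 _ _ (by simp [RExpr.cost, cell, NExpr.cost])
      (fun u hu hu' => by simp [RExpr.eval, cell, NExpr.eval, hu, hu', eval])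
  | mul e₁ e₂ ih₁ ih₂ =>
    intro m k s he hB
    obtain ⟨s1, h1⟩ := ih₁ k s he.1 hB
    obtain ⟨s2, h2⟩ := ih₂ (k + 1) s1 he.2
      (fun r hr => (h1.nat r hr).trans_le (hB r hr))
    rw [← eval_congr e₂ he.2 (h1.agree hA)] at h2
    exact h1.binary h2 _ _ (by simp [RExpr.cost, cell, NExpr.cost])
      (fun u hu hu' => by simp [RExpr.eval, cell, NExpr.eval, hu, hu', eval])
  | div e₁ e₂ ih₁ ih₂ =>
    intro m k s he hB
    obtain ⟨s1, h1⟩ := ih₁ k s he.1 hB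
    obtain ⟨s2, h2⟩ := ih₂ (k + 1) s1 he.2
      (fun r hr => (h1.nat r hr).trans_le (hB r hr))
    rw [← eval_congr e₂ he.2 (h1.agree hA)] at h2
    exact h1.binary h2 _ _ (by simp [RExpr.cost, cell, NExpr.cost])
      (fun u hu hu' => by simp [RExpr.eval, cell, NExpr.eval, hu, hu', eval])
  | sum r N e ih =>
    intro m k s he hB
    obtain ⟨rfl, hN, he⟩ := he
    refine exec_accumulate (k := k) (b := e.time B) (e.compile (k + 1))
      (setCell k (.add (cell k) (cell (k + 1)))) (fun i => e.eval (s.setNat r i))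
      (fun j => ∑ i ∈ Finset.range j, e.eval (s.setNat r i)) s hN (hB N hN) (by simp)
      (computes_loop_body hA hN he hB fun u hu => ih (k + 1) u he hu) fun i _ u h1 h2 =>
        ⟨u.setReal scratch k 0 (RExpr.eval u (.add (cell k) (cell (k + 1)))), ?_⟩
    rw [Finset.sum_range_succ, ← h1, ← h2]
    exact (computes_setCell (r + 1) k _ u).mono (by simp [RExpr.cost, cell, NExpr.cost])
  | sup r N e ih =>
    intro m k s he hB
    obtain ⟨rfl, hN, he⟩ := he
    refine exec_accumulate (k := k) (b := e.time B) (e.compile (k + 1))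
      (.ite (.realLt (cell k) (cell (k + 1))) (setCell k (cell (k + 1))) .skip)
      (fun i => e.eval (s.setNat r i))
      (fun j => runningMax (fun i => e.eval (s.setNat r i)) j) s hN (hB N hN) rfl
      (computes_loop_body hA hN he hB fun u hu => ih (k + 1) u he hu) fun i _ u h1 h2 => ?_
    by_cases h : u.real scratch k 0 < u.real scratch (k + 1) 0
    · obtain ⟨t, et, lt⟩ := (computes_setCell (r + 1) k (cell (k + 1)) u).exec
      have hc := computes_setCell (r + 1) k (cell (k + 1)) u
      refine ⟨_, ⟨⟨_, .iteTrue h et, ?_⟩, hc.nat, hc.real, hc.old, ?_⟩⟩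
      · simp only [BExpr.cost, cell, RExpr.cost, NExpr.cost] at lt ⊢; omega
      · rw [hc.val]
        rw [h1, h2] at h
        simp only [RExpr.eval, cell, NExpr.eval, h2, runningMax]
        exact (max_eq_right h.le).symm
    · refine ⟨u, ⟨⟨_, .iteFalse h (.skip u), ?_⟩, fun _ _ => rfl, fun _ _ => rfl,
        fun _ _ => rfl, ?_⟩⟩
      · simp [BExpr.cost, cell, RExpr.cost, NExpr.cost]
      · rw [h1, h2] at h
        rw [h1]
        exact (max_eq_left (not_lt.mp h)).symm
  | iteNat i j e₁ e₂ ih₁ ih₂ =>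
    intro m k s he hB
    by_cases h : i.eval s < j.eval s
    · obtain ⟨s1, h1⟩ := ih₁ k s he.2.2.1 hB
      obtain ⟨t, et, lt⟩ := h1.exec
      refine ⟨s1, ⟨⟨_, .iteTrue h et, ?_⟩, h1.nat, h1.real, h1.old, ?_⟩⟩
      · simp only [BExpr.cost, time]; omega
      · simp only [eval, if_pos h, h1.val]
    · obtain ⟨s1, h1⟩ := ih₂ k s he.2.2.2 hB
      obtain ⟨t, et, lt⟩ := h1.exec
      refine ⟨s1, ⟨⟨_, .iteFalse h et, ?_⟩, h1.nat, h1.real, h1.old, ?_⟩⟩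
      · simp only [BExpr.cost, time]; omega
      · simp only [eval, if_neg h, h1.val]
  | iteReal a b e₁ e₂ iha ihb ih₁ ih₂ =>
    intro m k s he hB
    obtain ⟨s1, h1⟩ := iha k s he.1 hB
    obtain ⟨s2, h2⟩ := ihb (k + 1) s1 he.2.1
      (fun r hr => (h1.nat r hr).trans_le (hB r hr))
    rw [← eval_congr b he.2.1 (h1.agree hA)] at h2
    have h12 : Agree A m s s2 := ⟨fun r hr => ((h2.nat r hr).trans (h1.nat r hr)).symm,
      fun c hc => ((h1.agree hA).2 c hc).trans ((h2.agree hA).2 c hc)⟩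
    have hB2 : ∀ r < m, s2.nat r ≤ B := fun r hr => (h12.1 r hr).symm.trans_le (hB r hr)
    have hcond : BExpr.eval s2 (.realLt (cell k) (cell (k + 1))) ↔ a.eval s < b.eval s := by
      simp only [BExpr.eval, cell, RExpr.eval, NExpr.eval, h2.val, h2.old k (by omega), h1.val]
    obtain ⟨t1, et1, lt1⟩ := h1.exec
    obtain ⟨t2, et2, lt2⟩ := h2.exec
    by_cases h : a.eval s < b.eval s
    · obtain ⟨s3, h3⟩ := ih₁ k s2 he.2.2.1 hB2
      rw [← eval_congr e₁ he.2.2.1 h12] at h3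
      obtain ⟨t, et, lt⟩ := h3.exec
      refine ⟨s3, ⟨⟨_, .seq et1 (.seq et2 (.iteTrue (hcond.2 h) et)), ?_⟩, fun r hr => ?_,
        fun c hc => ?_, fun i hi => ?_, ?_⟩⟩
      · simp only [BExpr.cost, time, cell, RExpr.cost, NExpr.cost]; omega
      · rw [h3.nat r hr, h12.1 r hr]
      · rw [h3.real c hc, h2.real c hc, h1.real c hc]
      · rw [h3.old i hi, h2.old i (by omega), h1.old i hi]
      · simp only [eval, if_pos h, h3.val]
    · obtain ⟨s3, h3⟩ := ih₂ k s2 he.2.2.2 hB2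
      rw [← eval_congr e₂ he.2.2.2 h12] at h3
      obtain ⟨t, et, lt⟩ := h3.exec
      refine ⟨s3, ⟨⟨_, .seq et1 (.seq et2 (.iteFalse (fun hc => h (hcond.1 hc)) et)), ?_⟩,
        fun r hr => ?_, fun c hc => ?_, fun i hi => ?_, ?_⟩⟩
      · simp only [BExpr.cost, time, cell, RExpr.cost, NExpr.cost]; omega
      · rw [h3.nat r hr, h12.1 r hr]
      · rw [h3.real c hc, h2.real c hc, h1.real c hc]
      · rw [h3.old i hi, h2.old i (by omega), h1.old i hi]
      · simp only [eval, if_neg h, h3.val]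
end SExpr

end RealRAM

namespace RealRAM

/-! ### Array programs -/

/-- Programs that fill rectangular parts of arrays, and loops over such programs. The entry in row
`ro + i` and column `co + j` of array `a` receives the value of `e` with `i` and `j` in the
registers `10` and `11`, where `i` and `j` are below the contents of `N₁` and `N₂`. -/
inductive ArrayProg : Type
  | fill (a : ℕ) (ro co : NExpr) (N₁ N₂ : ℕ) (e : SExpr)
  | seq (c₁ c₂ : ArrayProg)
  | loop (r N : ℕ) (c : ArrayProg)

namespace ArrayProg

/-- The entries that a `fill` command writes. -/
def Target (s : State) (ro co : NExpr) (N₁ N₂ i j : ℕ) : Prop :=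
  (ro.eval s ≤ i ∧ i < ro.eval s + s.nat N₁) ∧ co.eval s ≤ j ∧ j < co.eval s + s.nat N₂

open Classical in
/-- The effect of an array program on the memory, up to the auxiliary registers and arrays. -/
noncomputable def den : ArrayProg → State → State
  | .fill a ro co N₁ N₂ e, s =>
    { nat := s.nat
      real := Function.update s.real a fun i j => if Target s ro co N₁ N₂ i j then
        e.eval ((s.setNat 10 (i - ro.eval s)).setNat 11 (j - co.eval s)) else s.real a i j }
  | .seq c₁ c₂, s => c₂.den (c₁.den s)
  | .loop r N c, s =>
    (Nat.rec s (fun i u => c.den (u.setNat r i)) (s.nat N) : State).setNat r (s.nat N)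

/-- The registers that an array program writes. -/
def writes : ArrayProg → List ℕ
  | .fill .. => []
  | .seq c₁ c₂ => c₁.writes ++ c₂.writes
  | .loop r _ c => r :: c.writes

/-- Well-formed array programs: expressions do not read the array that they fill, and loops do not
write their counter or bound. -/
def Wf (A : List ℕ) : ArrayProg → Prop
  | .fill a ro co N₁ N₂ e => a ∈ A ∧ ro.Below 10 ∧ co.Below 10 ∧ N₁ < 10 ∧ N₂ < 10 ∧
      e.Wf (A.filter (· ≠ a)) 12
  | .seq c₁ c₂ => c₁.Wf A ∧ c₂.Wf A
  | .loop r N c => r < 10 ∧ N < 10 ∧ N ≠ r ∧ r ∉ c.writes ∧ N ∉ c.writes ∧ c.Wf A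

/-- The translation of array programs to programs of the machine. -/
def compile : ArrayProg → Cmd
  | .fill a ro co N₁ N₂ e => forLoop 10 N₁ (forLoop 11 N₂ (.seq (e.compile 0)
      (.setReal a (.add ro (.reg 10)) (.add co (.reg 11)) (SExpr.cell 0))))
  | .seq c₁ c₂ => .seq c₁.compile c₂.compile
  | .loop r N c => forLoop r N c.compile

/-- A bound for the running time when all registers are at most `B`. -/
def time (B : ℕ) : ArrayProg → ℕ
  | .fill _ ro co _ _ e => B * (B * (e.time B + ro.cost + co.cost + 16) + 14) + 6
  | .seq c₁ c₂ => c₁.time B + c₂.time B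
  | .loop _ _ c => B * (c.time B + 8) + 6

theorem den_nat {r : ℕ} : ∀ (c : ArrayProg) (s : State), r ∉ c.writes →
    (c.den s).nat r = s.nat r
  | .fill .., s, _ => rfl
  | .seq c₁ c₂, s, h => by
    simp only [writes, List.mem_append, not_or] at h
    simp only [den, den_nat c₂ _ h.2, den_nat c₁ _ h.1]
  | .loop q N c, s, h => by
    simp only [writes, List.mem_cons, not_or] at h
    simp only [den, State.setNat, Function.update_of_ne h.1]
    generalize s.nat N = n
    induction n with
    | zero => rfl
    | succ n ih => simp only [den_nat c _ h.2, Function.update_of_ne h.1, ih]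

theorem den_nat_le {A : List ℕ} {B : ℕ} : ∀ (c : ArrayProg) (s : State), c.Wf A →
    (∀ r < 10, s.nat r ≤ B) → ∀ r < 10, (c.den s).nat r ≤ B
  | .fill .., s, _, h => h
  | .seq c₁ c₂, s, hc, h => den_nat_le c₂ _ hc.2 (den_nat_le c₁ s hc.1 h)
  | .loop q N c, s, hc, h => by
    have hN := h N hc.2.1
    have main : ∀ n ≤ s.nat N, ∀ r < 10,
        (Nat.rec s (fun i u => c.den (u.setNat q i)) n : State).nat r ≤ B := by
      intro n
      induction n with
      | zero => exact fun _ => h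
      | succ n ih =>
        intro hn
        refine den_nat_le c _ hc.2.2.2.2.2 fun r hr => ?_
        rcases eq_or_ne r q with rfl | hne
        · simp [State.setNat]; omega
        · simpa [State.setNat, Function.update_of_ne hne] using ih (by omega) r hr
    intro r hr
    rcases eq_or_ne r q with rfl | hne
    · simp [den, State.setNat]; omega
    · simpa [den, State.setNat, Function.update_of_ne hne] using main _ le_rfl r hr

open SExpr (Agree)

/-- The machine writes entries one at a time whereas `den` writes them simultaneously. The two agree
because `e` does not read the array being filled. The state `s₀` carries the meaning; the machine
state `s` may differ from it in auxiliary registers and arrays. -/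
theorem exec_fill {A : List ℕ} (hA : scratch ∉ A) {B : ℕ} (a : ℕ) (ro co : NExpr) (N₁ N₂ : ℕ)
    (e : SExpr) (hw : (fill a ro co N₁ N₂ e).Wf A) (s₀ s : State) (hs : Agree A 10 s₀ s)
    (hB : ∀ r < 10, s.nat r ≤ B) :
    ∃ t s', Exec (fill a ro co N₁ N₂ e).compile s t s' ∧ t ≤ (fill a ro co N₁ N₂ e).time B ∧
      Agree A 10 ((fill a ro co N₁ N₂ e).den s₀) s' := by
  classical
  obtain ⟨haA, hro, hco, hN₁, hN₂, he⟩ := hw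
  have hA' : scratch ∉ A.filter (· ≠ a) := fun h => hA (List.mem_of_mem_filter h)
  set ρ := ro.eval s₀ with hρ
  set γ := co.eval s₀ with hγ
  set n₁ := s₀.nat N₁ with hn₁
  set n₂ := s₀.nat N₂ with hn₂
  let F : ℕ → ℕ → ℝ := fun i j => e.eval ((s₀.setNat 10 i).setNat 11 j)
  -- Rows before `i` are complete and row `i` is filled in its first `j` columns.
  let J : ℕ → ℕ → State → Prop := fun i j u => (∀ r < 10, u.nat r = s₀.nat r) ∧ u.nat 10 = i ∧
    (∀ b ∈ A, b ≠ a → u.real b = s₀.real b) ∧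
    ∀ p q, u.real a p q = if (ρ ≤ p ∧ p < ρ + i ∧ γ ≤ q ∧ q < γ + n₂) ∨
      (p = ρ + i ∧ γ ≤ q ∧ q < γ + j) then F (p - ρ) (q - γ) else s₀.real a p q
  have inner : ∀ i < n₁, ∀ u, J i 0 u → ∃ t u', Exec (forLoop 11 N₂ (.seq (e.compile 0)
      (.setReal a (.add ro (.reg 10)) (.add co (.reg 11)) (SExpr.cell 0)))) u t u' ∧
      t ≤ n₂ * ((e.time B + ro.cost + co.cost + 8) + 8) + 6 ∧ J i n₂ u' ∧ u'.nat 11 = n₂ := by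
    intro i hi u hu
    refine exec_forLoop (r := 11) (fun j u => J i j u ∧ u.nat 11 = j) u ?_ ?_ ?_
    · refine ⟨⟨fun r hr => ?_, ?_, hu.2.2.1, hu.2.2.2⟩, by simp [State.setNat]⟩
      · simp [State.setNat, Function.update_of_ne (show r ≠ 11 by omega), hu.1 r hr]
      · simp [State.setNat, hu.2.1]
    · exact fun j v hv => ⟨hv.2, hv.1.1 N₂ hN₂⟩
    · rintro j hj v ⟨⟨h1, h2, h3, h4⟩, h5⟩
      have hvB : ∀ r < 12, v.nat r ≤ B := by
        intro r hr
        rcases lt_or_ge r 10 with h | h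
        · rw [h1 r h, hs.1 r h]; exact hB r h
        · have hb1 : n₁ ≤ B := by rw [hn₁, hs.1 _ hN₁]; exact hB _ hN₁
          have hb2 : n₂ ≤ B := by rw [hn₂, hs.1 _ hN₂]; exact hB _ hN₂
          obtain rfl | rfl : r = 10 ∨ r = 11 := by omega
          · omega
          · omega
      obtain ⟨v1, hv1⟩ := SExpr.compile_computes hA' e 0 v he hvB
      obtain ⟨t, et, lt⟩ := hv1.exec
      have hag : Agree (A.filter (· ≠ a)) 12 ((s₀.setNat 10 i).setNat 11 j) v := by
        refine ⟨fun r hr => ?_, fun b hb => ?_⟩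
        · rcases lt_or_ge r 10 with h | h
          · simp [State.setNat, Function.update_of_ne (show r ≠ 11 by omega),
              Function.update_of_ne (show r ≠ 10 by omega), h1 r h]
          · obtain rfl | rfl : r = 10 ∨ r = 11 := by omega
            · simp [State.setNat, h2]
            · simp [State.setNat, h5]
        · simp only [List.mem_filter, decide_eq_true_eq] at hb
          exact (h3 b hb.1 hb.2).symm
      have hval : v1.real scratch 0 0 = F i j := by
        rw [hv1.val, ← SExpr.eval_congr e he hag]
      have hreal : ∀ b ∈ A, v1.real b = v.real b := fun b hb =>
        hv1.real b (by rintro rfl; exact hA hb)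
      have hroe : ro.eval v1 = ρ := NExpr.eval_congr
        (fun r hr => by rw [hv1.nat r (by omega), h1 r hr]) ro hro
      have hcoe : co.eval v1 = γ := NExpr.eval_congr
        (fun r hr => by rw [hv1.nat r (by omega), h1 r hr]) co hco
      refine ⟨_, _, .seq et (.setReal a _ _ _ v1), ?_, ?_, ⟨⟨fun r hr => ?_, ?_, ?_, ?_⟩, ?_⟩⟩
      · simp only [NExpr.cost, RExpr.cost, SExpr.cell]; omega
      · simp [State.setReal, hv1.nat 11 (by omega), h5]
      · simp [State.setReal, State.setNat, Function.update_of_ne (show r ≠ 11 by omega),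
          hv1.nat r (by omega), h1 r hr]
      · simp [State.setReal, State.setNat, hv1.nat 10 (by omega), h2]
      · intro b hb hba
        funext p q
        simp [State.setReal, State.setNat, hba, hreal b hb, h3 b hb hba]
      · intro p q
        simp only [State.setReal, State.setNat, NExpr.eval, hroe, hcoe, hv1.nat 10 (by omega),
          hv1.nat 11 (by omega), h2, h5, SExpr.cell, RExpr.eval, hval, true_and,
          hreal a haA, h4 p q]
        by_cases hp : p = ρ + i ∧ q = γ + j
        · rw [if_pos hp, if_pos (Or.inr ⟨hp.1, by omega, by omega⟩)]
          obtain ⟨rfl, rfl⟩ := hp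
          simp
        · rw [if_neg hp]
          refine if_congr ?_ rfl rfl
          omega
      · simp [State.setNat]
  have outer : ∃ t u', Exec (fill a ro co N₁ N₂ e).compile s t u' ∧
      t ≤ n₁ * ((n₂ * ((e.time B + ro.cost + co.cost + 8) + 8) + 6) + 8) + 6 ∧ J n₁ 0 u' := by
    refine exec_forLoop (r := 10) (fun i u => J i 0 u) s ?_ ?_ ?_
    · refine ⟨fun r hr => ?_, by simp [State.setNat], fun b hb _ => (hs.2 b hb).symm,
        fun p q => ?_⟩
      · simp [State.setNat, Function.update_of_ne (show r ≠ 10 by omega), hs.1 r hr]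
      · rw [if_neg (by omega)]
        exact congrFun (congrFun (hs.2 a haA).symm p) q
    · exact fun i u hu => ⟨hu.2.1, hu.1 N₁ hN₁⟩
    · intro i hi u hu
      obtain ⟨t, u', et, lt, ⟨h1, h2, h3, h4⟩, _⟩ := inner i hi u hu
      refine ⟨t, u', et, lt, h2, fun r hr => ?_, by simp [State.setNat], h3, fun p q => ?_⟩
      · simp [State.setNat, Function.update_of_ne (show r ≠ 10 by omega), h1 r hr]
      · simp only [State.setNat, h4 p q]
        refine if_congr ?_ rfl rfl
        omega
  obtain ⟨t, u', et, lt, h1, h2, h3, h4⟩ := outer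
  refine ⟨t, u', et, lt.trans ?_, fun r hr => (h1 r hr).symm, fun b hb => ?_⟩
  · have hb1 : n₁ ≤ B := by rw [hn₁, hs.1 _ hN₁]; exact hB _ hN₁
    have hb2 : n₂ ≤ B := by rw [hn₂, hs.1 _ hN₂]; exact hB _ hN₂
    simp only [time]
    gcongr ?_ + 6
    refine Nat.mul_le_mul hb1 ?_
    have := Nat.mul_le_mul_right ((e.time B + ro.cost + co.cost + 8) + 8) hb2
    have h' : B * (e.time B + ro.cost + co.cost + 8 + 8)
      = B * (e.time B + ro.cost + co.cost + 16) := rfl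
    omega
  · rcases eq_or_ne b a with rfl | hne
    · funext p q
      simp only [den, Function.update_self, h4 p q]
      refine if_congr ?_ rfl rfl
      simp only [Target, ← hρ, ← hγ, ← hn₁, ← hn₂]
      omega
    · simp [den, Function.update_of_ne hne, h3 b hb hne]

theorem exec_compile {A : List ℕ} (hA : scratch ∉ A) {B : ℕ} (c : ArrayProg) : c.Wf A →
    ∀ s₀ s : State, Agree A 10 s₀ s → (∀ r < 10, s.nat r ≤ B) →
    ∃ t s', Exec c.compile s t s' ∧ t ≤ c.time B ∧ Agree A 10 (c.den s₀) s' := by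
  induction c with
  | fill a ro co N₁ N₂ e => exact fun hw => exec_fill hA a ro co N₁ N₂ e hw
  | seq c₁ c₂ ih₁ ih₂ =>
    intro hw s₀ s hs hB
    obtain ⟨t₁, s₁, e₁, l₁, a₁⟩ := ih₁ hw.1 s₀ s hs hB
    obtain ⟨t₂, s₂, e₂, l₂, a₂⟩ := ih₂ hw.2 _ s₁ a₁ (fun r hr => by
      rw [← a₁.1 r hr]
      exact den_nat_le c₁ s₀ hw.1 (fun r hr => (hs.1 r hr).trans_le (hB r hr)) r hr)
    exact ⟨_, s₂, .seq e₁ e₂, by simp only [time]; omega, a₂⟩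
  | loop r N c ih =>
    intro hw s₀ s hs hB
    obtain ⟨hr, hN, hne, hrw, hNw, hc⟩ := hw
    have hB0 : ∀ r < 10, s₀.nat r ≤ B := fun r hr => (hs.1 r hr).trans_le (hB r hr)
    let g : ℕ → State := fun n => Nat.rec s₀ (fun i u => c.den (u.setNat r i)) n
    have hgN : ∀ n, (g n).nat N = s₀.nat N := by
      intro n
      induction n with
      | zero => rfl
      | succ n ih' =>
        show (c.den ((g n).setNat r n)).nat N = _
        rw [den_nat c _ hNw]
        simp [State.setNat, Function.update_of_ne hne, ih']
    have hset : ∀ {u v : State} (i : ℕ), (∀ q < 10, q ≠ r → u.nat q = v.nat q) →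
        (∀ a ∈ A, u.real a = v.real a) → Agree A 10 (u.setNat r i) (v.setNat r i) := by
      intro u v i h1 h2
      refine ⟨fun q hq => ?_, h2⟩
      rcases eq_or_ne q r with rfl | hqr
      · simp [State.setNat]
      · simp [State.setNat, Function.update_of_ne hqr, h1 q hq hqr]
    have hgB : ∀ n ≤ s₀.nat N, ∀ q < 10, q ≠ r → (g n).nat q ≤ B := by
      intro n
      induction n with
      | zero => exact fun _ q hq _ => hB0 q hq
      | succ n ih' =>
        intro hn q hq _
        refine den_nat_le c _ hc (fun p hp => ?_) q hq
        rcases eq_or_ne p r with rfl | hqr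
        · have := hB0 N hN
          simp [State.setNat]; omega
        · show Function.update (g n).nat r n p ≤ B
          rw [Function.update_of_ne hqr]
          exact ih' (by omega) p hp hqr
    let I : ℕ → State → Prop := fun i u => i ≤ s₀.nat N ∧ Agree A 10 ((g i).setNat r i) u
    have key : ∃ t s', Exec (forLoop r N c.compile) s t s' ∧
        t ≤ s₀.nat N * (c.time B + 8) + 6 ∧ I (s₀.nat N) s' := by
      refine exec_forLoop I s ⟨Nat.zero_le _, hset 0 (fun q hq _ => hs.1 q hq) hs.2⟩ ?_ ?_
      · rintro i u ⟨_, hu⟩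
        constructor
        · rw [← hu.1 r hr]; simp [State.setNat]
        · rw [← hu.1 N hN]; simp [State.setNat, Function.update_of_ne hne, hgN]
      · rintro i hi u ⟨_, hu⟩
        obtain ⟨t, u', et, lt, au⟩ := ih hc _ u hu (fun q hq => by
          rw [← hu.1 q hq]
          rcases eq_or_ne q r with rfl | hqr
          · have := hB0 N hN
            simp [State.setNat]; omega
          · simpa [State.setNat, Function.update_of_ne hqr] using hgB i hi.le q hq hqr)
        refine ⟨t, u', et, lt, ?_, hi, hset _ (fun q hq _ => au.1 q hq) au.2⟩
        rw [← au.1 r hr, den_nat c _ hrw]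
        simp [State.setNat]
    obtain ⟨t, s', et, lt, _, hag⟩ := key
    refine ⟨t, s', et, lt.trans ?_, hag⟩
    have := Nat.mul_le_mul_right (c.time B + 8) (hB0 N hN)
    simp only [time]; omega

end ArrayProg

/-! ### Running times are polynomial -/

/-- The degree of the polynomial bound for the time to compute an expression. -/
def SExpr.degree : SExpr → ℕ
  | .const _ => 0
  | .entry .. => 0
  | .add e₁ e₂ => e₁.degree + e₂.degree
  | .sub e₁ e₂ => e₁.degree + e₂.degree
  | .mul e₁ e₂ => e₁.degree + e₂.degree
  | .div e₁ e₂ => e₁.degree + e₂.degree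
  | .sum _ _ e => e.degree + 1
  | .sup _ _ e => e.degree + 1
  | .iteNat _ _ e₁ e₂ => e₁.degree + e₂.degree
  | .iteReal a b e₁ e₂ => a.degree + b.degree + e₁.degree + e₂.degree

/-- The time is a polynomial in `B` with natural coefficients, whose sum is its value at 1; for `1 ≤
B` every monomial is at most the power given by `degree`. -/
theorem SExpr.time_le {B : ℕ} (hB : 1 ≤ B) : ∀ e : SExpr, e.time B ≤ e.time 1 * B ^ e.degree := by
  have hp : ∀ k, 1 ≤ B ^ k := fun k => Nat.one_le_pow _ _ hB
  have two : ∀ {x y x' y' c p q : ℕ}, x ≤ x' * B ^ p → y ≤ y' * B ^ q →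
      x + y + c ≤ (x' + y' + c) * B ^ (p + q) := by
    intro x y x' y' c p q hx hy
    have h1 : x' * B ^ p ≤ x' * B ^ (p + q) :=
      Nat.mul_le_mul_left _ (Nat.pow_le_pow_right hB (by omega))
    have h2 : y' * B ^ q ≤ y' * B ^ (p + q) :=
      Nat.mul_le_mul_left _ (Nat.pow_le_pow_right hB (by omega))
    have h3 : c ≤ c * B ^ (p + q) := Nat.le_mul_of_pos_right _ (hp _)
    calc x + y + c ≤ x' * B ^ (p + q) + y' * B ^ (p + q) + c * B ^ (p + q) := by omega
      _ = _ := by ring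
  have bind : ∀ {x x' c p : ℕ}, x ≤ x' * B ^ p →
      B * (x + c) + 10 ≤ (1 * (x' + c) + 10) * B ^ (p + 1) := by
    intro x x' c p hx
    have h3 : c ≤ c * B ^ p := Nat.le_mul_of_pos_right _ (hp _)
    have h4 : 10 ≤ 10 * B ^ (p + 1) := Nat.le_mul_of_pos_right _ (hp _)
    calc B * (x + c) + 10 ≤ B * (x' * B ^ p + c * B ^ p) + 10 * B ^ (p + 1) := by gcongr
      _ = _ := by ring
  intro e
  induction e with
  | const q => simp [time, degree]
  | entry a i j => simp [time, degree]
  | add e₁ e₂ ih₁ ih₂ => exact two ih₁ ih₂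
  | sub e₁ e₂ ih₁ ih₂ => exact two ih₁ ih₂
  | mul e₁ e₂ ih₁ ih₂ => exact two ih₁ ih₂
  | div e₁ e₂ ih₁ ih₂ => exact two ih₁ ih₂
  | sum r N e ih => exact bind ih
  | sup r N e ih => exact bind ih
  | iteNat i j e₁ e₂ ih₁ ih₂ =>
    have := two (c := i.cost + j.cost + 2) ih₁ ih₂
    simp only [time, degree]
    calc _ = e₁.time B + e₂.time B + (i.cost + j.cost + 2) := by ring
      _ ≤ _ := this
      _ = _ := by ring
  | iteReal a b e₁ e₂ iha ihb ih₁ ih₂ =>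
    have := two (c := 8) (two (c := 0) (two (c := 0) iha ihb) ih₁) ih₂
    simpa only [time, degree, add_zero] using this

/-- The degree of the polynomial bound for the running time of an array program. -/
def ArrayProg.degree : ArrayProg → ℕ
  | .fill _ _ _ _ _ e => e.degree + 2
  | .seq c₁ c₂ => c₁.degree + c₂.degree
  | .loop _ _ c => c.degree + 1

theorem ArrayProg.time_le {B : ℕ} (hB : 1 ≤ B) :
    ∀ c : ArrayProg, c.time B ≤ c.time 1 * B ^ c.degree
  | .fill a ro co N₁ N₂ e => by
    have hp : ∀ k, 1 ≤ B ^ k := fun k => Nat.one_le_pow _ _ hB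
    have h := SExpr.time_le hB e
    simp only [time, degree]
    set c := ro.cost + co.cost + 16 with hc
    have h1 : e.time B + ro.cost + co.cost + 16 ≤ (e.time 1 + c) * B ^ e.degree := by
      have : c ≤ c * B ^ e.degree := Nat.le_mul_of_pos_right _ (hp _)
      calc _ = e.time B + c := by omega
        _ ≤ e.time 1 * B ^ e.degree + c * B ^ e.degree := by omega
        _ = _ := by ring
    calc B * (B * (e.time B + ro.cost + co.cost + 16) + 14) + 6
        ≤ B * (B * ((e.time 1 + c) * B ^ e.degree) + 14 * B ^ (e.degree + 1)) +
          6 * B ^ (e.degree + 2) := by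
          gcongr
          · exact Nat.le_mul_of_pos_right _ (hp _)
          · exact Nat.le_mul_of_pos_right _ (hp _)
      _ = (1 * (1 * (e.time 1 + c) + 14) + 6) * B ^ (e.degree + 2) := by ring
      _ = _ := by rw [hc]; ring
  | .seq c₁ c₂ => by
    have h1 : c₁.time 1 * B ^ c₁.degree ≤ c₁.time 1 * B ^ (c₁.degree + c₂.degree) :=
      Nat.mul_le_mul_left _ (Nat.pow_le_pow_right hB (by omega))
    have h2 : c₂.time 1 * B ^ c₂.degree ≤ c₂.time 1 * B ^ (c₁.degree + c₂.degree) :=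
      Nat.mul_le_mul_left _ (Nat.pow_le_pow_right hB (by omega))
    simp only [time, degree, add_mul]
    have := time_le hB c₁
    have := time_le hB c₂
    omega
  | .loop r N c => by
    have hp : ∀ k, 1 ≤ B ^ k := fun k => Nat.one_le_pow _ _ hB
    simp only [time, degree]
    calc B * (c.time B + 8) + 6
        ≤ B * (c.time 1 * B ^ c.degree + 8 * B ^ c.degree) + 6 * B ^ (c.degree + 1) := by
          gcongr
          · exact time_le hB c
          · exact Nat.le_mul_of_pos_right _ (hp _)
          · exact Nat.le_mul_of_pos_right _ (hp _)
      _ = _ := by ring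

end RealRAM

namespace RealRAM

/-! ### The program -/

namespace FilterProg

open NExpr (reg const)

/-- The arrays used by the program. -/
abbrev arrays : List ℕ := List.range 30

/-- Assignment to the entry in row `0` and column `0` of an array. -/
def put (a : ℕ) (e : SExpr) : ArrayProg := .fill a (const 0) (const 0) 5 5 e

/-- Assignment to row `0` of an array, of length given by register `N`. -/
def putRow (a N : ℕ) (e : SExpr) : ArrayProg := .fill a (const 0) (const 0) 5 N e

/-- The entry in row `0` and column `0` of an array. -/
def get (a : ℕ) : SExpr := .entry a (const 0) (const 0)

/-- The entry in row `0` of an array in the column given by register `r`. -/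
def getRow (a r : ℕ) : SExpr := .entry a (const 0) (reg r)

/-- The weight of the sample given by register `r`. -/
def weight (r : ℕ) : SExpr := .sub (.const 1) (getRow 4 r)

/-- Threshold, score level, total weight, weighted mean and the matrix of the test. -/
def prepare : ArrayProg :=
  .seq (put 17 (.mul (get 15) (.add (.const 1) (.mul (.const 10)
    (.iteReal (.const 0) (get 5) (.const 6)
      (.iteReal (.mul (.mul (.const 2) (get 1)) (get 16)) (.const 6)
        (.mul (.mul (.const 2) (get 1)) (get 16)) (.const 6)))))))
  (.seq (put 18 (.iteReal (.const 0) (get 5) (.const 0) (.mul (.const 2) (get 16))))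
  (.seq (put 20 (.sum 12 0 (weight 12)))
  (.seq (putRow 6 4 (.div (.sum 12 0 (.mul (weight 12) (.entry 3 (reg 12) (reg 11)))) (get 20)))
  (.fill 7 (const 0) (const 0) 4 4
    (.sub (.iteNat (reg 10) (reg 11) (.const 0) (.iteNat (reg 11) (reg 10) (.const 0) (get 17)))
      (.sum 12 0 (.mul (.mul (weight 12) (.sub (.entry 3 (reg 12) (reg 10)) (getRow 6 10)))
        (.sub (.entry 3 (reg 12) (reg 11)) (getRow 6 11)))))))))

/-- One step of the orthogonalization of the unit vectors with respect to the test matrix. -/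
def orthStep : ArrayProg :=
  .seq (putRow 8 4 (.sub
    (.iteNat (reg 9) (reg 11) (.const 0) (.iteNat (reg 11) (reg 9) (.const 0) (.const 1)))
    (.sum 12 9 (.mul (.div (.sum 13 4 (.mul (.entry 7 (reg 9) (reg 13))
      (.entry 9 (reg 12) (reg 13)))) (getRow 10 12)) (.entry 9 (reg 12) (reg 11))))))
  (.seq (.fill 9 (reg 9) (const 0) 5 4 (getRow 8 11))
  (.fill 10 (const 0) (reg 9) 5 5 (.sum 12 4 (.sum 13 4 (.mul (.mul (.entry 9 (reg 9) (reg 12))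
    (.entry 7 (reg 12) (reg 13))) (.entry 9 (reg 9) (reg 13)))))))

/-- Choice of the direction, the scores, and the update of the removed weights and the mode. -/
def update : ArrayProg :=
  .seq (putRow 11 4 (.sum 12 4 (.iteReal (.const 0) (getRow 10 12) (.const 0)
    (.iteReal (.const 0) (.sum 13 12 (.iteReal (.const 0) (getRow 10 13) (.const 0) (.const 1)))
      (.const 0) (.entry 9 (reg 12) (reg 11))))))
  (.seq (putRow 22 0 (.sum 12 4 (.mul (getRow 11 12)
    (.sub (.entry 3 (reg 11) (reg 12)) (getRow 6 12)))))
  (.seq (putRow 12 0 (.sup 12 5 (.sub (.mul (getRow 22 11) (getRow 22 11))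
    (.mul (get 18) (.sum 13 4 (.mul (getRow 11 13) (getRow 11 13)))))))
  (.seq (put 13 (.sup 12 0 (.iteReal (getRow 4 12) (.const 1) (getRow 12 12) (.const 0))))
  (.seq (putRow 14 0 (.add (getRow 4 11) (.div (.mul (weight 11) (getRow 12 11)) (get 13))))
  (.seq (put 19 (.iteReal (.const 0) (get 5) (.const 0)
    (.iteReal (.mul (.mul (.const 4) (get 1)) (get 15)) (.sum 12 0 (getRow 14 12)) (.const 1)
      (.iteReal (.const 0) (get 13) (.const 0) (.iteReal (.const 0)
        (.sum 12 4 (.mul (getRow 11 12) (getRow 11 12))) (.const 1) (.const 0))))))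
  -- The new weights and mode pass through arrays 23 and 24 because a `fill` may not read its own
  -- target.
  (.seq (putRow 23 0 (.iteReal (.const 0) (get 19) (getRow 4 11) (getRow 14 11)))
  (.seq (putRow 4 0 (getRow 23 11))
  (.seq (put 24 (.iteReal (.const 0) (get 19) (.const 1) (get 5)))
  (put 5 (get 24))))))))))

/-- One filter step. -/
def filterStep : ArrayProg := .seq prepare (.seq (.loop 9 4 orthStep) update)

/-- The number of samples as a real number, and the score level of the mode for sub-Gaussian
distributions, from the constant `q`. -/
def parameters (q : ℚ) : ArrayProg :=
  -- Registers cannot be read as reals; `n` is obtained as a sum of `n` ones, and the summation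
  -- index `j` below in the same way.
  .seq (put 15 (.sum 12 0 (.const 1)))
  (put 16 (.mul (.const q) (.sum 12 0 (.div (.const 1)
    (.add (.sum 13 12 (.const 1)) (.mul (get 15) (get 1)))))))

/-- The part of a round after the registers have been set. -/
def roundProg (q : ℚ) : ArrayProg :=
  .seq (.fill 3 (const 0) (reg 6) 0 1 (.entry 0 (reg 10) (reg 11)))
  (.seq (parameters q)
  (.seq (.loop 8 7 filterStep)
  (.seq (put 21 (.sum 12 0 (weight 12)))
  (putRow 2 1 (.div (.sum 12 0 (.mul (weight 12) (.entry 3 (reg 12) (.add (reg 6) (reg 11)))))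
    (get 21))))))

/-- The program: register `4` holds the number of coordinates revealed so far, register `6` the
number of coordinates revealed in the earlier rounds. -/
def program (q : ℚ) : Cmd :=
  .seq (.setNat 5 (const 1)) (.seq (.setNat 6 (reg 4)) (.seq (.setNat 4 (.add (reg 4) (reg 1)))
    (.seq (.setNat 7 (.add (reg 0) (const 2))) (roundProg q).compile)))

theorem wf_round (q : ℚ) : (roundProg q).Wf arrays := by
  simp [roundProg, parameters, filterStep, prepare, orthStep, update, put, putRow, ArrayProg.Wf,
    SExpr.Wf, NExpr.Below, get, getRow, weight, ArrayProg.writes]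

/-! ### Postconditions of the program and its description as a sequence of filter steps -/

theorem fill_spec (a : ℕ) (ro co : NExpr) (N₁ N₂ : ℕ) (e : SExpr) (s : State) :
    ∃ F : ℕ → ℕ → ℝ, (ArrayProg.fill a ro co N₁ N₂ e).den s =
        ⟨s.nat, Function.update s.real a F⟩ ∧
      (∀ i < s.nat N₁, ∀ j < s.nat N₂, F (ro.eval s + i) (co.eval s + j) =
        e.eval ((s.setNat 10 i).setNat 11 j)) ∧
      ∀ i j, (i < ro.eval s ∨ ro.eval s + s.nat N₁ ≤ i ∨ j < co.eval s ∨
        co.eval s + s.nat N₂ ≤ j) → F i j = s.real a i j := by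
  refine ⟨_, rfl, fun i hi j hj => ?_, fun i j h => ?_⟩
  · rw [if_pos ⟨⟨by omega, by omega⟩, by omega, by omega⟩]
    simp
  · exact if_neg fun hT => by
      obtain ⟨⟨_, _⟩, _, _⟩ := hT
      omega

/-- The property `Q` holds after the execution of `c`. -/
def Post (c : ArrayProg) (s : State) (Q : State → Prop) : Prop := Q (c.den s)

theorem Post.seq {c₁ c₂ : ArrayProg} {s : State} {Q : State → Prop}
    (h : Post c₁ s fun s' => Post c₂ s' Q) : Post (.seq c₁ c₂) s Q := h

theorem Post.seq_den {c₁ c₂ : ArrayProg} {s : State} {Q : State → Prop}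
    (h : Post c₂ (c₁.den s) Q) : Post (.seq c₁ c₂) s Q := h

theorem Post.fill {a : ℕ} {ro co : NExpr} {N₁ N₂ : ℕ} {e : SExpr} {s : State} {Q : State → Prop}
    (h : ∀ F : ℕ → ℕ → ℝ, (∀ i < s.nat N₁, ∀ j < s.nat N₂, F (ro.eval s + i) (co.eval s + j) =
        e.eval ((s.setNat 10 i).setNat 11 j)) →
      (∀ i j, (i < ro.eval s ∨ ro.eval s + s.nat N₁ ≤ i ∨ j < co.eval s ∨
        co.eval s + s.nat N₂ ≤ j) → F i j = s.real a i j) →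
      Q ⟨s.nat, Function.update s.real a F⟩) :
    Post (.fill a ro co N₁ N₂ e) s Q := by
  obtain ⟨F, hF, h1, h2⟩ := fill_spec a ro co N₁ N₂ e s
  rw [Post, hF]
  exact h F h1 h2

theorem Post.fillBlock {a N₁ N₂ : ℕ} {e : SExpr} {s : State} {Q : State → Prop}
    (h : ∀ F : ℕ → ℕ → ℝ, (∀ i < s.nat N₁, ∀ j < s.nat N₂, F i j =
        e.eval ((s.setNat 10 i).setNat 11 j)) → Q ⟨s.nat, Function.update s.real a F⟩) :
    Post (.fill a (const 0) (const 0) N₁ N₂ e) s Q :=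
  Post.fill fun F hF _ => h F fun i hi j hj => by simpa [NExpr.eval] using hF i hi j hj

theorem Post.putRow {a N : ℕ} {e : SExpr} {s : State} {Q : State → Prop} (h1 : s.nat 5 = 1)
    (h : ∀ F : ℕ → ℕ → ℝ, (∀ j < s.nat N, F 0 j = e.eval ((s.setNat 10 0).setNat 11 j)) →
      Q ⟨s.nat, Function.update s.real a F⟩) : Post (putRow a N e) s Q :=
  Post.fillBlock fun F hF => h F fun j hj => hF 0 (by omega) j hj

theorem Post.put {a : ℕ} {e : SExpr} {s : State} {Q : State → Prop} (h1 : s.nat 5 = 1)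
    (h : ∀ F : ℕ → ℕ → ℝ, F 0 0 = e.eval ((s.setNat 10 0).setNat 11 0) →
      Q ⟨s.nat, Function.update s.real a F⟩) : Post (put a e) s Q :=
  Post.putRow h1 fun F hF => h F (hF 0 (by omega))

/-- The weighted mean of the samples `x` with removed weights `z`. -/
noncomputable def wmean (n : ℕ) (x : ℕ → ℕ → ℝ) (z : ℕ → ℝ) (p : ℕ) : ℝ :=
  (∑ i ∈ Finset.range n, (1 - z i) * x i p) / ∑ i ∈ Finset.range n, (1 - z i)

/-- The covariance bound `Λ` of the present mode. -/
noncomputable def bound (ε θ mode : ℝ) : ℝ := if 0 < mode then 6 else min (2 * ε * θ) 6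

/-- The level of the scores in the present mode. -/
noncomputable def level (θ mode : ℝ) : ℝ := if 0 < mode then 0 else 2 * θ

/-- The test matrix. -/
noncomputable def testMatrix (n : ℕ) (ε θ : ℝ) (x : ℕ → ℕ → ℝ) (z : ℕ → ℝ) (mode : ℝ)
    (p p' : ℕ) : ℝ :=
  (if p = p' then n * (1 + 10 * bound ε θ mode) else 0) -
    ∑ i ∈ Finset.range n, (1 - z i) * (x i p - wmean n x z p) * (x i p' - wmean n x z p')

theorem prepare_spec (s : State) (h5 : s.nat 5 = 1) (hN : s.real 15 0 0 = s.nat 0) :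
    Post prepare s fun s' => s'.nat = s.nat ∧
      (∀ a ∉ [6, 7, 17, 18, 20], s'.real a = s.real a) ∧
      s'.real 18 0 0 = level (s.real 16 0 0) (s.real 5 0 0) ∧
      (∀ p < s.nat 4, s'.real 6 0 p = wmean (s.nat 0) (s.real 3) (s.real 4 0) p) ∧
      ∀ p < s.nat 4, ∀ p' < s.nat 4, s'.real 7 p p' =
        testMatrix (s.nat 0) (s.real 1 0 0) (s.real 16 0 0) (s.real 3) (s.real 4 0)
          (s.real 5 0 0) p p' := by
  refine .seq (.put h5 fun F1 v1 => .seq (.put h5 fun F2 v2 => .seq (.put h5 fun F3 v3 =>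
    .seq (.putRow h5 fun F4 v4 => .fillBlock fun F5 v5 => ?_))))
  simp only [SExpr.eval, NExpr.eval, State.setNat, Function.update_apply, get, getRow, weight,
    Nat.reduceEqDiff, if_true, if_false, Rat.cast_one, Rat.cast_zero, Rat.cast_ofNat] at v1 v2 v3 v4 v5 ⊢
  rw [hN] at v1
  rw [v3] at v4
  refine ⟨trivial, fun a ha => ?_, v2, v4, fun p hp p' hp' => ?_⟩
  · simp only [List.mem_cons, List.not_mem_nil, or_false, not_or] at ha
    simp [ha]
  rw [v5 p hp p' hp', v1]
  have hb : bound (s.real 1 0 0) (s.real 16 0 0) (s.real 5 0 0) = if 0 < s.real 5 0 0 then 6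
      else if 2 * s.real 1 0 0 * s.real 16 0 0 < 6 then 2 * s.real 1 0 0 * s.real 16 0 0
        else 6 := by
    rw [bound, min_def_lt]
  have e4 : ∀ p < s.nat 4, F4 0 p = wmean (s.nat 0) (s.real 3) (s.real 4 0) p := v4
  rw [← hb, testMatrix, e4 p hp, e4 p' hp']
  congr 1
  rcases lt_trichotomy p p' with h | h | h
  · simp [h, h.ne]
  · simp [h]
  · simp [h, h.ne', h.not_gt]

/-- The vectors `U k` arise from the unit vectors by orthogonalization with respect to the bilinear
form of the matrix `S`, and the numbers `Q k` are the values of the quadratic form. -/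
def IsOrth (D : ℕ) (S U : ℕ → ℕ → ℝ) (Q : ℕ → ℝ) (k : ℕ) : Prop :=
  (∀ j < D, U k j = (if j = k then 1 else 0) - ∑ l ∈ Finset.range k,
    (∑ p ∈ Finset.range D, S k p * U l p) / Q l * U l j) ∧
  Q k = ∑ p ∈ Finset.range D, ∑ p' ∈ Finset.range D, U k p * S p p' * U k p'

/-- Only the vectors up to index `k` enter, so the relation survives the later passes of the loop,
which write further rows. -/
theorem IsOrth.congr {D k : ℕ} {S U U' : ℕ → ℕ → ℝ} {Q Q' : ℕ → ℝ} (h : IsOrth D S U Q k)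
    (hU : ∀ l ≤ k, ∀ j < D, U' l j = U l j) (hQ : ∀ l ≤ k, Q' l = Q l) : IsOrth D S U' Q' k := by
  constructor
  · intro j hj
    rw [hU k le_rfl j hj, h.1 j hj]
    refine congrArg _ (Finset.sum_congr rfl fun l hl => ?_)
    have hl' := (Finset.mem_range.1 hl).le
    rw [hU l hl' j hj, hQ l hl']
    congr 2
    exact Finset.sum_congr rfl fun p hp => by rw [hU l hl' p (Finset.mem_range.1 hp)]
  · rw [hQ k le_rfl, h.2]
    refine Finset.sum_congr rfl fun p hp => Finset.sum_congr rfl fun p' hp' => ?_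
    rw [hU k le_rfl p (Finset.mem_range.1 hp), hU k le_rfl p' (Finset.mem_range.1 hp')]

theorem orthStep_spec (s : State) (h5 : s.nat 5 = 1) :
    Post orthStep s fun s' => s'.nat = s.nat ∧
      (∀ a ∉ [8, 9, 10], s'.real a = s.real a) ∧
      (∀ l < s.nat 9, s'.real 9 l = s.real 9 l ∧ s'.real 10 0 l = s.real 10 0 l) ∧
      IsOrth (s.nat 4) (s.real 7) (s'.real 9) (s'.real 10 0) (s.nat 9) := by
  refine .seq (.putRow h5 fun F1 v1 => .seq (.fill fun F2 v2 w2 => .fill fun F3 v3 w3 => ?_))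
  simp only [SExpr.eval, NExpr.eval, State.setNat, Function.update_apply, getRow,
    Nat.reduceEqDiff, if_true, if_false, Rat.cast_one, Rat.cast_zero, h5, zero_add,
    Nat.lt_one_iff, forall_eq, add_zero] at v1 v2 v3 w2 w3 ⊢
  have e2 : ∀ l < s.nat 9, F2 l = s.real 9 l := fun l hl => funext fun j => w2 l j (Or.inl hl)
  refine ⟨trivial, fun a ha => ?_, fun l hl => ⟨e2 l hl, w3 0 l (by omega)⟩, fun j hj => ?_, v3⟩
  · simp only [List.mem_cons, List.not_mem_nil, or_false, not_or] at ha
    simp [ha]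
  · rw [v2 j hj, v1 j hj]
    congr 1
    · rcases lt_trichotomy (s.nat 9) j with h | h | h
      · simp [h, h.ne']
      · simp [h]
      · simp [h, h.ne, h.not_gt]
    · refine Finset.sum_congr rfl fun l hl => ?_
      have hl' := Finset.mem_range.1 hl
      rw [e2 l hl', w3 0 l (by omega)]

theorem Post.loop {r N : ℕ} {c : ArrayProg} {s : State} {Q : State → Prop}
    (I : ℕ → State → Prop) (h0 : I 0 s)
    (hstep : ∀ i < s.nat N, ∀ u, I i u → Post c (u.setNat r i) (I (i + 1)))
    (h : ∀ u, I (s.nat N) u → Q (u.setNat r (s.nat N))) : Post (.loop r N c) s Q := by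
  refine h _ ?_
  have main : ∀ n ≤ s.nat N, I n (Nat.rec s (fun i u => c.den (u.setNat r i)) n : State) := by
    intro n
    induction n with
    | zero => exact fun _ => h0
    | succ n ih => exact fun hn => hstep n (by omega) _ (ih (by omega))
  exact main _ le_rfl

theorem orth_spec (s : State) (h5 : s.nat 5 = 1) :
    Post (.loop 9 4 orthStep) s fun s' => (∀ r ≠ 9, s'.nat r = s.nat r) ∧
      (∀ a ∉ [8, 9, 10], s'.real a = s.real a) ∧
      ∀ k < s.nat 4, IsOrth (s.nat 4) (s.real 7) (s'.real 9) (s'.real 10 0) k := by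
  refine .loop (fun i s' => (∀ r ≠ 9, s'.nat r = s.nat r) ∧
    (∀ a ∉ [8, 9, 10], s'.real a = s.real a) ∧
    ∀ k < i, IsOrth (s.nat 4) (s.real 7) (s'.real 9) (s'.real 10 0) k) (by simp) ?_ ?_
  · rintro i hi u ⟨h1, h2, h3⟩
    have e9 : (u.setNat 9 i).nat 9 = i := by simp [State.setNat]
    have er : ∀ r ≠ 9, (u.setNat 9 i).nat r = s.nat r := fun r hr => by
      simp [State.setNat, Function.update_of_ne hr, h1 r hr]
    obtain ⟨g1, g2, g3, g4⟩ := orthStep_spec (u.setNat 9 i) (by rw [er 5 (by decide), h5])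
    rw [e9] at g3 g4
    rw [er 4 (by decide), show (u.setNat 9 i).real 7 = s.real 7 from h2 7 (by simp)] at g4
    refine ⟨fun r hr => by rw [g1, er r hr], fun a ha => (g2 a ha).trans (h2 a ha),
      fun k hk => ?_⟩
    rcases Nat.lt_succ_iff_lt_or_eq.1 hk with hk | rfl
    · exact (h3 k hk).congr (fun l hl j _ => congrFun (g3 l (by omega)).1 j)
        fun l hl => (g3 l (by omega)).2
    · exact g4
  · rintro u ⟨h1, h2, h3⟩
    exact ⟨fun r hr => by simp [State.setNat, Function.update_of_ne hr, h1 r hr], h2, h3⟩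

/-- The first of the vectors `U k` at which the quadratic form is not positive. -/
noncomputable def firstDirection (D : ℕ) (U : ℕ → ℕ → ℝ) (Q : ℕ → ℝ) (p : ℕ) : ℝ :=
  ∑ k ∈ Finset.range D, if 0 < Q k then 0 else
    if 0 < ∑ l ∈ Finset.range k, (if 0 < Q l then (0 : ℝ) else 1) then 0 else U k p

/-- The score of a sample with respect to the direction `v`. -/
noncomputable def score (n D : ℕ) (lev : ℝ) (x : ℕ → ℕ → ℝ) (z v : ℕ → ℝ) (i : ℕ) : ℝ :=
  max 0 ((∑ p ∈ Finset.range D, v p * (x i p - wmean n x z p)) ^ 2 -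
    lev * ∑ p ∈ Finset.range D, v p ^ 2)

/-- The largest score among the samples that have not been removed. -/
noncomputable def maxScore (n : ℕ) (z f : ℕ → ℝ) : ℝ :=
  runningMax (fun i => if z i < 1 then f i else 0) n

/-- The removed weight of a sample after a step with scores `f`. -/
noncomputable def removal (n : ℕ) (z f : ℕ → ℝ) (i : ℕ) : ℝ :=
  z i + (1 - z i) * f i / maxScore n z f

/-- The condition that the mode for sub-Gaussian distributions is abandoned: too much weight would
be removed, or a direction was found but all scores vanish. -/
def Switches (n D : ℕ) (ε mode : ℝ) (z v f : ℕ → ℝ) : Prop :=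
  ¬ 0 < mode ∧ (4 * ε * n < ∑ i ∈ Finset.range n, removal n z f i ∨
    ¬ 0 < maxScore n z f ∧ 0 < ∑ p ∈ Finset.range D, v p ^ 2)

open Classical in
/-- A filter step from the removed weights `z` and the mode `mode` to `z'` and `mode'`. -/
def IsStep (n D : ℕ) (ε θ : ℝ) (x : ℕ → ℕ → ℝ) (z : ℕ → ℝ) (mode : ℝ) (z' : ℕ → ℝ)
    (mode' : ℝ) : Prop :=
  ∃ (U : ℕ → ℕ → ℝ) (Q v f : ℕ → ℝ),
    (∀ k < D, IsOrth D (testMatrix n ε θ x z mode) U Q k) ∧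
    (∀ p < D, v p = firstDirection D U Q p) ∧
    (∀ i < n, f i = score n D (level θ mode) x z v i) ∧
    (∀ i < n, z' i = if Switches n D ε mode z v f then z i else removal n z f i) ∧
    mode' = if Switches n D ε mode z v f then 1 else mode

theorem update_spec (s : State) (h5 : s.nat 5 = 1) (hN : s.real 15 0 0 = s.nat 0)
    (h6 : ∀ p < s.nat 4, s.real 6 0 p = wmean (s.nat 0) (s.real 3) (s.real 4 0) p)
    (h7 : ∀ k < s.nat 4, IsOrth (s.nat 4) (testMatrix (s.nat 0) (s.real 1 0 0) (s.real 16 0 0)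
      (s.real 3) (s.real 4 0) (s.real 5 0 0)) (s.real 9) (s.real 10 0) k)
    (h18 : s.real 18 0 0 = level (s.real 16 0 0) (s.real 5 0 0)) :
    Post update s fun s' => s'.nat = s.nat ∧
      (∀ a ∉ [4, 5, 11, 12, 13, 14, 19, 22, 23, 24], s'.real a = s.real a) ∧
      IsStep (s.nat 0) (s.nat 4) (s.real 1 0 0) (s.real 16 0 0) (s.real 3) (s.real 4 0)
        (s.real 5 0 0) (s'.real 4 0) (s'.real 5 0 0) := by
  refine .seq (.putRow h5 fun F1 v1 => .seq (.putRow h5 fun F2 v2 => .seq (.putRow h5 fun F3 v3 =>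
    .seq (.put h5 fun F4 v4 => .seq (.putRow h5 fun F5 v5 => .seq (.put h5 fun F6 v6 =>
    .seq (.putRow h5 fun F7 v7 => .seq (.putRow h5 fun F8 v8 => .seq (.put h5 fun F9 v9 =>
    .put h5 fun F10 v10 => ?_)))))))))
  simp only [SExpr.eval, NExpr.eval, State.setNat, Function.update_apply, get, getRow, weight,
    Nat.reduceEqDiff, if_true, if_false, Rat.cast_one, Rat.cast_zero, Rat.cast_ofNat, h5,
    hN, h18] at v1 v2 v3 v4 v5 v6 v7 v8 v9 v10 ⊢
  classical
  refine ⟨trivial, fun a ha => ?_, s.real 9, s.real 10 0, F1 0, F3 0, h7, v1, fun i hi => ?_, ?_⟩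
  · simp only [List.mem_cons, List.not_mem_nil, or_false, not_or] at ha
    simp [ha]
  · have e2 : F2 0 i = ∑ p ∈ Finset.range (s.nat 4), F1 0 p *
        (s.real 3 i p - wmean (s.nat 0) (s.real 3) (s.real 4 0) p) := by
      rw [v2 i hi]
      exact Finset.sum_congr rfl fun p hp => by rw [h6 p (Finset.mem_range.1 hp)]
    rw [v3 i hi, score, ← e2]
    simp only [runningMax, sq]
  · have e5 : ∀ i < s.nat 0, F5 0 i = removal (s.nat 0) (s.real 4 0) (F3 0) i := fun i hi => by
      rw [v5 i hi, v4]
      rfl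
    have e6 : (0 < F6 0 0) ↔ Switches (s.nat 0) (s.nat 4) (s.real 1 0 0) (s.real 5 0 0)
        (s.real 4 0) (F1 0) (F3 0) := by
      rw [v6, Switches, Finset.sum_congr rfl fun i hi => e5 i (Finset.mem_range.1 hi), v4]
      change _ ↔ _ ∧ (_ ∨ ¬ 0 < runningMax _ _ ∧ _)
      simp only [sq]
      split_ifs <;> simp_all
    refine ⟨fun i hi => ?_, ?_⟩
    · rw [v8 i hi, v7 i hi, e5 i hi]
      exact if_congr e6 rfl rfl
    · rw [v10, v9]
      exact if_congr e6 rfl rfl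

theorem filterStep_spec (s : State) (h5 : s.nat 5 = 1) (hN : s.real 15 0 0 = s.nat 0) :
    Post filterStep s fun s' => (∀ r ≠ 9, s'.nat r = s.nat r) ∧
      (∀ a ∈ [1, 3, 15, 16], s'.real a = s.real a) ∧
      IsStep (s.nat 0) (s.nat 4) (s.real 1 0 0) (s.real 16 0 0) (s.real 3) (s.real 4 0)
        (s.real 5 0 0) (s'.real 4 0) (s'.real 5 0 0) := by
  obtain ⟨a1, a2, a3, a4, a5⟩ := prepare_spec s h5 hN
  set s1 := prepare.den s with hs1
  obtain ⟨b1, b2, b3⟩ := orth_spec s1 (by rw [a1, h5])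
  set s2 := (ArrayProg.loop 9 4 orthStep).den s1 with hs2
  have e : ∀ a ∉ [6, 7, 17, 18, 20, 8, 9, 10], s2.real a = s.real a := fun a ha => by
    simp only [List.mem_cons, List.not_mem_nil, or_false, not_or] at ha
    rw [b2 a (by simp [ha]), a2 a (by simp [ha])]
  have n0 : s2.nat 0 = s.nat 0 := by rw [b1 0 (by decide), a1]
  have n4 : s2.nat 4 = s.nat 4 := by rw [b1 4 (by decide), a1]
  obtain ⟨c1, c2, c3⟩ := update_spec s2 (by rw [b1 5 (by decide), a1, h5])
    (by rw [e 15 (by decide), n0, hN])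
    (by rw [n4, n0, b2 6 (by decide), e 3 (by decide), e 4 (by decide)]; exact a4)
    (by
      rw [n4, n0, e 1 (by decide), e 16 (by decide), e 3 (by decide), e 4 (by decide),
        e 5 (by decide)]
      intro k hk
      have := b3 k (by rw [a1]; exact hk)
      rw [a1] at this
      refine ⟨fun j hj => ?_, ?_⟩
      · rw [this.1 j hj]
        refine congrArg _ (Finset.sum_congr rfl fun l hl => ?_)
        congr 2
        exact Finset.sum_congr rfl fun p hp => by rw [a5 k hk p (Finset.mem_range.1 hp)]
      · rw [this.2]
        refine Finset.sum_congr rfl fun p hp => Finset.sum_congr rfl fun p' hp' => ?_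
        rw [a5 p (Finset.mem_range.1 hp) p' (Finset.mem_range.1 hp')])
    (by rw [b2 18 (by decide), a3, e 16 (by decide), e 5 (by decide)])
  refine ⟨fun r hr => ?_, fun a ha => ?_, ?_⟩
  · show (FilterProg.update.den s2).nat r = _
    rw [c1, b1 r hr, a1]
  · show (FilterProg.update.den s2).real a = _
    have : a ∉ [4, 5, 11, 12, 13, 14, 19, 22, 23, 24] ∧ a ∉ [6, 7, 17, 18, 20, 8, 9, 10] := by
      revert a; decide
    rw [c2 a this.1, e a this.2]
  · rw [n4, n0, e 1 (by decide), e 16 (by decide), e 3 (by decide), e 4 (by decide),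
      e 5 (by decide)] at c3
    exact c3

/-- The score level of the mode for sub-Gaussian distributions. -/
noncomputable def baseLevel (q : ℚ) (n : ℕ) (ε : ℝ) : ℝ :=
  q * ∑ j ∈ Finset.range n, 1 / (j + n * ε)

/-- The outcome of a round: `n + 2` filter steps lead from `z` and `mode` to `z'` and `mode'`. -/
def IsRound (q : ℚ) (n D : ℕ) (ε : ℝ) (x : ℕ → ℕ → ℝ) (z : ℕ → ℝ) (mode : ℝ) (z' : ℕ → ℝ)
    (mode' : ℝ) : Prop :=
  ∃ (Z : ℕ → ℕ → ℝ) (m : ℕ → ℝ), Z 0 = z ∧ m 0 = mode ∧ Z (n + 2) = z' ∧ m (n + 2) = mode' ∧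
    ∀ i < n + 2, IsStep n D ε (baseLevel q n ε) x (Z i) (m i) (Z (i + 1)) (m (i + 1))

theorem parameters_spec (q : ℚ) (s : State) (h5 : s.nat 5 = 1) :
    Post (parameters q) s fun s' => s'.nat = s.nat ∧
      (∀ a ∉ [15, 16], s'.real a = s.real a) ∧ s'.real 15 0 0 = s.nat 0 ∧
      s'.real 16 0 0 = baseLevel q (s.nat 0) (s.real 1 0 0) := by
  refine .seq (.put h5 fun F1 v1 => .put h5 fun F2 v2 => ?_)
  simp only [SExpr.eval, NExpr.eval, State.setNat, Function.update_apply, get,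
    Nat.reduceEqDiff, if_true, if_false, Rat.cast_one, Finset.sum_const, Finset.card_range,
    nsmul_eq_mul, mul_one] at v1 v2 ⊢
  rw [v1] at v2
  refine ⟨trivial, fun a ha => ?_, v1, v2⟩
  simp only [List.mem_cons, List.not_mem_nil, or_false, not_or] at ha
  simp [ha]

theorem steps_spec (q : ℚ) (s : State) (h5 : s.nat 5 = 1) (h7 : s.nat 7 = s.nat 0 + 2)
    (hN : s.real 15 0 0 = s.nat 0) (hθ : s.real 16 0 0 = baseLevel q (s.nat 0) (s.real 1 0 0)) :
    Post (.loop 8 7 filterStep) s fun s' => (∀ r, r ≠ 8 → r ≠ 9 → s'.nat r = s.nat r) ∧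
      s'.real 3 = s.real 3 ∧
      IsRound q (s.nat 0) (s.nat 4) (s.real 1 0 0) (s.real 3) (s.real 4 0) (s.real 5 0 0)
        (s'.real 4 0) (s'.real 5 0 0) := by
  refine .loop (fun i s' => (∀ r, r ≠ 8 → r ≠ 9 → s'.nat r = s.nat r) ∧
    (∀ a ∈ [1, 3, 15, 16], s'.real a = s.real a) ∧
    ∃ (Z : ℕ → ℕ → ℝ) (m : ℕ → ℝ), Z 0 = s.real 4 0 ∧ m 0 = s.real 5 0 0 ∧
      Z i = s'.real 4 0 ∧ m i = s'.real 5 0 0 ∧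
      ∀ j < i, IsStep (s.nat 0) (s.nat 4) (s.real 1 0 0) (baseLevel q (s.nat 0) (s.real 1 0 0))
        (s.real 3) (Z j) (m j) (Z (j + 1)) (m (j + 1)))
    ⟨fun _ _ _ => rfl, fun _ _ => rfl, fun _ => s.real 4 0, fun _ => s.real 5 0 0, rfl, rfl, rfl,
      rfl, fun j hj => absurd hj (Nat.not_lt_zero j)⟩ ?_ ?_
  · rintro i hi u ⟨h1, h2, Z, m, hZ0, hm0, hZ, hm, hst⟩
    have er : ∀ r, r ≠ 8 → r ≠ 9 → (u.setNat 8 i).nat r = s.nat r := fun r hr hr' => by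
      simp [State.setNat, Function.update_of_ne hr, h1 r hr hr']
    obtain ⟨g1, g2, g3⟩ := filterStep_spec (u.setNat 8 i)
      (by rw [er 5 (by decide) (by decide), h5])
      (by rw [er 0 (by decide) (by decide)]; exact (congrFun₂ (h2 15 (by decide)) 0 0).trans hN)
    rw [er 0 (by decide) (by decide), er 4 (by decide) (by decide),
      show (u.setNat 8 i).real = u.real from rfl, h2 1 (by decide), h2 3 (by decide),
      h2 16 (by decide), hθ, ← hZ, ← hm] at g3
    refine ⟨fun r hr hr' => by rw [g1 r hr', er r hr hr'], fun a ha => by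
      rw [g2 a ha]; exact h2 a ha, fun j => if j ≤ i then Z j else
        (filterStep.den (u.setNat 8 i)).real 4 0, fun j => if j ≤ i then m j else
        (filterStep.den (u.setNat 8 i)).real 5 0 0, by simpa using hZ0, by simpa using hm0,
        by simp, by simp, fun j hj => ?_⟩
    rcases Nat.lt_succ_iff_lt_or_eq.1 hj with hj | rfl
    · simpa [hj.le, Nat.succ_le_of_lt hj] using hst j hj
    · simpa using g3
  · rintro u ⟨h1, h2, Z, m, hZ0, hm0, hZ, hm, hst⟩
    refine ⟨fun r hr hr' => by simp [State.setNat, Function.update_of_ne hr, h1 r hr hr'],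
      h2 3 (by decide), Z, m, hZ0, hm0, ?_, ?_, ?_⟩
    · rw [← h7]; exact hZ
    · rw [← h7]; exact hm
    · rw [← h7]; exact hst

theorem round_spec (q : ℚ) (s : State) (h5 : s.nat 5 = 1) (h7 : s.nat 7 = s.nat 0 + 2) :
    Post (roundProg q) s fun s' => (∀ r, r ≠ 8 → r ≠ 9 → s'.nat r = s.nat r) ∧
      (∀ i < s.nat 0, ∀ j < s.nat 1, s'.real 3 i (s.nat 6 + j) = s.real 0 i j) ∧
      (∀ i, ∀ j < s.nat 6, s'.real 3 i j = s.real 3 i j) ∧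
      IsRound q (s.nat 0) (s.nat 4) (s.real 1 0 0) (s'.real 3) (s.real 4 0) (s.real 5 0 0)
        (s'.real 4 0) (s'.real 5 0 0) ∧
      ∀ j < s.nat 1, s'.real 2 0 j = wmean (s.nat 0) (s'.real 3) (s'.real 4 0) (s.nat 6 + j) := by
  refine .seq (.fill fun F1 v1 w1 => ?_)
  set s1 : State := ⟨s.nat, Function.update s.real 3 F1⟩ with hs1
  simp only [SExpr.eval, NExpr.eval, State.setNat, Function.update_apply, Nat.reduceEqDiff,
    if_true, if_false, zero_add] at v1 w1
  obtain ⟨p1, p2, p3, p4⟩ := parameters_spec q s1 h5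
  refine .seq_den ?_
  set s2 := (parameters q).den s1 with hs2
  have e2 : ∀ a ∉ [3, 15, 16], s2.real a = s.real a := fun a ha => by
    simp only [List.mem_cons, List.not_mem_nil, or_false, not_or] at ha
    rw [p2 a (by simp [ha]), hs1]
    simp [ha]
  have e3 : s2.real 3 = F1 := by rw [p2 3 (by decide), hs1]; simp
  have hn : s2.nat = s.nat := p1
  obtain ⟨g1, g2, g3⟩ := steps_spec q s2 (by rw [hn, h5]) (by rw [hn, h7])
    (by rw [p3, hn]) (by rw [p4, hn, e2 1 (by decide)]; simp [hs1])
  refine .seq_den ?_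
  set s3 := (ArrayProg.loop 8 7 filterStep).den s2 with hs3
  rw [hn] at g1 g3
  rw [e3] at g2
  rw [e2 1 (by decide), e3, e2 4 (by decide), e2 5 (by decide)] at g3
  have h53 : s3.nat 5 = 1 := by rw [g1 5 (by decide) (by decide), h5]
  refine .seq (.put h53 fun F2 v2 => .putRow h53 fun F3 v3 => ?_)
  simp only [SExpr.eval, NExpr.eval, State.setNat, Function.update_apply, get, getRow, weight,
    Nat.reduceEqDiff, if_true, if_false, Rat.cast_one, g2, g1 0 (by decide) (by decide),
    g1 1 (by decide) (by decide), g1 6 (by decide) (by decide)] at v2 v3 ⊢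
  refine ⟨g1, v1, fun i j hj => w1 i j (Or.inr (Or.inr (Or.inl hj))), g3, fun j hj => ?_⟩
  rw [v3 j hj, v2, wmean]

end FilterProg
end RealRAM

/-! ### Execution of one round on the machine -/

namespace RealRAM.FilterProg

open NExpr (reg const)

/-- The execution is fixed before the bound `B`, so that the time estimate holds for every
admissible `B` and one choice of successor states serves all inputs. -/
theorem exec_program (q : ℚ) (u : State) :
    ∃ c s', Exec (program q) u c s' ∧
      (∀ B, u.nat 0 + 2 ≤ B → u.nat 4 + u.nat 1 ≤ B → (∀ r < 10, u.nat r ≤ B) →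
        c ≤ (roundProg q).time B + 12 ∧ ∀ r < 10, s'.nat r ≤ B) ∧
      s'.nat 4 = u.nat 4 + u.nat 1 ∧
      (∀ i < u.nat 0, ∀ j < u.nat 1, s'.real 3 i (u.nat 4 + j) = u.real 0 i j) ∧
      (∀ i, ∀ j < u.nat 4, s'.real 3 i j = u.real 3 i j) ∧
      IsRound q (u.nat 0) (u.nat 4 + u.nat 1) (u.real 1 0 0) (s'.real 3) (u.real 4 0)
        (u.real 5 0 0) (s'.real 4 0) (s'.real 5 0 0) ∧
      ∀ j < u.nat 1, s'.real 2 0 j = wmean (u.nat 0) (s'.real 3) (s'.real 4 0) (u.nat 4 + j) := by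
  set v : State := (((u.setNat 5 1).setNat 6 (u.nat 4)).setNat 4 (u.nat 4 + u.nat 1)).setNat 7
    (u.nat 0 + 2) with hv
  have hexec : ∀ {c s'}, Exec (roundProg q).compile v c s' → Exec (program q) u (c + 12) s' := by
    intro c s' h
    have e1 := Exec.setNat 5 (const 1) u
    have e2 := Exec.setNat 6 (reg 4) (u.setNat 5 1)
    have e3 := Exec.setNat 4 (.add (reg 4) (reg 1)) ((u.setNat 5 1).setNat 6 (u.nat 4))
    have e4 := Exec.setNat 7 (.add (reg 0) (const 2))
      (((u.setNat 5 1).setNat 6 (u.nat 4)).setNat 4 (u.nat 4 + u.nat 1))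
    have e := Exec.seq e1 (.seq e2 (.seq e3 (.seq e4 h)))
    have hc : c + 12 = 2 + (2 + (4 + (4 + c))) := by omega
    rw [hc]
    exact e
  have v0 : v.nat 0 = u.nat 0 := by simp [hv, State.setNat]
  have v1 : v.nat 1 = u.nat 1 := by simp [hv, State.setNat]
  have v4 : v.nat 4 = u.nat 4 + u.nat 1 := by simp [hv, State.setNat]
  have v5 : v.nat 5 = 1 := by simp [hv, State.setNat]
  have v6 : v.nat 6 = u.nat 4 := by simp [hv, State.setNat]
  have v7 : v.nat 7 = u.nat 0 + 2 := by simp [hv, State.setNat]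
  have hrest : ∀ r < 10, r ≠ 4 → r ≠ 5 → r ≠ 6 → r ≠ 7 → v.nat r = u.nat r := by
    intro r _ h4 h5 h6 h7
    simp [hv, State.setNat, Function.update_of_ne, h4, h5, h6, h7]
  have hvr : v.real = u.real := rfl
  obtain ⟨s1, s2, s3, s4, s5⟩ := round_spec q v v5 (by rw [v7, v0])
  set w := (roundProg q).den v with hw
  have hag : SExpr.Agree arrays 10 v v := ⟨fun _ _ => rfl, fun _ _ => rfl⟩
  -- Any bound proves that the program halts; for a prescribed `B` the compiled run is produced
  -- again and identified with this one by determinism.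
  obtain ⟨B₀, hB₀⟩ : ∃ B, ∀ r < 10, v.nat r ≤ B :=
    ⟨∑ r ∈ Finset.range 10, v.nat r, fun r hr =>
      Finset.single_le_sum (f := v.nat) (fun _ _ => Nat.zero_le _) (Finset.mem_range.2 hr)⟩
  obtain ⟨c, s', he, -, ha⟩ := (roundProg q).exec_compile (by decide) (wf_round q) v v hag hB₀
  have hreal : ∀ a ∈ arrays, s'.real a = w.real a := fun a h => (ha.2 a h).symm
  simp only [v0, v4, v1, v6, hvr] at s2 s3 s4 s5
  refine ⟨c + 12, s', hexec he, fun B h0 h4 hB => ?_, ?_, ?_, ?_, ?_, ?_⟩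
  · have hvB : ∀ r < 10, v.nat r ≤ B := by
      intro r hr
      by_cases h4 : r = 4
      · subst h4; omega
      by_cases h5 : r = 5
      · subst h5; omega
      by_cases h6 : r = 6
      · subst h6; rw [v6]; exact hB 4 (by omega)
      by_cases h7 : r = 7
      · subst h7; omega
      rw [hrest r hr h4 h5 h6 h7]
      exact hB r hr
    obtain ⟨c', s'', he', hc, ha'⟩ := (roundProg q).exec_compile (by decide) (wf_round q) v v hag hvB
    obtain ⟨rfl, rfl⟩ := he.unique he'
    refine ⟨by omega, fun r hr => ?_⟩
    rw [← ha'.1 r hr]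
    exact ArrayProg.den_nat_le _ v (wf_round q) hvB r hr
  · rw [← ha.1 4 (by omega), s1 4 (by decide) (by decide), v4]
  · rw [hreal 3 (by decide)]; exact s2
  · rw [hreal 3 (by decide)]; exact s3
  · rw [hreal 3 (by decide), hreal 4 (by decide), hreal 5 (by decide)]; exact s4
  · rw [hreal 2 (by decide), hreal 3 (by decide), hreal 4 (by decide)]; exact s5

theorem wmean_congr {n D : ℕ} {x x' : ℕ → ℕ → ℝ} (h : ∀ i < n, ∀ p < D, x i p = x' i p)
    (z : ℕ → ℝ) {p : ℕ} (hp : p < D) : wmean n x z p = wmean n x' z p := by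
  rw [wmean, wmean]
  congr 1
  exact Finset.sum_congr rfl fun i hi => by rw [h i (Finset.mem_range.1 hi) p hp]

theorem testMatrix_congr {n D : ℕ} {x x' : ℕ → ℕ → ℝ} (h : ∀ i < n, ∀ p < D, x i p = x' i p)
    (ε θ : ℝ) (z : ℕ → ℝ) (mode : ℝ) {p p' : ℕ} (hp : p < D) (hp' : p' < D) :
    testMatrix n ε θ x z mode p p' = testMatrix n ε θ x' z mode p p' := by
  rw [testMatrix, testMatrix, wmean_congr h z hp, wmean_congr h z hp']
  congr 1
  refine Finset.sum_congr rfl fun i hi => ?_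
  rw [h i (Finset.mem_range.1 hi) p hp, h i (Finset.mem_range.1 hi) p' hp']

theorem IsOrth.congr_matrix {D k : ℕ} {S S' U : ℕ → ℕ → ℝ} {Q : ℕ → ℝ} (hk : k < D)
    (hS : ∀ p < D, ∀ p' < D, S p p' = S' p p') (h : IsOrth D S U Q k) : IsOrth D S' U Q k := by
  refine ⟨fun j hj => ?_, ?_⟩
  · rw [h.1 j hj]
    refine congrArg _ (Finset.sum_congr rfl fun l hl => ?_)
    congr 2
    exact Finset.sum_congr rfl fun p hp => by rw [hS k hk p (Finset.mem_range.1 hp)]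
  · rw [h.2]
    refine Finset.sum_congr rfl fun p hp => Finset.sum_congr rfl fun p' hp' => ?_
    rw [hS p (Finset.mem_range.1 hp) p' (Finset.mem_range.1 hp')]

/-- A step depends only on the first `D` coordinates. This replaces the partially filled array of
the machine by the full dataset. -/
theorem IsStep.congr {n D : ℕ} {ε θ : ℝ} {x x' : ℕ → ℕ → ℝ}
    (h : ∀ i < n, ∀ p < D, x i p = x' i p) {z : ℕ → ℝ} {mode : ℝ} {z' : ℕ → ℝ} {mode' : ℝ}
    (hs : IsStep n D ε θ x z mode z' mode') : IsStep n D ε θ x' z mode z' mode' := by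
  obtain ⟨U, Q, v, f, h1, h2, h3, h4, h5⟩ := hs
  refine ⟨U, Q, v, f, fun k hk => (h1 k hk).congr_matrix hk fun p hp p' hp' =>
    testMatrix_congr h ε θ z mode hp hp', h2, fun i hi => ?_, h4, h5⟩
  rw [h3 i hi, score, score]
  congr 3
  refine Finset.sum_congr rfl fun p hp => ?_
  rw [h i hi p (Finset.mem_range.1 hp), wmean_congr h z (Finset.mem_range.1 hp)]

theorem IsRound.congr {q : ℚ} {n D : ℕ} {ε : ℝ} {x x' : ℕ → ℕ → ℝ}
    (h : ∀ i < n, ∀ p < D, x i p = x' i p) {z : ℕ → ℝ} {mode : ℝ} {z' : ℕ → ℝ} {mode' : ℝ}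
    (hs : IsRound q n D ε x z mode z' mode') : IsRound q n D ε x' z mode z' mode' := by
  obtain ⟨Z, m, h1, h2, h3, h4, h5⟩ := hs
  exact ⟨Z, m, h1, h2, h3, h4, fun i hi => (h5 i hi).congr h⟩

end RealRAM.FilterProg

/-! ### The online run and its running time -/

namespace OnlineMean

open RealRAM RealRAM.FilterProg

/-- The samples with their coordinates in the order in which they are revealed. -/
noncomputable def flatten {n T d : ℕ} (x : Fin n → Space T d) (i p : ℕ) : ℝ :=
  if h : i < n ∧ p < T * d then x ⟨i, h.1⟩ (finProdFinEquiv.symm ⟨p, h.2⟩) else 0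

theorem lt_mul_of_batch {T d t j : ℕ} (ht : t < T) (hj : j < d) : t * d + j < T * d := by
  calc t * d + j < t * d + d := by omega
    _ = (t + 1) * d := by ring
    _ ≤ T * d := Nat.mul_le_mul_right _ ht

theorem flatten_apply {n T d : ℕ} (x : Fin n → Space T d) (i : Fin n) (t : Fin T) (j : Fin d) :
    flatten x i (t * d + j) = x i (t, j) := by
  have hp : (t : ℕ) * d + j < T * d := lt_mul_of_batch t.2 j.2
  rw [flatten, dif_pos ⟨i.2, hp⟩]
  have : finProdFinEquiv.symm ⟨t * d + j, hp⟩ = (t, j) := by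
    rw [Equiv.symm_apply_eq]
    ext
    simp [finProdFinEquiv]; ring
  rw [this]

/-- From here on the machine is replaced by the sequence `Z` of removed weights and the sequence
`mode`; only these and the output formula are needed for the error analysis. -/
theorem onlineRun_program (q : ℚ) {n T d : ℕ} (hn : 1 ≤ n) (hT : 1 ≤ T) (hd : 1 ≤ d) (ε : ℝ)
    (x : Fin n → Space T d) :
    ∃ (y : Space T d) (m : ℕ), OnlineRun (program q) ε x y m ∧
      m ≤ T * ((roundProg q).time (6 * (n * (T * d))) + 12) ∧
      ∃ (Z : ℕ → ℕ → ℝ) (mode : ℕ → ℝ), (∀ i, Z 0 i = 0) ∧ mode 0 = 0 ∧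
        ∀ t < T, IsRound q n ((t + 1) * d) ε (flatten x) (Z t) (mode t) (Z (t + 1))
            (mode (t + 1)) ∧
          ∀ (ht : t < T) (j : Fin d), y (⟨t, ht⟩, j) =
            wmean n (flatten x) (Z (t + 1)) (t * d + j) := by
  choose cost next hexec htime hn4 hnew hold hround hout using exec_program q
  -- Beyond round `T` there is no batch; the default value only makes the recursion total.
  let inp : ℕ → State → State := fun t s =>
    if ht : t < T then reveal T t ε (fun i j => x i (⟨t, ht⟩, j)) s else s
  let s : ℕ → State := fun t => Nat.rec State.blank (fun t s => next (inp t s)) t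
  have hs : ∀ t, s (t + 1) = next (inp t (s t)) := fun t => rfl
  have hinp : ∀ t (ht : t < T) (u : State), inp t u =
      reveal T t ε (fun i j => x i (⟨t, ht⟩, j)) u := fun t ht u => dif_pos ht
  have r0 : ∀ t (ht : t < T) u, (inp t u).nat 0 = n := fun t ht u => by
    rw [hinp t ht]; simp [reveal]
  have r1 : ∀ t (ht : t < T) u, (inp t u).nat 1 = d := fun t ht u => by
    rw [hinp t ht]; simp [reveal]
  have r4 : ∀ t (ht : t < T) u, (inp t u).nat 4 = u.nat 4 := fun t ht u => by
    rw [hinp t ht]; simp [reveal]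
  have a1 : ∀ t (ht : t < T) u, (inp t u).real 1 0 0 = ε := fun t ht u => by
    rw [hinp t ht]; simp [reveal]
  have ag : ∀ t (ht : t < T) u a, 2 ≤ a → (inp t u).real a = u.real a := fun t ht u a ha => by
    rw [hinp t ht]
    funext i j
    simp [reveal, show a ≠ 0 by omega, show a ≠ 1 by omega]
  have a0 : ∀ t (ht : t < T) u (i : Fin n) (j : Fin d), (inp t u).real 0 i j =
      flatten x i (t * d + j) := fun t ht u i j => by
    rw [hinp t ht, flatten_apply x i ⟨t, ht⟩ j]
    simp [reveal]
  have i4 : ∀ t ≤ T, (s t).nat 4 = t * d := by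
    intro t
    induction t with
    | zero => intro _; simp [s, State.blank]
    | succ t ih =>
      intro ht
      rw [hs, hn4, r1 t ht, r4 t ht, ih (by omega)]; ring
  have i3 : ∀ t ≤ T, ∀ i < n, ∀ p < t * d, (s t).real 3 i p = flatten x i p := by
    intro t
    induction t with
    | zero => intro _ i _ p hp; simp at hp
    | succ t ih =>
      intro ht i hi p hp
      rw [hs]
      by_cases h : p < t * d
      · rw [hold _ i p (by rw [r4 t ht, i4 t (by omega)]; exact h), ag t ht _ 3 (by omega)]
        exact ih (by omega) i hi p h
      · obtain ⟨j, rfl⟩ := Nat.exists_eq_add_of_le (not_lt.1 h)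
        have hj : j < d := by rw [add_mul] at hp; omega
        have := hnew (inp t (s t)) i (by rw [r0 t ht]; exact hi) j (by rw [r1 t ht]; exact hj)
        rw [r4 t ht, i4 t (by omega)] at this
        rw [this]
        exact a0 t ht _ ⟨i, hi⟩ ⟨j, hj⟩
  -- Large enough for the number `n + 2` of steps, for the number of revealed coordinates and for
  -- all input registers.
  set B := 6 * (n * (T * d)) with hB
  have hTd : 1 ≤ T * d := Nat.mul_pos hT hd
  have b1 : n ≤ n * (T * d) := Nat.le_mul_of_pos_right _ hTd
  have b2 : T * d ≤ n * (T * d) := Nat.le_mul_of_pos_left _ hn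
  have b3 : T ≤ T * d := Nat.le_mul_of_pos_right _ hd
  have b4 : d ≤ T * d := Nat.le_mul_of_pos_left _ hT
  have hbd : ∀ t, t < T → (∀ r < 10, (s t).nat r ≤ B) →
      cost (inp t (s t)) ≤ (roundProg q).time B + 12 ∧
        ∀ r < 10, (next (inp t (s t))).nat r ≤ B := by
    intro t ht hst
    have hD : t * d + d ≤ T * d := by
      rw [← Nat.succ_mul]; exact Nat.mul_le_mul_right _ ht
    refine htime (inp t (s t)) B (by rw [r0 t ht]; omega)
      (by rw [r1 t ht, r4 t ht, i4 t ht.le]; omega) fun r hr => ?_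
    have := hst r hr
    rw [hinp t ht]
    simp only [reveal]
    split_ifs <;> omega
  have ireg : ∀ t ≤ T, ∀ r < 10, (s t).nat r ≤ B := by
    intro t
    induction t with
    | zero => intro _ r _; simp [s, State.blank]
    | succ t ih =>
      intro ht
      rw [hs]
      exact (hbd t ht (ih (by omega))).2
  have hZ : ∀ t, t < T → IsRound q n ((t + 1) * d) ε (flatten x) ((s t).real 4 0)
      ((s t).real 5 0 0) ((s (t + 1)).real 4 0) ((s (t + 1)).real 5 0 0) := by
    intro t ht
    have := hround (inp t (s t))
    rw [r0 t ht, r1 t ht, r4 t ht, i4 t ht.le, a1 t ht, ag t ht _ 4 (by omega),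
      ag t ht _ 5 (by omega), ← hs, ← Nat.succ_mul] at this
    exact this.congr (i3 (t + 1) ht)
  have hO : ∀ t, t < T → ∀ j : Fin d, (s (t + 1)).real 2 0 j =
      wmean n (flatten x) ((s (t + 1)).real 4 0) (t * d + j) := by
    intro t ht j
    have := hout (inp t (s t)) j (by rw [r1 t ht]; exact j.2)
    rw [r0 t ht, r4 t ht, i4 t ht.le, ← hs] at this
    rw [this]
    exact wmean_congr (D := (t + 1) * d) (i3 (t + 1) ht) _ (by rw [Nat.succ_mul]; omega)
  refine ⟨WithLp.toLp 2 fun p => (s (p.1 + 1)).real 2 0 p.2, ∑ t ∈ Finset.range T,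
    cost (inp t (s t)), ⟨s, fun t => cost (inp t (s t)), rfl, fun t => ⟨?_, fun j => rfl⟩, rfl⟩,
    ?_, fun t => (s t).real 4 0, fun t => (s t).real 5 0 0, fun i => by simp [s, State.blank],
    by simp [s, State.blank], fun t ht => ⟨hZ t ht, fun _ j => hO t ht j⟩⟩
  · have := hexec (inp t (s t))
    rw [← hs] at this
    dsimp only
    rw [hinp t t.2] at this ⊢
    exact this
  · calc _ ≤ ∑ t ∈ Finset.range T, ((roundProg q).time B + 12) :=
        Finset.sum_le_sum fun t ht => (hbd t (Finset.mem_range.1 ht)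
          (ireg t (Finset.mem_range.1 ht).le)).1
      _ = _ := by simp

theorem exists_running_time_bound : ∃ C k₀ : ℕ, ∀ k ≥ k₀, ∀ (q : ℚ) (n T d : ℕ), 1 ≤ n → 1 ≤ T →
    1 ≤ d → T * ((roundProg q).time (6 * (n * (T * d))) + 12) ≤ C * (n * (T * d)) ^ k := by
  set e := (roundProg 0).degree with he
  refine ⟨(roundProg 0).time 1 * 6 ^ e + 12, e + 1, fun k hk q n T d hn hT hd => ?_⟩
  -- The time bound ignores the values of rational constants, so the running time is uniform in `q`
  -- and hence in `K`.
  have ht : (roundProg q).time (6 * (n * (T * d))) = (roundProg 0).time (6 * (n * (T * d))) := rfl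
  have hTd : 1 ≤ T * d := Nat.mul_pos hT hd
  have hM : 1 ≤ n * (T * d) := Nat.mul_pos hn hTd
  have hTM : T ≤ n * (T * d) :=
    (Nat.le_mul_of_pos_right _ hd).trans (Nat.le_mul_of_pos_left _ hn)
  have h1 := ArrayProg.time_le (B := 6 * (n * (T * d))) (by omega) (roundProg 0)
  rw [ht]
  generalize n * (T * d) = M at *
  generalize (roundProg 0).time 1 = a at *
  have hp : 1 ≤ M ^ e := Nat.one_le_pow _ _ hM
  calc T * ((roundProg 0).time (6 * M) + 12) ≤ M * (a * (6 * M) ^ e + 12 * M ^ e) := by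
        gcongr; omega
    _ = (a * 6 ^ e + 12) * M ^ (e + 1) := by rw [mul_pow]; ring
    _ ≤ _ := Nat.mul_le_mul_left _ (Nat.pow_le_pow_right hM hk)

end OnlineMean

namespace RealRAM.FilterProg

/-! ### Orthogonalization decides positive definiteness -/

/-- The bilinear form of a matrix. -/
noncomputable def form (D : ℕ) (S : ℕ → ℕ → ℝ) (y w : ℕ → ℝ) : ℝ :=
  ∑ p ∈ Finset.range D, ∑ p' ∈ Finset.range D, y p * S p p' * w p'

theorem form_congr {D : ℕ} {S : ℕ → ℕ → ℝ} {y y' w w' : ℕ → ℝ} (hy : ∀ p < D, y p = y' p)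
    (hw : ∀ p < D, w p = w' p) : form D S y w = form D S y' w' :=
  Finset.sum_congr rfl fun p hp => Finset.sum_congr rfl fun p' hp' => by
    rw [hy p (Finset.mem_range.1 hp), hw p' (Finset.mem_range.1 hp')]

theorem form_comm {D : ℕ} {S : ℕ → ℕ → ℝ} (hS : ∀ p < D, ∀ p' < D, S p p' = S p' p)
    (y w : ℕ → ℝ) : form D S y w = form D S w y := by
  rw [form, form, Finset.sum_comm]
  refine Finset.sum_congr rfl fun p hp => Finset.sum_congr rfl fun p' hp' => ?_
  rw [hS p' (Finset.mem_range.1 hp') p (Finset.mem_range.1 hp)]; ring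

theorem form_add_mul_left (D : ℕ) (S : ℕ → ℕ → ℝ) (y y' w : ℕ → ℝ) (c : ℝ) :
    form D S (fun p => y p + c * y' p) w = form D S y w + c * form D S y' w := by
  simp only [form, Finset.mul_sum, ← Finset.sum_add_distrib]
  exact Finset.sum_congr rfl fun p _ => Finset.sum_congr rfl fun p' _ => by ring

theorem form_sum_left {ι : Type*} (D : ℕ) (S : ℕ → ℕ → ℝ) (s : Finset ι) (c : ι → ℝ)
    (y : ι → ℕ → ℝ) (w : ℕ → ℝ) :
    form D S (fun p => ∑ l ∈ s, c l * y l p) w = ∑ l ∈ s, c l * form D S (y l) w := by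
  simp only [form, Finset.mul_sum, Finset.sum_mul]
  refine ((Finset.sum_congr rfl fun _ _ => Finset.sum_comm).trans Finset.sum_comm).trans ?_
  exact Finset.sum_congr rfl fun l _ => Finset.sum_congr rfl fun p _ =>
    Finset.sum_congr rfl fun p' _ => by ring

/-- Triangularity holds without any positivity, even if some `Q l` vanishes, since only the
coefficients of earlier vectors are divided. -/
theorem IsOrth.lower {D : ℕ} {S U : ℕ → ℕ → ℝ} {Q : ℕ → ℝ} (h : ∀ k < D, IsOrth D S U Q k) :
    ∀ k j, k < j → j < D → U k j = 0 := by
  intro k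
  induction k using Nat.strong_induction_on with
  | _ k ih =>
    intro j hkj hj
    rw [(h k (by omega)).1 j hj, if_neg (by omega), Finset.sum_eq_zero, sub_zero]
    intro l hl
    have := Finset.mem_range.1 hl
    rw [ih l this j (by omega) hj, mul_zero]

theorem IsOrth.diag {D : ℕ} {S U : ℕ → ℕ → ℝ} {Q : ℕ → ℝ} (h : ∀ k < D, IsOrth D S U Q k)
    {k : ℕ} (hk : k < D) : U k k = 1 := by
  rw [(h k hk).1 k hk, if_pos rfl, Finset.sum_eq_zero, sub_zero]
  intro l hl
  rw [IsOrth.lower h l k (Finset.mem_range.1 hl) hk, mul_zero]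

theorem IsOrth.form_left {D k : ℕ} {S U : ℕ → ℕ → ℝ} {Q : ℕ → ℝ} (h : IsOrth D S U Q k)
    (hk : k < D) (w : ℕ → ℝ) : form D S (U k) w = ∑ p ∈ Finset.range D, S k p * w p -
      ∑ l ∈ Finset.range k, (∑ p ∈ Finset.range D, S k p * U l p) / Q l * form D S (U l) w := by
  rw [← form_sum_left, form_congr (y' := fun p => (if p = k then 1 else 0) + (-1) *
    ∑ l ∈ Finset.range k, (∑ p ∈ Finset.range D, S k p * U l p) / Q l * U l p) (w' := w)
    (fun p hp => by rw [h.1 p hp]; ring) (fun _ _ => rfl), form_add_mul_left]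
  have : form D S (fun p => if p = k then 1 else 0) w = ∑ p ∈ Finset.range D, S k p * w p := by
    rw [form, Finset.sum_eq_single k]
    · simp
    · intro p _ hp; simp [hp]
    · intro hk'; exact absurd (Finset.mem_range.2 hk) hk'
  rw [this]; ring

/-- Pairing the recursion for `U k` with `U m` leaves, by induction, only the term `l = m`, which
cancels the pairing of row `k` of `S` with `U m`; positivity of `Q m` permits the division. -/
theorem IsOrth.orthogonal {D : ℕ} {S U : ℕ → ℕ → ℝ} {Q : ℕ → ℝ}
    (hS : ∀ p < D, ∀ p' < D, S p p' = S p' p) (h : ∀ k < D, IsOrth D S U Q k)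
    (hQ : ∀ k < D, 0 < Q k) : ∀ k < D, ∀ m < k, form D S (U k) (U m) = 0 := by
  intro k
  induction k using Nat.strong_induction_on with
  | _ k ih =>
    intro hk m hm
    rw [(h k hk).form_left hk, Finset.sum_eq_single (s := Finset.range k) m]
    · have hq : form D S (U m) (U m) = Q m := (h m (by omega)).2.symm
      rw [hq, div_mul_cancel₀ _ (hQ m (by omega)).ne', sub_self]
    · intro l hl hlm
      have hl := Finset.mem_range.1 hl
      rcases lt_or_gt_of_ne hlm with h' | h'
      · rw [form_comm hS, ih m hm (by omega) l h', mul_zero]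
      · rw [ih l hl (by omega) m h', mul_zero]
    · intro h'; exact absurd (Finset.mem_range.2 hm) h'

/-- Completing squares from the last coordinate down: subtracting `y K` times `U K` removes
coordinate `K`, and the remainder is orthogonal to `U K`, so the form drops by `y K ^ 2 * Q K`. -/
theorem IsOrth.form_pos {D : ℕ} {S U : ℕ → ℕ → ℝ} {Q : ℕ → ℝ}
    (hS : ∀ p < D, ∀ p' < D, S p p' = S p' p) (h : ∀ k < D, IsOrth D S U Q k)
    (hQ : ∀ k < D, 0 < Q k) (y : ℕ → ℝ) (hy : ∃ p < D, y p ≠ 0) :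
    0 < form D S y y := by
  -- Orthogonality of vectors supported below `K` to all `U m` with `K ≤ m` is carried along; it
  -- removes the cross term.
  have main : ∀ K ≤ D, ∀ y : ℕ → ℝ, (∀ p, K ≤ p → p < D → y p = 0) →
      0 ≤ form D S y y ∧ ((∃ p < D, y p ≠ 0) → 0 < form D S y y) ∧ ∀ m, K ≤ m → m < D → form D S y (U m) = 0 := by
    intro K
    induction K with
    | zero =>
      intro _ y hy
      have h0 : ∀ w, form D S y w = 0 := fun w =>
        Finset.sum_eq_zero fun p hp => Finset.sum_eq_zero fun p' _ => by
          rw [hy p (Nat.zero_le _) (Finset.mem_range.1 hp)]; ring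
      exact ⟨(h0 y).ge, fun ⟨p, hp, hne⟩ => absurd (hy p (Nat.zero_le _) hp) hne,
        fun m _ _ => h0 _⟩
    | succ K ih =>
      intro hK y hy
      obtain ⟨h1, h1', h2⟩ := ih (by omega) (fun p => y p + (-y K) * U K p) fun p hp hpD => by
        rcases hp.eq_or_lt with rfl | hp
        · rw [IsOrth.diag h hpD]; ring
        · rw [hy p hp hpD, IsOrth.lower h K p hp hpD]; ring
      set y' : ℕ → ℝ := fun p => y p + (-y K) * U K p with hy'
      have e : y = fun p => y' p + y K * U K p := by
        funext p; rw [hy']; ring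
      have hl : ∀ w, form D S y w = form D S y' w + y K * form D S (U K) w := fun w => by
        conv_lhs => rw [e]
        exact form_add_mul_left D S y' (U K) w (y K)
      have hyy : form D S y y = form D S y' y' + y K ^ 2 * Q K := by
        rw [hl, form_comm hS y' y, hl, form_comm hS (U K) y, hl, form_comm hS (U K) y',
          h2 K le_rfl (by omega)]
        have hq : form D S (U K) (U K) = Q K := (h K (by omega)).2.symm
        rw [hq]; ring
      have hQK := hQ K (by omega)
      refine ⟨by rw [hyy]; positivity, fun hne => ?_, fun m hm hmD => ?_⟩
      · by_cases hyK : y K = 0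
        · have : y' = y := by funext p; rw [hy', hyK]; ring
          rw [← this] at hne ⊢
          exact h1' hne
        · rw [hyy]; positivity
      · rw [hl, h2 m (by omega) hmD, form_comm hS (U K) (U m),
          IsOrth.orthogonal hS h hQ m hmD K (by omega)]
        ring
  exact (main D le_rfl y fun p hp hpD => by omega).2.1 hy

/-- If some `Q k` is not positive, the first such `U k` is selected. It is nonzero because its
diagonal coordinate is 1. Vectors computed after it may be meaningless, but they are not used. -/
theorem firstDirection_spec {D : ℕ} {S U : ℕ → ℕ → ℝ} {Q : ℕ → ℝ}
    (hS : ∀ p < D, ∀ p' < D, S p p' = S p' p) (h : ∀ k < D, IsOrth D S U Q k) :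
    ((∀ p, firstDirection D U Q p = 0) ∧ ∀ y, (∃ p < D, y p ≠ 0) → 0 < form D S y y) ∨
      ((∃ p < D, firstDirection D U Q p ≠ 0) ∧
        form D S (firstDirection D U Q) (firstDirection D U Q) ≤ 0) := by
  by_cases hQ : ∀ k < D, 0 < Q k
  · refine Or.inl ⟨fun p => Finset.sum_eq_zero fun k hk => ?_, IsOrth.form_pos hS h hQ⟩
    rw [if_pos (hQ k (Finset.mem_range.1 hk))]
  · right
    classical
    push Not at hQ
    obtain ⟨hk, hQk⟩ := Nat.find_spec hQ
    set k := Nat.find hQ with hkdef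
    have hmin : ∀ l < k, 0 < Q l := fun l hl => by
      by_contra hneg
      exact Nat.find_min hQ hl ⟨by omega, not_lt.1 hneg⟩
    have hv : firstDirection D U Q = U k := by
      funext p
      rw [firstDirection, Finset.sum_eq_single k]
      · rw [if_neg (not_lt.2 hQk), if_neg]
        rw [Finset.sum_eq_zero fun l hl => if_pos (hmin l (Finset.mem_range.1 hl))]
        exact lt_irrefl _
      · intro l _ hl
        rcases lt_or_gt_of_ne hl with hl | hl
        · rw [if_pos (hmin l hl)]
        · split_ifs with h1 h2
          · rfl
          · rfl
          · exfalso
            refine h2 (Finset.sum_pos' (fun i _ => by split_ifs <;> norm_num)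
              ⟨k, Finset.mem_range.2 hl, ?_⟩)
            rw [if_neg (not_lt.2 hQk)]; exact one_pos
      · intro h'; exact absurd (Finset.mem_range.2 hk) h'
    rw [hv]
    exact ⟨⟨k, hk, by rw [IsOrth.diag h hk]; exact one_ne_zero⟩, (h k hk).2.symm.trans_le hQk⟩

theorem testMatrix_comm (n : ℕ) (ε θ : ℝ) (x : ℕ → ℕ → ℝ) (z : ℕ → ℝ) (mode : ℝ) (p p' : ℕ) :
    testMatrix n ε θ x z mode p p' = testMatrix n ε θ x z mode p' p := by
  rw [testMatrix, testMatrix]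
  congr 1
  · exact if_congr eq_comm rfl rfl
  · exact Finset.sum_congr rfl fun i _ => by ring

theorem form_testMatrix (n D : ℕ) (ε θ : ℝ) (x : ℕ → ℕ → ℝ) (z : ℕ → ℝ) (mode : ℝ)
    (y : ℕ → ℝ) : form D (testMatrix n ε θ x z mode) y y =
      n * (1 + 10 * bound ε θ mode) * ∑ p ∈ Finset.range D, y p ^ 2 -
      ∑ i ∈ Finset.range n, (1 - z i) *
        (∑ p ∈ Finset.range D, y p * (x i p - wmean n x z p)) ^ 2 := by
  have hsub : ∀ p p' A B, y p * (A - B) * y p' = y p * A * y p' - y p * B * y p' := by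
    intros; ring
  simp only [form, testMatrix, hsub, Finset.sum_sub_distrib]
  congr 1
  · rw [Finset.mul_sum]
    refine Finset.sum_congr rfl fun p hp => ?_
    rw [Finset.sum_eq_single p]
    · simp; ring
    · intro p' _ hp'; simp [hp'.symm]
    · intro h; exact absurd hp h
  · simp only [sq, Finset.sum_mul_sum]
    simp only [Finset.mul_sum, Finset.sum_mul]
    refine ((Finset.sum_congr rfl fun _ _ => Finset.sum_comm).trans Finset.sum_comm).trans ?_
    exact Finset.sum_congr rfl fun l _ => Finset.sum_congr rfl fun p _ =>
      Finset.sum_congr rfl fun p' _ => by ring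

end RealRAM.FilterProg

namespace RealRAM.FilterProg

/-! ### One-dimensional projections of a stable set of samples -/

theorem sq_sum_mul_le {ι : Type*} (s : Finset ι) {w y : ι → ℝ} (hw : ∀ i ∈ s, 0 ≤ w i) :
    (∑ i ∈ s, w i * y i) ^ 2 ≤ (∑ i ∈ s, w i) * ∑ i ∈ s, w i * y i ^ 2 :=
  Finset.sum_sq_le_sum_mul_sum_of_sq_le_mul s hw
    (fun i hi => mul_nonneg (hw i hi) (sq_nonneg _)) fun i _ => le_of_eq (by ring)

theorem sum_mul_sub_sq {ι : Type*} (G : Finset ι) (w a : ι → ℝ) (b : ℝ) :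
    ∑ i ∈ G, w i * (a i - b) ^ 2 =
    ∑ i ∈ G, w i * a i ^ 2 - 2 * b * ∑ i ∈ G, w i * a i + b ^ 2 * ∑ i ∈ G, w i := by
  rw [Finset.mul_sum, Finset.mul_sum, ← Finset.sum_sub_distrib, ← Finset.sum_add_distrib]
  exact Finset.sum_congr rfl fun i _ => by ring

/-- The values `a` of a linear functional of squared norm `s` at the samples in `I`, centred at
the true mean, are regular on the subset `G`. -/
structure Stable {ι : Type*} [DecidableEq ι] (I G : Finset ι) (e s L h : ℝ) (a : ι → ℝ) :
    Prop where
  subset : G ⊆ I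
  compl : ((I \ G).card : ℝ) ≤ e * I.card
  e_nonneg : 0 ≤ e
  e_le : e ≤ 1 / 200
  L_nonneg : 0 ≤ L
  h_nonneg : 0 ≤ h
  he : h * e ≤ L
  mean : (∑ i ∈ G, a i) ^ 2 ≤ (I.card : ℝ) ^ 2 * (e * L)
  upper : ∑ i ∈ G, a i ^ 2 ≤ I.card * (s + L)
  tail : ∑ i ∈ G, max 0 (a i ^ 2 - h) ≤ I.card * L
  lower : I.card * (s - L) ≤ ∑ i ∈ G, a i ^ 2

namespace Stable

variable {ι : Type*} [DecidableEq ι] {I G : Finset ι} {e s L h : ℝ} {a : ι → ℝ}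

theorem sum_sdiff (H : Stable I G e s L h a) (f : ι → ℝ) :
    ∑ i ∈ I, f i = ∑ i ∈ G, f i + ∑ i ∈ I \ G, f i := by
  rw [add_comm, Finset.sum_sdiff H.subset]

/-- Split `a ^ 2` into at most `h` plus the tail above `h`: the first part contributes at most `h`
times the mass of `u`, controlled by `he`, and the second is controlled by `tail` because `u ≤ 1`.
-/
theorem light_sum_le (H : Stable I G e s L h a) {u : ι → ℝ} (hu0 : ∀ i ∈ G, 0 ≤ u i)
    (hu1 : ∀ i ∈ G, u i ≤ 1) {c : ℝ} (hc : 0 ≤ c) (hu : ∑ i ∈ G, u i ≤ c * e * I.card) :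
    ∑ i ∈ G, u i * a i ^ 2 ≤ (c + 1) * L * I.card := by
  have hN : (0 : ℝ) ≤ I.card := Nat.cast_nonneg _
  have h1 : ∑ i ∈ G, u i * a i ^ 2 ≤ ∑ i ∈ G, (h * u i + max 0 (a i ^ 2 - h)) := by
    refine Finset.sum_le_sum fun i hi => ?_
    have h2 : a i ^ 2 - h ≤ max 0 (a i ^ 2 - h) := le_max_right _ _
    have h3 : (0 : ℝ) ≤ max 0 (a i ^ 2 - h) := le_max_left _ _
    have h4 := mul_le_mul_of_nonneg_left h2 (hu0 i hi)
    have h5 := mul_le_mul_of_nonneg_right (hu1 i hi) h3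
    linarith
  rw [Finset.sum_add_distrib, ← Finset.mul_sum] at h1
  have h2 : h * ∑ i ∈ G, u i ≤ h * (c * e * I.card) := mul_le_mul_of_nonneg_left hu H.h_nonneg
  have h3 : h * (c * e * I.card) ≤ c * L * I.card := by
    calc h * (c * e * I.card) = (h * e) * (c * I.card) := by ring
      _ ≤ L * (c * I.card) := mul_le_mul_of_nonneg_right H.he (by positivity)
      _ = _ := by ring
  have := H.tail
  nlinarith

/-- The total squared deviation from `b` of the samples outside `G`. -/
noncomputable def excess (I G : Finset ι) (w a : ι → ℝ) (b : ℝ) : ℝ :=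
  ∑ i ∈ I \ G, w i * (a i - b) ^ 2

/-- The removed part of the sum has square at most 3e · 4L in units of `I.card ^ 2` by
Cauchy-Schwarz and `light_sum_le`, and 26 = 2 · 1 + 2 · 12. -/
theorem sq_sum_good_le (H : Stable I G e s L h a) {w : ι → ℝ} (hw0 : ∀ i ∈ I, 0 ≤ w i)
    (hw1 : ∀ i ∈ I, w i ≤ 1) (hG : ∑ i ∈ G, (1 - w i) ≤ 3 * e * I.card) :
    (∑ i ∈ G, w i * a i) ^ 2 ≤ 26 * (I.card : ℝ) ^ 2 * (e * L) := by
  have h1 := sq_sum_mul_le G (w := fun i => 1 - w i) (y := a)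
    fun i hi => by linarith [hw1 i (H.subset hi)]
  have h2 := H.light_sum_le (u := fun i => 1 - w i)
    (fun i hi => by linarith [hw1 i (H.subset hi)])
    (fun i hi => by linarith [hw0 i (H.subset hi)]) (by norm_num) hG
  have h3 : ∑ i ∈ G, w i * a i = ∑ i ∈ G, a i - ∑ i ∈ G, (1 - w i) * a i := by
    rw [← Finset.sum_sub_distrib]; exact Finset.sum_congr rfl fun i _ => by ring
  have h4 : (∑ i ∈ G, (1 - w i)) * ∑ i ∈ G, (1 - w i) * a i ^ 2 ≤
      (3 * e * I.card) * ((3 + 1) * L * I.card) := by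
    refine mul_le_mul hG h2 (Finset.sum_nonneg fun i hi => mul_nonneg
      (by linarith [hw1 i (H.subset hi)]) (sq_nonneg _)) ?_
    have := H.e_nonneg
    positivity
  have h5 := H.mean
  rw [h3]
  nlinarith [sq_nonneg (∑ i ∈ G, a i + ∑ i ∈ G, (1 - w i) * a i)]

/-- The offset `b` of the weighted mean is balanced by the good sum and by the deviations outside
`G`. The latter carry mass at most `e * I.card`, so they act on `b ^ 2` only through `e` times the
excess. -/
theorem sq_center_le (H : Stable I G e s L h a) (hI : 0 < I.card) {w : ι → ℝ}
    (hw0 : ∀ i ∈ I, 0 ≤ w i)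
    (hw1 : ∀ i ∈ I, w i ≤ 1) (hG : ∑ i ∈ G, (1 - w i) ≤ 3 * e * I.card) {b : ℝ}
    (hb : ∑ i ∈ I, w i * (a i - b) = 0) :
    b ^ 2 * I.card ≤ e * (65 * L * I.card + 3 * excess I G w a b) := by
  have hN : (0 : ℝ) < I.card := Nat.cast_pos.2 hI
  set N : ℝ := (I.card : ℝ) with hNdef
  set R := excess I G w a b with hR
  have hBw : ∀ i ∈ I \ G, 0 ≤ w i := fun i hi => hw0 i (Finset.sdiff_subset hi)
  have hR0 : 0 ≤ R := Finset.sum_nonneg fun i hi => mul_nonneg (hBw i hi) (sq_nonneg _)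
  have h1 := H.sq_sum_good_le hw0 hw1 hG
  have h2 := sq_sum_mul_le (I \ G) (w := w) (y := fun i => a i - b) hBw
  have h3 : ∑ i ∈ I \ G, w i ≤ e * N := by
    calc ∑ i ∈ I \ G, w i ≤ ∑ i ∈ I \ G, 1 :=
          Finset.sum_le_sum fun i hi => hw1 i (Finset.sdiff_subset hi)
      _ ≤ e * N := by simpa using H.compl
  have h4 : (∑ i ∈ I \ G, w i * (a i - b)) ^ 2 ≤ e * N * R :=
    h2.trans (mul_le_mul_of_nonneg_right h3 hR0)
  have hcard : N = (G.card : ℝ) + (I \ G).card := by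
    rw [hNdef, ← Nat.cast_add, add_comm, Finset.card_sdiff_add_card_eq_card H.subset]
  have h5 : N * (9 / 10) ≤ ∑ i ∈ G, w i := by
    have e1 : ∑ i ∈ G, (1 - w i) = G.card - ∑ i ∈ G, w i := by
      rw [Finset.sum_sub_distrib]; simp
    have := H.compl
    have := mul_le_mul_of_nonneg_right H.e_le hN.le
    linarith
  have h6 : (∑ i ∈ G, w i) * b = ∑ i ∈ G, w i * a i + ∑ i ∈ I \ G, w i * (a i - b) := by
    rw [H.sum_sdiff] at hb
    have : ∑ i ∈ G, w i * (a i - b) = ∑ i ∈ G, w i * a i - (∑ i ∈ G, w i) * b := by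
      rw [Finset.sum_mul, ← Finset.sum_sub_distrib]
      exact Finset.sum_congr rfl fun i _ => by ring
    linarith
  have h7 : ((∑ i ∈ G, w i) * b) ^ 2 ≤ 52 * N ^ 2 * (e * L) + 2 * (e * N * R) := by
    rw [h6]
    nlinarith [sq_nonneg (∑ i ∈ G, w i * a i - ∑ i ∈ I \ G, w i * (a i - b))]
  have h8 : (N * (9 / 10)) ^ 2 * b ^ 2 ≤ ((∑ i ∈ G, w i) * b) ^ 2 := by
    rw [mul_pow _ b]
    exact mul_le_mul_of_nonneg_right (pow_le_pow_left₀ (by positivity) h5 2) (sq_nonneg _)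
  -- The constants are 52/0.81 and 2/0.81, rounded up.
  have h9 : N * (b ^ 2 * N) ≤ N * (e * (65 * L * N + 3 * R)) := by
    have : 0 ≤ N ^ 2 * (e * L) := by
      have := H.e_nonneg; have := H.L_nonneg; positivity
    have : 0 ≤ e * N * R := by have := H.e_nonneg; positivity
    nlinarith
  exact le_of_mul_le_mul_left h9 hN

theorem cross_le (H : Stable I G e s L h a) (hI : 0 < I.card) {w : ι → ℝ}
    (hw0 : ∀ i ∈ I, 0 ≤ w i)
    (hw1 : ∀ i ∈ I, w i ≤ 1) (hG : ∑ i ∈ G, (1 - w i) ≤ 3 * e * I.card) (b : ℝ) :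
    |2 * b * ∑ i ∈ G, w i * a i| ≤ b ^ 2 * I.card + 26 * I.card * (e * L) := by
  have hN : (0 : ℝ) < I.card := Nat.cast_pos.2 hI
  have h1 := H.sq_sum_good_le hw0 hw1 hG
  set A := ∑ i ∈ G, w i * a i
  have h2 : |2 * b * A| * I.card ≤ (b ^ 2 * I.card + 26 * I.card * (e * L)) * I.card := by
    have : |2 * b * A| * I.card = 2 * (|b| * I.card) * |A| := by
      rw [abs_mul, abs_mul, abs_two]; ring
    rw [this]
    nlinarith [sq_nonneg (|b| * I.card - |A|), sq_abs b, sq_abs A]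
  exact le_of_mul_le_mul_right h2 hN

/-- The surplus in the covariance must come from outside `G`, since the second moment on `G` is at
most `s + L` per sample. Scores above the level `2 * h` keep most of this excess, while on `G` they
retain little more than the tail. -/
theorem scores_good_le (H : Stable I G e s L h a) (hI : 0 < I.card) {w : ι → ℝ}
    (hw0 : ∀ i ∈ I, 0 ≤ w i) (hw1 : ∀ i ∈ I, w i ≤ 1)
    (hG : ∑ i ∈ G, (1 - w i) ≤ 3 * e * I.card) {b : ℝ}
    (hb : ∑ i ∈ I, w i * (a i - b) = 0)
    (hviol : I.card * (s + 10 * L) ≤ ∑ i ∈ I, w i * (a i - b) ^ 2) :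
    ∑ i ∈ G, w i * max 0 ((a i - b) ^ 2 - 2 * h) ≤
        ∑ i ∈ I \ G, w i * max 0 ((a i - b) ^ 2 - 2 * h) ∧
      (0 < L → 0 < ∑ i ∈ I \ G, w i * max 0 ((a i - b) ^ 2 - 2 * h)) := by
  have hN : (0 : ℝ) < I.card := Nat.cast_pos.2 hI
  set N : ℝ := (I.card : ℝ) with hNdef
  set R := excess I G w a b with hR
  have hBw : ∀ i ∈ I \ G, 0 ≤ w i := fun i hi => hw0 i (Finset.sdiff_subset hi)
  have hR0 : 0 ≤ R := Finset.sum_nonneg fun i hi => mul_nonneg (hBw i hi) (sq_nonneg _)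
  have hc := H.sq_center_le hI hw0 hw1 hG hb
  have hx := (abs_le.1 (H.cross_le hI hw0 hw1 hG b)).1
  have he := H.e_nonneg
  have hL := H.L_nonneg
  have heN : e * (65 * L * N + 3 * R) ≤ 1 / 200 * (65 * L * N + 3 * R) :=
    mul_le_mul_of_nonneg_right H.e_le (by positivity)
  have heL : N * (e * L) ≤ N * (1 / 200 * L) := by have := H.e_le; gcongr
  have hwG : ∑ i ∈ G, w i ≤ N := by
    calc ∑ i ∈ G, w i ≤ ∑ i ∈ G, 1 := Finset.sum_le_sum fun i hi => hw1 i (H.subset hi)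
      _ = G.card := by simp
      _ ≤ N := Nat.cast_le.2 (Finset.card_le_card H.subset)
  have hg1 : ∑ i ∈ G, w i * a i ^ 2 ≤ N * (s + L) := le_trans (Finset.sum_le_sum fun i hi =>
    mul_le_of_le_one_left (sq_nonneg _) (hw1 i (H.subset hi))) H.upper
  have hg2 := sum_mul_sub_sq G w a b
  have hg3 : b ^ 2 * ∑ i ∈ G, w i ≤ b ^ 2 * N := mul_le_mul_of_nonneg_left hwG (sq_nonneg _)
  rw [H.sum_sdiff] at hviol
  change _ ≤ _ + R at hviol
  -- Of the surplus 10LN, the good samples explain LN and small multiples of LN and `R` coming from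
  -- `b`.
  have hRL : 5 * L * N ≤ R := by nlinarith
  -- The level `2 * h` is subtracted on mass at most `e * N`, and `h * e ≤ L`.
  have hbad : R - 2 * L * N ≤ ∑ i ∈ I \ G, w i * max 0 ((a i - b) ^ 2 - 2 * h) := by
    have h1 : R - 2 * h * ∑ i ∈ I \ G, w i ≤
        ∑ i ∈ I \ G, w i * max 0 ((a i - b) ^ 2 - 2 * h) := by
      rw [hR, excess, Finset.mul_sum, ← Finset.sum_sub_distrib]
      refine Finset.sum_le_sum fun i hi => ?_
      have := mul_le_mul_of_nonneg_left (le_max_right 0 ((a i - b) ^ 2 - 2 * h)) (hBw i hi)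
      linarith
    have h2 : ∑ i ∈ I \ G, w i ≤ e * N := by
      calc ∑ i ∈ I \ G, w i ≤ ∑ i ∈ I \ G, 1 :=
            Finset.sum_le_sum fun i hi => hw1 i (Finset.sdiff_subset hi)
        _ ≤ e * N := by simpa using H.compl
    have h3 : h * ∑ i ∈ I \ G, w i ≤ L * N := by
      calc h * ∑ i ∈ I \ G, w i ≤ h * (e * N) := mul_le_mul_of_nonneg_left h2 H.h_nonneg
        _ = (h * e) * N := by ring
        _ ≤ L * N := mul_le_mul_of_nonneg_right H.he hN.le
    linarith
  have hgood : ∑ i ∈ G, w i * max 0 ((a i - b) ^ 2 - 2 * h) ≤ 2 * (N * L) + 2 * (b ^ 2 * N) := by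
    have h1 : ∑ i ∈ G, w i * max 0 ((a i - b) ^ 2 - 2 * h) ≤
        ∑ i ∈ G, (2 * max 0 (a i ^ 2 - h) + 2 * b ^ 2 * w i) := by
      refine Finset.sum_le_sum fun i hi => ?_
      -- This is why the scores use twice the level of the tail condition: recentring from the true
      -- mean to the weighted mean doubles the square.
      have hm : max 0 ((a i - b) ^ 2 - 2 * h) ≤ 2 * max 0 (a i ^ 2 - h) + 2 * b ^ 2 := by
        refine max_le (by positivity) ?_
        nlinarith [le_max_right 0 (a i ^ 2 - h), sq_nonneg (a i + b)]
      have h0 := hw0 i (H.subset hi)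
      have h1 := hw1 i (H.subset hi)
      have hm0 : (0 : ℝ) ≤ max 0 (a i ^ 2 - h) := le_max_left _ _
      calc _ ≤ w i * (2 * max 0 (a i ^ 2 - h) + 2 * b ^ 2) := mul_le_mul_of_nonneg_left hm h0
        _ = w i * (2 * max 0 (a i ^ 2 - h)) + 2 * b ^ 2 * w i := by ring
        _ ≤ _ := by
          gcongr ?_ + _
          exact mul_le_of_le_one_left (by positivity) h1
    rw [Finset.sum_add_distrib, ← Finset.mul_sum, ← Finset.mul_sum] at h1
    have := H.tail
    nlinarith
  constructor
  · nlinarith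
  · intro hL'
    have : 0 < L * N := mul_pos hL' hN
    nlinarith

/-- Once the covariance is small, the lower bound on the second moment of `G` leaves little room for
the excess of the other samples. A small excess bounds the offset by `sq_center_le` and also the
second moment of arbitrary light weights, bad samples included. -/
theorem regular (H : Stable I G e s L h a) (hI : 0 < I.card) {w : ι → ℝ}
    (hw0 : ∀ i ∈ I, 0 ≤ w i) (hw1 : ∀ i ∈ I, w i ≤ 1)
    (hG : ∑ i ∈ G, (1 - w i) ≤ 3 * e * I.card) {b : ℝ}
    (hb : ∑ i ∈ I, w i * (a i - b) = 0)
    (hcov : ∑ i ∈ I, w i * (a i - b) ^ 2 ≤ I.card * (s + 10 * L)) :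
    b ^ 2 ≤ 116 * (e * L) ∧ ∀ u : ι → ℝ, (∀ i ∈ I, 0 ≤ u i) → (∀ i ∈ I, u i ≤ w i) →
      ∑ i ∈ I, u i ≤ 4 * e * I.card → ∑ i ∈ I, u i * a i ^ 2 ≤ 41 * L * I.card := by
  have hN : (0 : ℝ) < I.card := Nat.cast_pos.2 hI
  set N : ℝ := (I.card : ℝ) with hNdef
  set R := excess I G w a b with hR
  have hBw : ∀ i ∈ I \ G, 0 ≤ w i := fun i hi => hw0 i (Finset.sdiff_subset hi)
  have hR0 : 0 ≤ R := Finset.sum_nonneg fun i hi => mul_nonneg (hBw i hi) (sq_nonneg _)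
  have hc := H.sq_center_le hI hw0 hw1 hG hb
  have hx := (abs_le.1 (H.cross_le hI hw0 hw1 hG b)).2
  have he := H.e_nonneg
  have hL := H.L_nonneg
  have heN : e * (65 * L * N + 3 * R) ≤ 1 / 200 * (65 * L * N + 3 * R) :=
    mul_le_mul_of_nonneg_right H.e_le (by positivity)
  have heL : N * (e * L) ≤ N * (1 / 200 * L) := by have := H.e_le; gcongr
  have hlight := H.light_sum_le (u := fun i => 1 - w i) (c := 3)
    (fun i hi => by linarith [hw1 i (H.subset hi)])
    (fun i hi => by linarith [hw0 i (H.subset hi)]) (by norm_num) hG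
  have hg1 : N * (s - L) - (3 + 1) * L * N ≤ ∑ i ∈ G, w i * a i ^ 2 := by
    have : ∑ i ∈ G, w i * a i ^ 2 = ∑ i ∈ G, a i ^ 2 - ∑ i ∈ G, (1 - w i) * a i ^ 2 := by
      rw [← Finset.sum_sub_distrib]; exact Finset.sum_congr rfl fun i _ => by ring
    have := H.lower
    linarith
  have hg2 := sum_mul_sub_sq G w a b
  have hg3 : 0 ≤ b ^ 2 * ∑ i ∈ G, w i :=
    mul_nonneg (sq_nonneg _) (Finset.sum_nonneg fun i hi => hw0 i (H.subset hi))
  rw [H.sum_sdiff] at hcov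
  change _ + R ≤ _ at hcov
  have hLN : 0 ≤ L * N := by positivity
  -- 10 from the test, 1 from `lower` and 4 from the weight removed in `G`, with the rest absorbing
  -- the terms in `b`. Then 116 = 65 + 3 · 17.
  have hRL : R ≤ 17 * L * N := by nlinarith
  have hb2 : b ^ 2 * N ≤ 116 * (e * L) * N := by
    have : e * R ≤ e * (17 * L * N) := mul_le_mul_of_nonneg_left hRL he
    nlinarith
  refine ⟨le_of_mul_le_mul_right hb2 hN, fun u hu0 hu1 hu => ?_⟩
  have hb3 : b ^ 2 * N ≤ L * N := by nlinarith
  have hb4 : b ^ 2 ≤ L := le_of_mul_le_mul_right hb3 hN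
  have huG : ∑ i ∈ G, u i ≤ 4 * e * N := le_trans
    (Finset.sum_le_sum_of_subset_of_nonneg H.subset fun i hi _ => hu0 i hi) hu
  have h1 := H.light_sum_le (fun i hi => hu0 i (H.subset hi))
    (fun i hi => (hu1 i (H.subset hi)).trans (hw1 i (H.subset hi))) (by norm_num) huG
  have h2 : ∑ i ∈ I \ G, u i * a i ^ 2 ≤ 2 * R + 2 * b ^ 2 * (e * N) := by
    calc ∑ i ∈ I \ G, u i * a i ^ 2 ≤ ∑ i ∈ I \ G, (2 * (w i * (a i - b) ^ 2) + 2 * b ^ 2) := by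
          refine Finset.sum_le_sum fun i hi => ?_
          have hi' := Finset.sdiff_subset hi
          have h1 := hu1 i hi'
          have h2 := hw1 i hi'
          have h3 := hw0 i hi'
          have h4 : u i * a i ^ 2 ≤ w i * a i ^ 2 := mul_le_mul_of_nonneg_right h1 (sq_nonneg _)
          have h5 : w i * a i ^ 2 ≤ w i * (2 * (a i - b) ^ 2 + 2 * b ^ 2) :=
            mul_le_mul_of_nonneg_left (by nlinarith [sq_nonneg (a i - 2 * b)]) h3
          have h6 : w i * b ^ 2 ≤ b ^ 2 := mul_le_of_le_one_left (sq_nonneg _) h2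
          linarith
      _ = 2 * R + 2 * b ^ 2 * (I \ G).card := by
          rw [Finset.sum_add_distrib, ← Finset.mul_sum, hR, excess]; simp; ring
      _ ≤ _ := by have := H.compl; gcongr
  have h3 : b ^ 2 * (e * N) ≤ L * N := by
    calc b ^ 2 * (e * N) ≤ L * (1 * N) := by
          have := H.e_le
          gcongr; linarith
      _ = _ := by ring
  -- The total is 5 on `G` and 2 · 17 + 2 outside, in units of LN.
  rw [H.sum_sdiff]
  linarith

end Stable

end RealRAM.FilterProg

namespace RealRAM.FilterProg

/-! ### The dynamics of the filter -/

theorem runningMax_nonneg (f : ℕ → ℝ) : ∀ n, 0 ≤ runningMax f n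
  | 0 => le_rfl
  | _ + 1 => le_max_of_le_left (runningMax_nonneg f _)

theorem le_runningMax (f : ℕ → ℝ) : ∀ {n i : ℕ}, i < n → f i ≤ runningMax f n
  | n + 1, i, h => by
    rcases Nat.lt_succ_iff_lt_or_eq.1 h with h | rfl
    · exact le_max_of_le_left (le_runningMax f h)
    · exact le_max_right _ _

theorem exists_eq_runningMax (f : ℕ → ℝ) : ∀ {n : ℕ}, 0 < runningMax f n →
    ∃ i < n, f i = runningMax f n
  | 0, h => absurd h (lt_irrefl _)
  | n + 1, h => by
    rcases max_cases (runningMax f n) (f n) with ⟨h1, _⟩ | ⟨h1, _⟩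
    · rw [runningMax, h1] at h ⊢
      obtain ⟨i, hi, he⟩ := exists_eq_runningMax f h
      exact ⟨i, by omega, he⟩
    · exact ⟨n, by omega, by rw [runningMax, h1]⟩

/-- Valid also when the largest score is 0: division by zero gives zero and nothing is removed. -/
theorem removal_mem {n : ℕ} {z f : ℕ → ℝ} (hf : ∀ i < n, 0 ≤ f i) {i : ℕ} (hi : i < n)
    (hz : z i ≤ 1) : z i ≤ removal n z f i ∧ removal n z f i ≤ 1 := by
  have hm : 0 ≤ maxScore n z f := runningMax_nonneg _ _
  have h1 : 0 ≤ 1 - z i := by linarith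
  constructor
  · rw [removal]
    linarith [div_nonneg (mul_nonneg h1 (hf i hi)) hm]
  · rcases hz.eq_or_lt with h | h
    · rw [removal, h]; simp
    · have h2 : f i ≤ maxScore n z f := by
        have := le_runningMax (fun i => if z i < 1 then f i else 0) hi
        simp only [h, if_true] at this
        exact this
      have h3 : (1 - z i) * f i / maxScore n z f ≤ 1 - z i :=
        div_le_of_le_mul₀ hm h1 (mul_le_mul_of_nonneg_left h2 h1)
      rw [removal]; linarith

/-- Normalizing by the largest score of the remaining samples makes the step as long as possible: a
sample attaining it is removed completely, which forces termination. -/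
theorem exists_removal_eq_one {n : ℕ} {z f : ℕ → ℝ} (h : 0 < maxScore n z f) :
    ∃ i < n, z i < 1 ∧ removal n z f i = 1 := by
  obtain ⟨i, hi, he⟩ := exists_eq_runningMax _ h
  have he' : (if z i < 1 then f i else 0) = maxScore n z f := he
  split_ifs at he' with hz
  · refine ⟨i, hi, hz, ?_⟩
    rw [removal, he', mul_div_assoc, div_self h.ne']; ring
  · exact absurd he' h.ne

/-- The values at the samples, centred at `μ`, of the linear functional given by `v`. -/
noncomputable def proj (D : ℕ) (x : ℕ → ℕ → ℝ) (μ v : ℕ → ℝ) (i : ℕ) : ℝ :=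
  ∑ p ∈ Finset.range D, v p * (x i p - μ p)

/-- The squared norm of the first coordinates of `v`. -/
noncomputable def normSq (D : ℕ) (v : ℕ → ℝ) : ℝ := ∑ p ∈ Finset.range D, v p ^ 2

theorem normSq_nonneg (D : ℕ) (v : ℕ → ℝ) : 0 ≤ normSq D v :=
  Finset.sum_nonneg fun _ _ => sq_nonneg _

/-- The samples in `G` are a stable subset of the samples `x` with respect to the mean `μ`. -/
def StableData (n D : ℕ) (G : Finset ℕ) (e L h : ℝ) (x : ℕ → ℕ → ℝ) (μ : ℕ → ℝ) : Prop :=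
  ∀ v, Stable (Finset.range n) G e (normSq D v) (L * normSq D v) (h * normSq D v) (proj D x μ v)

/-- A direction in the first `D` coordinates is a direction in all of them after extension by zero.
Thus the same `G` serves every round. -/
theorem StableData.restrict {n M D : ℕ} {G : Finset ℕ} {e L h : ℝ} {x : ℕ → ℕ → ℝ} {μ : ℕ → ℝ}
    (H : StableData n M G e L h x μ) (hD : D ≤ M) : StableData n D G e L h x μ := by
  intro v
  have := H fun p => if p < D then v p else 0
  have key : ∀ g : ℕ → ℝ → ℝ, (∀ p, g p 0 = 0) →
      ∑ p ∈ Finset.range M, g p (if p < D then v p else 0) = ∑ p ∈ Finset.range D, g p (v p) := by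
    intro g hg
    rw [← Finset.sum_subset (Finset.range_subset_range.2 hD)]
    · exact Finset.sum_congr rfl fun p hp => by rw [if_pos (Finset.mem_range.1 hp)]
    · intro p _ hp
      rw [if_neg (by simpa using hp), hg]
  have e1 : normSq M (fun p => if p < D then v p else 0) = normSq D v :=
    key (fun _ t => t ^ 2) (by simp)
  have e2 : proj M x μ (fun p => if p < D then v p else 0) = proj D x μ v := by
    funext i
    exact key (fun p t => t * (x i p - μ p)) (by simp)
  rwa [e1, e2] at this

/-- The offset of the weighted mean from `μ` in the direction `v`. -/
noncomputable def offset (n D : ℕ) (x : ℕ → ℕ → ℝ) (z μ v : ℕ → ℝ) : ℝ :=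
  ∑ p ∈ Finset.range D, v p * (wmean n x z p - μ p)

theorem proj_sub_offset (n D : ℕ) (x : ℕ → ℕ → ℝ) (z μ v : ℕ → ℝ) (i : ℕ) :
    proj D x μ v i - offset n D x z μ v = proj D x (wmean n x z) v i := by
  rw [proj, offset, proj, ← Finset.sum_sub_distrib]
  exact Finset.sum_congr rfl fun p _ => by ring

theorem sum_weight_mul_sub_offset {n : ℕ} (D : ℕ) (x : ℕ → ℕ → ℝ) {z : ℕ → ℝ} (μ v : ℕ → ℝ)
    (hW : ∑ i ∈ Finset.range n, (1 - z i) ≠ 0) :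
    ∑ i ∈ Finset.range n, (1 - z i) * (proj D x μ v i - offset n D x z μ v) = 0 := by
  simp only [proj_sub_offset]
  simp only [proj, Finset.mul_sum]
  rw [Finset.sum_comm]
  refine Finset.sum_eq_zero fun p _ => ?_
  have : ∀ i, (1 - z i) * (v p * (x i p - wmean n x z p)) =
      v p * ((1 - z i) * x i p) - v p * wmean n x z p * (1 - z i) := fun i => by ring
  rw [Finset.sum_congr rfl fun i _ => this i, Finset.sum_sub_distrib, ← Finset.mul_sum,
    ← Finset.mul_sum, wmean, mul_assoc, div_mul_cancel₀ _ hW, sub_self]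

/-- The test matrix is positive definite. -/
def Accepts (n D : ℕ) (ε θ : ℝ) (x : ℕ → ℕ → ℝ) (z : ℕ → ℝ) (mode : ℝ) : Prop :=
  ∀ y, (∃ p < D, y p ≠ 0) → 0 < form D (testMatrix n ε θ x z mode) y y

/-- A filter step with a direction `v` in which the weighted covariance is too large. -/
def Violates (n D : ℕ) (ε θ : ℝ) (x : ℕ → ℕ → ℝ) (z : ℕ → ℝ) (mode : ℝ) (v f : ℕ → ℝ) : Prop :=
  0 < normSq D v ∧ form D (testMatrix n ε θ x z mode) v v ≤ 0 ∧
    ∀ i < n, f i = score n D (level θ mode) x z v i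

theorem Accepts.congr {n D : ℕ} {ε θ : ℝ} {x : ℕ → ℕ → ℝ} {z z' : ℕ → ℝ} {mode : ℝ}
    (h : Accepts n D ε θ x z mode) (hz : ∀ i < n, z' i = z i) : Accepts n D ε θ x z' mode := by
  have hw : wmean n x z' = wmean n x z := by
    funext p
    rw [wmean, wmean]
    congr 1 <;> exact Finset.sum_congr rfl fun i hi => by rw [hz i (Finset.mem_range.1 hi)]
  have : testMatrix n ε θ x z' mode = testMatrix n ε θ x z mode := by
    funext p p'
    rw [testMatrix, testMatrix, hw]
    congr 1
    exact Finset.sum_congr rfl fun i hi => by rw [hz i (Finset.mem_range.1 hi)]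
  rw [Accepts, this]
  exact h

/-- If the test passes, the direction and all scores vanish and the state is a fixed point; `hz`
excludes that the mode is abandoned merely because the budget had been exceeded before. -/
theorem IsStep.cases {n D : ℕ} {ε θ : ℝ} {x : ℕ → ℕ → ℝ} {z : ℕ → ℝ} {mode : ℝ} {z' : ℕ → ℝ}
    {mode' : ℝ} (h : IsStep n D ε θ x z mode z' mode')
    (hz : ¬ 0 < mode → ∑ i ∈ Finset.range n, z i ≤ 4 * ε * n) :
    (Accepts n D ε θ x z mode ∧ (∀ i < n, z' i = z i) ∧ mode' = mode) ∨
    ∃ v f, Violates n D ε θ x z mode v f ∧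
      ((Switches n D ε mode z v f ∧ (∀ i < n, z' i = z i) ∧ mode' = 1) ∨
        (¬ Switches n D ε mode z v f ∧ (∀ i < n, z' i = removal n z f i) ∧ mode' = mode)) := by
  obtain ⟨U, Q, v, f, hU, hv, hf, hz', hm⟩ := h
  rcases firstDirection_spec (fun p _ p' _ => testMatrix_comm n ε θ x z mode p p') hU with
    ⟨h0, hpos⟩ | ⟨⟨p, hp, hne⟩, hform⟩
  · left
    have hv0 : ∀ p < D, v p = 0 := fun p hp => by rw [hv p hp, h0]
    have hf0 : ∀ i < n, f i = 0 := fun i hi => by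
      rw [hf i hi, score, Finset.sum_eq_zero fun p hp => by rw [hv0 p (Finset.mem_range.1 hp),
        zero_mul], Finset.sum_eq_zero fun p hp => by rw [hv0 p (Finset.mem_range.1 hp), sq,
        zero_mul]]
      simp
    have hr : ∀ i < n, removal n z f i = z i := fun i hi => by rw [removal, hf0 i hi]; simp
    have hS : ¬ Switches n D ε mode z v f := by
      rintro ⟨h1, h2 | h2⟩
      · rw [Finset.sum_congr rfl fun i hi => hr i (Finset.mem_range.1 hi)] at h2
        exact absurd h2 (not_lt.2 (hz h1))
      · rw [Finset.sum_eq_zero fun p hp => by rw [hv0 p (Finset.mem_range.1 hp), sq,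
          zero_mul]] at h2
        exact lt_irrefl _ h2.2
    exact ⟨hpos, fun i hi => by rw [hz' i hi, if_neg hS, hr i hi], by rw [hm, if_neg hS]⟩
  · right
    refine ⟨v, f, ⟨?_, ?_, hf⟩, ?_⟩
    · refine Finset.sum_pos' (fun _ _ => sq_nonneg _) ⟨p, Finset.mem_range.2 hp, ?_⟩
      rw [hv p hp]; positivity
    · rwa [form_congr hv hv]
    · by_cases hS : Switches n D ε mode z v f
      · exact Or.inl ⟨hS, fun i hi => by rw [hz' i hi, if_pos hS], by rw [hm, if_pos hS]⟩
      · exact Or.inr ⟨hS, fun i hi => by rw [hz' i hi, if_neg hS], by rw [hm, if_neg hS]⟩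

theorem Violates.score_nonneg {n D : ℕ} {ε θ : ℝ} {x : ℕ → ℕ → ℝ} {z : ℕ → ℝ} {mode : ℝ}
    {v f : ℕ → ℝ} (h : Violates n D ε θ x z mode v f) : ∀ i < n, 0 ≤ f i := fun i hi => by
  rw [h.2.2 i hi]; exact le_max_left _ _

open Classical in
/-- A quantity that decreases in every filter step with a violated direction. -/
noncomputable def potential (n : ℕ) (z : ℕ → ℝ) (mode : ℝ) : ℕ :=
  ((Finset.range n).filter fun i => z i < 1).card + if 0 < mode then 0 else 1

theorem potential_lt {n : ℕ} {z f : ℕ → ℝ} {mode : ℝ} {z' : ℕ → ℝ} (hf : ∀ i < n, 0 ≤ f i)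
    (hz : ∀ i < n, z i ≤ 1) (hz' : ∀ i < n, z' i = removal n z f i)
    (hm : 0 < maxScore n z f) : potential n z' mode < potential n z mode := by
  obtain ⟨i, hi, hzi, hri⟩ := exists_removal_eq_one hm
  rw [potential, potential]
  gcongr ?_ + _
  refine Finset.card_lt_card ⟨fun j hj => ?_, fun hsub => ?_⟩
  · rw [Finset.mem_filter] at hj ⊢
    have hjn := Finset.mem_range.1 hj.1
    refine ⟨hj.1, lt_of_le_of_lt ?_ hj.2⟩
    rw [hz' j hjn]
    exact (removal_mem hf hjn (hz j hjn)).1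
  · have := hsub (Finset.mem_filter.2 ⟨Finset.mem_range.2 hi, hzi⟩)
    rw [Finset.mem_filter, hz' i hi, hri] at this
    exact lt_irrefl _ this.2

/-- An invariant of the filter under which it stops with an accepted state. -/
structure FilterInvariant (n D : ℕ) (ε θ : ℝ) (x : ℕ → ℕ → ℝ) (P : (ℕ → ℝ) → ℝ → Prop) :
    Prop where
  congr : ∀ z z' mode, P z mode → (∀ i < n, z' i = z i) → P z' mode
  mem : ∀ z mode, P z mode → ∀ i < n, 0 ≤ z i ∧ z i ≤ 1
  budget : ∀ z mode, P z mode → ¬ 0 < mode → ∑ i ∈ Finset.range n, z i ≤ 4 * ε * n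
  switch : ∀ z mode v f, P z mode → Violates n D ε θ x z mode v f →
    Switches n D ε mode z v f → P z 1
  step : ∀ z mode v f, P z mode → Violates n D ε θ x z mode v f →
    ¬ Switches n D ε mode z v f → P (removal n z f) mode ∧ 0 < maxScore n z f

/-- Every rejecting step lowers `potential`, by a completely removed sample or by the switch of
mode, and accepted states persist. Since the potential is at most `n + 1` initially, `n + 2` steps
cannot all reject. -/
theorem FilterInvariant.round {n D : ℕ} {ε : ℝ} {q : ℚ} {x : ℕ → ℕ → ℝ}
    {P : (ℕ → ℝ) → ℝ → Prop} (H : FilterInvariant n D ε (baseLevel q n ε) x P) {z : ℕ → ℝ}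
    {mode : ℝ} {z' : ℕ → ℝ} {mode' : ℝ} (h : IsRound q n D ε x z mode z' mode')
    (hP : P z mode) : P z' mode' ∧ Accepts n D ε (baseLevel q n ε) x z' mode' ∧
      ∀ i < n, z i ≤ z' i := by
  obtain ⟨Z, m, rfl, rfl, rfl, rfl, hst⟩ := h
  set θ := baseLevel q n ε
  have one : ∀ k < n + 2, P (Z k) (m k) → P (Z (k + 1)) (m (k + 1)) ∧
      (∀ i < n, Z k i ≤ Z (k + 1) i) ∧
      ((Accepts n D ε θ x (Z k) (m k) → Accepts n D ε θ x (Z (k + 1)) (m (k + 1)))) ∧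
      (Accepts n D ε θ x (Z (k + 1)) (m (k + 1)) ∨
        potential n (Z (k + 1)) (m (k + 1)) < potential n (Z k) (m k)) := by
    intro k hk hPk
    rcases (hst k hk).cases (H.budget _ _ hPk) with ⟨ha, hz, hm⟩ | ⟨v, f, hv, hS | hS⟩
    · have ha' : Accepts n D ε θ x (Z (k + 1)) (m (k + 1)) := by
        rw [hm]; exact ha.congr hz
      exact ⟨by rw [hm]; exact H.congr _ _ _ hPk hz, fun i hi => (hz i hi).ge, fun _ => ha',
        Or.inl ha'⟩
    · obtain ⟨hS, hz, hm⟩ := hS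
      refine ⟨by rw [hm]; exact H.congr _ _ _ (H.switch _ _ _ _ hPk hv hS) hz,
        fun i hi => (hz i hi).ge, fun ha => ?_, Or.inr ?_⟩
      · exfalso
        by_cases hne : ∃ p < D, v p ≠ 0
        · exact absurd (ha v hne) (not_lt.2 hv.2.1)
        · push Not at hne
          refine hv.1.ne' (Finset.sum_eq_zero fun p hp => ?_)
          rw [hne p (Finset.mem_range.1 hp)]; simp
      · rw [potential, potential, hm, if_pos one_pos, if_neg hS.1,
          Finset.filter_congr fun i hi => by rw [hz i (Finset.mem_range.1 hi)]]
        omega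
    · obtain ⟨hS, hz, hm⟩ := hS
      obtain ⟨hP', hmax⟩ := H.step _ _ _ _ hPk hv hS
      have hz1 : ∀ i < n, Z k i ≤ 1 := fun i hi => (H.mem _ _ hPk i hi).2
      refine ⟨by rw [hm]; exact H.congr _ _ _ hP' hz, fun i hi => ?_, fun ha => ?_, Or.inr ?_⟩
      · rw [hz i hi]
        exact (removal_mem hv.score_nonneg hi (hz1 i hi)).1
      · exfalso
        by_cases hne : ∃ p < D, v p ≠ 0
        · exact absurd (ha v hne) (not_lt.2 hv.2.1)
        · push Not at hne
          refine hv.1.ne' (Finset.sum_eq_zero fun p hp => ?_)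
          rw [hne p (Finset.mem_range.1 hp)]; simp
      · rw [hm]
        exact potential_lt hv.score_nonneg hz1 hz hmax
  have main : ∀ k ≤ n + 2, P (Z k) (m k) ∧ (∀ i < n, Z 0 i ≤ Z k i) ∧
      (Accepts n D ε θ x (Z k) (m k) ∨ potential n (Z k) (m k) + k ≤ n + 1) := by
    intro k
    induction k with
    | zero =>
      refine fun _ => ⟨hP, fun _ _ => le_rfl, Or.inr ?_⟩
      rw [potential]
      have := Finset.card_filter_le (Finset.range n) fun i => Z 0 i < 1
      rw [Finset.card_range] at this
      split_ifs <;> omega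
    | succ k ih =>
      intro hk
      obtain ⟨h1, h2, h3⟩ := ih (by omega)
      obtain ⟨g1, g2, g3, g4⟩ := one k (by omega) h1
      refine ⟨g1, fun i hi => (h2 i hi).trans (g2 i hi), ?_⟩
      rcases h3 with h3 | h3
      · exact Or.inl (g3 h3)
      · rcases g4 with g4 | g4
        · exact Or.inl g4
        · exact Or.inr (by omega)
  obtain ⟨h1, h2, h3 | h3⟩ := main (n + 2) le_rfl
  · exact ⟨h1, h3, h2⟩
  · omega

end RealRAM.FilterProg

namespace RealRAM.FilterProg

/-! ### The invariants of the filter -/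

theorem form_testMatrix_offset (n D : ℕ) (ε θ : ℝ) (x : ℕ → ℕ → ℝ) (z : ℕ → ℝ) (mode : ℝ)
    (μ v : ℕ → ℝ) : form D (testMatrix n ε θ x z mode) v v =
      n * (1 + 10 * bound ε θ mode) * normSq D v -
        ∑ i ∈ Finset.range n, (1 - z i) * (proj D x μ v i - offset n D x z μ v) ^ 2 := by
  simp only [form_testMatrix, proj_sub_offset]
  rfl

/-- Weights that have removed only little from the good samples. -/
structure Admissible (n : ℕ) (G : Finset ℕ) (ε : ℝ) (z : ℕ → ℝ) : Prop where
  mem : ∀ i < n, 0 ≤ z i ∧ z i ≤ 1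
  good : ∑ i ∈ G, z i ≤ 6 * ε * n

namespace StableData

variable {n D : ℕ} {G : Finset ℕ} {ε θ L h mode : ℝ} {x : ℕ → ℕ → ℝ} {μ z v f : ℕ → ℝ}

theorem sum_bad_le (H : StableData n D G (2 * ε) L h x μ) (hz : ∀ i < n, z i ≤ 1) :
    ∑ i ∈ Finset.range n \ G, z i ≤ 2 * ε * n := by
  have h1 := (H 0).compl
  rw [Finset.card_range] at h1
  calc ∑ i ∈ Finset.range n \ G, z i ≤ ∑ i ∈ Finset.range n \ G, 1 :=
        Finset.sum_le_sum fun i hi =>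
          hz i (Finset.mem_range.1 (Finset.sdiff_subset hi))
    _ ≤ _ := by simpa using h1

theorem sum_le (H : StableData n D G (2 * ε) L h x μ) (hz : Admissible n G ε z) :
    ∑ i ∈ Finset.range n, z i ≤ 8 * ε * n := by
  rw [(H 0).sum_sdiff]
  linarith [H.sum_bad_le fun i hi => (hz.mem i hi).2, hz.good]

theorem half_le (H : StableData n D G (2 * ε) L h x μ) (hz : Admissible n G ε z) :
    (n : ℝ) / 2 ≤ ∑ i ∈ Finset.range n, (1 - z i) := by
  have h1 := H.sum_le hz
  have h2 : 2 * ε * n ≤ 1 / 200 * n :=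
    mul_le_mul_of_nonneg_right (H 0).e_le (Nat.cast_nonneg n)
  have : (0 : ℝ) ≤ n := Nat.cast_nonneg n
  rw [Finset.sum_sub_distrib]
  simp only [Finset.sum_const, Finset.card_range, nsmul_eq_mul, mul_one]
  linarith

/-- Removed masses are scores times weights divided by a common maximum, so the comparison of scores
becomes a comparison of removed masses. -/
theorem removal_good_le (H : StableData n D G (2 * ε) L h x μ) (hn : 0 < n) (hL : 0 < L)
    (hz : Admissible n G ε z) (hlev : level θ mode = 2 * h) (hbd : L ≤ bound ε θ mode)
    (hv : Violates n D ε θ x z mode v f) :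
    ∑ i ∈ G, (removal n z f i - z i) ≤ ∑ i ∈ Finset.range n \ G, (removal n z f i - z i) ∧
      0 < maxScore n z f := by
  have hn' : (0 : ℝ) < n := Nat.cast_pos.2 hn
  have hw0 : ∀ i ∈ Finset.range n, 0 ≤ 1 - z i := fun i hi => by
    linarith [(hz.mem i (Finset.mem_range.1 hi)).2]
  have hw1 : ∀ i ∈ Finset.range n, 1 - z i ≤ 1 := fun i hi => by
    linarith [(hz.mem i (Finset.mem_range.1 hi)).1]
  have hW : ∑ i ∈ Finset.range n, (1 - z i) ≠ 0 := by
    have := H.half_le hz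
    exact (lt_of_lt_of_le (by positivity) this).ne'
  have hviol : ((Finset.range n).card : ℝ) * (normSq D v + 10 * (L * normSq D v)) ≤
      ∑ i ∈ Finset.range n, (1 - z i) * (proj D x μ v i - offset n D x z μ v) ^ 2 := by
    have h1 := hv.2.1
    rw [form_testMatrix_offset n D ε θ x z mode μ v] at h1
    rw [Finset.card_range]
    have : (n : ℝ) * (1 + 10 * L) * normSq D v ≤ n * (1 + 10 * bound ε θ mode) * normSq D v := by
      have := normSq_nonneg D v
      gcongr
    linarith
  obtain ⟨h1, h2⟩ := (H v).scores_good_le (by simpa using hn) hw0 hw1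
    (by simpa [← mul_assoc, show (3 : ℝ) * 2 = 6 by norm_num] using hz.good)
    (sum_weight_mul_sub_offset D x μ v hW) hviol
  have h3 := h2 (mul_pos hL hv.1)
  have hsc : ∀ i < n,
      f i = max 0 ((proj D x μ v i - offset n D x z μ v) ^ 2 - 2 * (h * normSq D v)) := by
    intro i hi
    rw [hv.2.2 i hi, proj_sub_offset, score, hlev, mul_assoc 2]
    rfl
  have hGn : ∀ i ∈ G, i < n := fun i hi => Finset.mem_range.1 ((H 0).subset hi)
  have hBn : ∀ i ∈ Finset.range n \ G, i < n := fun i hi =>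
    Finset.mem_range.1 (Finset.sdiff_subset hi)
  have hsum : ∀ S : Finset ℕ, (∀ i ∈ S, i < n) → ∑ i ∈ S, (1 - z i) *
      max 0 ((proj D x μ v i - offset n D x z μ v) ^ 2 - 2 * (h * normSq D v)) =
      ∑ i ∈ S, (1 - z i) * f i := fun S hS =>
    Finset.sum_congr rfl fun i hi => by rw [hsc i (hS i hi)]
  rw [hsum _ hGn, hsum _ hBn] at h1
  rw [hsum _ hBn] at h3
  have hrem : ∀ i, removal n z f i - z i = (1 - z i) * f i / maxScore n z f := fun i => by
    rw [removal]; ring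
  constructor
  · simp only [hrem, ← Finset.sum_div]
    exact div_le_div_of_nonneg_right h1 (runningMax_nonneg _ _)
  · obtain ⟨i, hi, hlt⟩ := Finset.exists_lt_of_sum_lt
      (show ∑ i ∈ Finset.range n \ G, (0 : ℝ) < ∑ i ∈ Finset.range n \ G, (1 - z i) * f i by
        rwa [Finset.sum_const_zero])
    have hin := hBn i hi
    have hfi := hv.score_nonneg i hin
    have hz1 : z i < 1 := by
      by_contra! hc
      exact absurd hlt (not_lt.2 (mul_nonpos_of_nonpos_of_nonneg (by linarith) hfi))
    have hf : 0 < f i := pos_of_mul_pos_right hlt (by linarith)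
    refine lt_of_lt_of_le hf ?_
    have := le_runningMax (fun i => if z i < 1 then f i else 0) hin
    simp only [hz1, if_true] at this
    exact this

theorem removal_mem_of_violates (hz : ∀ i < n, 0 ≤ z i ∧ z i ≤ 1)
    (hv : Violates n D ε θ x z mode v f) : ∀ i < n, 0 ≤ removal n z f i ∧ removal n z f i ≤ 1 :=
  fun i hi => by
    have := removal_mem hv.score_nonneg hi (hz i hi).2
    exact ⟨(hz i hi).1.trans this.1, this.2⟩

/-- The invariant for distributions of bounded covariance. -/
theorem filterInvariant_bounded (H : StableData n D G (2 * ε) 6 0 x μ) (hn : 0 < n) :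
    FilterInvariant n D ε θ x fun z mode => (∀ i < n, 0 ≤ z i ∧ z i ≤ 1) ∧
      (¬ 0 < mode ∧ ∑ i ∈ Finset.range n, z i ≤ 4 * ε * n ∨
        0 < mode ∧ ∑ i ∈ G, z i ≤ 4 * ε * n + ∑ i ∈ Finset.range n \ G, z i) where
  congr := by
    rintro z z' mode ⟨h1, h2⟩ hz
    refine ⟨fun i hi => by rw [hz i hi]; exact h1 i hi, ?_⟩
    rwa [Finset.sum_congr rfl fun i hi => hz i (Finset.mem_range.1 hi),
      Finset.sum_congr rfl fun i hi => hz i (Finset.mem_range.1 ((H 0).subset hi)),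
      Finset.sum_congr (s₁ := Finset.range n \ G) rfl fun i hi =>
        hz i (Finset.mem_range.1 (Finset.sdiff_subset hi))]
  mem := fun z mode h => h.1
  budget := by
    rintro z mode ⟨_, h | h⟩ hm
    exacts [h.2, absurd h.1 hm]
  switch := by
    -- At the switch the total removed mass is still within the budget 4εn, because the step that
    -- would have exceeded it is discarded; hence the good mass is too.
    rintro z mode v f ⟨h1, h | h⟩ _ hS
    · refine ⟨h1, Or.inr ⟨one_pos, ?_⟩⟩
      have := h.2
      rw [(H 0).sum_sdiff] at this
      have h3 : 0 ≤ ∑ i ∈ Finset.range n \ G, z i := Finset.sum_nonneg fun i hi =>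
        (h1 i (Finset.mem_range.1 (Finset.sdiff_subset hi))).1
      linarith
    · exact absurd h.1 hS.1
  step := by
    rintro z mode v f ⟨h1, h | h⟩ hv hS
    -- In the first mode nothing is known about the tail of `G`; both claims hold because the
    -- program did not switch.
    · have hS' : ∑ i ∈ Finset.range n, removal n z f i ≤ 4 * ε * n ∧ 0 < maxScore n z f := by
        by_contra hc
        refine hS ⟨h.1, ?_⟩
        by_contra! hc'
        refine hc ⟨hc'.1, ?_⟩
        by_contra hc2
        exact absurd hv.1 (not_lt.2 (hc'.2 (not_lt.1 hc2)))
      exact ⟨⟨removal_mem_of_violates h1 hv, Or.inl ⟨h.1, hS'.1⟩⟩, hS'.2⟩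
    · have hbad := H.sum_bad_le fun i hi => (h1 i hi).2
      -- The good mass lost is at most 4εn + 2εn = 6εn, which is the bound in `Admissible`.
      obtain ⟨h3, h4⟩ := H.removal_good_le hn (by norm_num) ⟨h1, by linarith [h.2]⟩
        (by rw [level, if_pos h.1, mul_zero]) (by rw [bound, if_pos h.1]) hv
      refine ⟨⟨removal_mem_of_violates h1 hv, Or.inr ⟨h.1, ?_⟩⟩, h4⟩
      rw [Finset.sum_sub_distrib, Finset.sum_sub_distrib] at h3
      linarith [h.2]

/-- The invariant for sub-Gaussian distributions. -/
theorem filterInvariant_subgaussian (H : StableData n D G (2 * ε) (2 * ε * θ) θ x μ) (hn : 0 < n)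
    (h0 : 0 < 2 * ε * θ) (h6 : 2 * ε * θ ≤ 6) :
    FilterInvariant n D ε θ x fun z mode => (∀ i < n, 0 ≤ z i ∧ z i ≤ 1) ∧ ¬ 0 < mode ∧
      ∑ i ∈ G, z i ≤ ∑ i ∈ Finset.range n \ G, z i := by
  -- The complement of `G` has mass at most 2εn, so the total stays within the budget 4εn.
  have key : ∀ z : ℕ → ℝ, (∀ i < n, z i ≤ 1) → ∑ i ∈ G, z i ≤ ∑ i ∈ Finset.range n \ G, z i →
      ∑ i ∈ Finset.range n, z i ≤ 4 * ε * n := by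
    intro z h1 h2
    have := H.sum_bad_le h1
    rw [(H 0).sum_sdiff]
    linarith
  have main : ∀ z mode v f, ((∀ i < n, 0 ≤ z i ∧ z i ≤ 1) ∧ ¬ 0 < mode ∧
      ∑ i ∈ G, z i ≤ ∑ i ∈ Finset.range n \ G, z i) → Violates n D ε θ x z mode v f →
      ∑ i ∈ G, removal n z f i ≤ ∑ i ∈ Finset.range n \ G, removal n z f i ∧
        0 < maxScore n z f := by
    rintro z mode v f ⟨h1, h2, h3⟩ hv
    have hbad := H.sum_bad_le fun i hi => (h1 i hi).2
    have he := (H 0).e_nonneg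
    have : 0 ≤ 2 * ε * n := by positivity
    obtain ⟨h4, h5⟩ := H.removal_good_le hn h0 ⟨h1, by linarith⟩
      (by rw [level, if_neg h2]) (by rw [bound, if_neg h2]; exact le_min le_rfl h6) hv
    rw [Finset.sum_sub_distrib, Finset.sum_sub_distrib] at h4
    exact ⟨by linarith, h5⟩
  refine ⟨?_, fun z mode h => h.1, ?_, ?_, ?_⟩
  · rintro z z' mode ⟨h1, h2, h3⟩ hz
    refine ⟨fun i hi => by rw [hz i hi]; exact h1 i hi, h2, ?_⟩
    rwa [Finset.sum_congr rfl fun i hi => hz i (Finset.mem_range.1 ((H 0).subset hi)),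
      Finset.sum_congr (s₁ := Finset.range n \ G) rfl fun i hi =>
        hz i (Finset.mem_range.1 (Finset.sdiff_subset hi))]
  · exact fun z mode h _ => key z (fun i hi => (h.1 i hi).2) h.2.2
  -- Neither reason for a switch can occur, so this case is contradictory.
  · intro z mode v f h hv hS
    obtain ⟨h1, h2⟩ := main z mode v f h hv
    have := key _ (fun i hi => (removal_mem_of_violates h.1 hv i hi).2) h1
    rcases hS.2 with h3 | h3
    · exact absurd h3 (not_lt.2 this)
    · exact absurd h2 h3.1
  · intro z mode v f h hv _
    obtain ⟨h1, h2⟩ := main z mode v f h hv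
    exact ⟨⟨removal_mem_of_violates h.1 hv, h.2.1, h1⟩, h2⟩

theorem cov_le_of_accepts (ha : Accepts n D ε θ x z mode) (hbd : bound ε θ mode ≤ L) (v : ℕ → ℝ) :
    ∑ i ∈ Finset.range n, (1 - z i) * (proj D x μ v i - offset n D x z μ v) ^ 2 ≤
      (Finset.range n).card * (normSq D v + 10 * (L * normSq D v)) := by
  have hf : 0 ≤ form D (testMatrix n ε θ x z mode) v v := by
    by_cases hne : ∃ p < D, v p ≠ 0
    · exact (ha v hne).le
    · push Not at hne
      rw [form_congr (y' := 0) (w' := 0) hne hne]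
      simp [form]
  rw [form_testMatrix_offset n D ε θ x z mode μ v] at hf
  rw [Finset.card_range]
  have : (n : ℝ) * (1 + 10 * bound ε θ mode) * normSq D v ≤ n * (1 + 10 * L) * normSq D v := by
    have := normSq_nonneg D v
    gcongr
  linarith

/-- Only `bound ≤ L` is required, so acceptance in the stricter first mode is also sound for a
distribution of bounded covariance. -/
theorem regular_of_accepts (H : StableData n D G (2 * ε) L h x μ) (hn : 0 < n)
    (hz : Admissible n G ε z) (ha : Accepts n D ε θ x z mode) (hbd : bound ε θ mode ≤ L)
    (v : ℕ → ℝ) : offset n D x z μ v ^ 2 ≤ 116 * (2 * ε * (L * normSq D v)) ∧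
      ∀ u : ℕ → ℝ, (∀ i < n, 0 ≤ u i) → (∀ i < n, u i ≤ 1 - z i) →
        ∑ i ∈ Finset.range n, u i ≤ 8 * ε * n →
        ∑ i ∈ Finset.range n, u i * proj D x μ v i ^ 2 ≤ 41 * (L * normSq D v) * n := by
  have hn' : (0 : ℝ) < n := Nat.cast_pos.2 hn
  have hW : ∑ i ∈ Finset.range n, (1 - z i) ≠ 0 := by
    have := H.half_le hz
    exact (lt_of_lt_of_le (by positivity) this).ne'
  obtain ⟨h1, h2⟩ := (H v).regular (w := fun i => 1 - z i) (by simpa using hn)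
    (fun i hi => by linarith [(hz.mem i (Finset.mem_range.1 hi)).2])
    (fun i hi => by linarith [(hz.mem i (Finset.mem_range.1 hi)).1])
    (by simpa [← mul_assoc, show (3 : ℝ) * 2 = 6 by norm_num] using hz.good)
    (sum_weight_mul_sub_offset D x μ v hW) (cov_le_of_accepts ha hbd v)
  refine ⟨h1, fun u hu0 hu1 hu => ?_⟩
  have := h2 u (fun i hi => hu0 i (Finset.mem_range.1 hi)) (fun i hi => hu1 i (Finset.mem_range.1 hi))
    (by rw [Finset.card_range]; linarith)
  rwa [Finset.card_range] at this

/-- The direction is taken to be the offset vector itself, so that one factor of its squared norm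
cancels. -/
theorem normSq_offset_le (H : StableData n D G (2 * ε) L h x μ) (hn : 0 < n) (hL : 0 ≤ L)
    (hz : Admissible n G ε z) (ha : Accepts n D ε θ x z mode) (hbd : bound ε θ mode ≤ L) :
    normSq D (fun p => wmean n x z p - μ p) ≤ 232 * (ε * L) := by
  have h1 := (H.regular_of_accepts hn hz ha hbd fun p => wmean n x z p - μ p).1
  have h2 : offset n D x z μ (fun p => wmean n x z p - μ p) =
      normSq D (fun p => wmean n x z p - μ p) :=
    Finset.sum_congr rfl fun p _ => by ring
  rw [h2] at h1
  rcases (normSq_nonneg D fun p => wmean n x z p - μ p).eq_or_lt with h3 | h3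
  · rw [← h3]
    have := (H 0).e_nonneg
    nlinarith
  · refine le_of_mul_le_mul_right ?_ h3
    linarith

/-- Duality: the sum is tested against itself and Cauchy-Schwarz is applied with weights `u`. The
factor `∑ u`, rather than its worst value 8εn, is what makes the bound additive over consecutive
rounds. -/
theorem normSq_light_sum_le (H : StableData n D G (2 * ε) L h x μ) (hn : 0 < n) (hL : 0 ≤ L)
    (hz : Admissible n G ε z) (ha : Accepts n D ε θ x z mode) (hbd : bound ε θ mode ≤ L)
    {u : ℕ → ℝ} (hu0 : ∀ i < n, 0 ≤ u i) (hu1 : ∀ i < n, u i ≤ 1 - z i)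
    (hu : ∑ i ∈ Finset.range n, u i ≤ 8 * ε * n) :
    normSq D (fun p => ∑ i ∈ Finset.range n, u i * (x i p - μ p)) ≤
      41 * L * n * ∑ i ∈ Finset.range n, u i := by
  set v : ℕ → ℝ := fun p => ∑ i ∈ Finset.range n, u i * (x i p - μ p) with hv
  have h1 := (H.regular_of_accepts hn hz ha hbd v).2 u hu0 hu1 hu
  have h2 : normSq D v = ∑ i ∈ Finset.range n, u i * proj D x μ v i := by
    simp only [proj, Finset.mul_sum]
    rw [Finset.sum_comm]
    refine Finset.sum_congr rfl fun p _ => ?_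
    rw [sq]
    nth_rewrite 2 [hv]
    simp only [Finset.mul_sum]
    exact Finset.sum_congr rfl fun i _ => by ring
  have hu0' : ∀ i ∈ Finset.range n, 0 ≤ u i := fun i hi => hu0 i (Finset.mem_range.1 hi)
  have h3 := sq_sum_mul_le (Finset.range n) (w := u) (y := proj D x μ v) hu0'
  rw [← h2] at h3
  have hU := Finset.sum_nonneg hu0'
  have h4 := h3.trans (mul_le_mul_of_nonneg_left h1 hU)
  rcases (normSq_nonneg D v).eq_or_lt with h5 | h5
  · rw [← h5]; positivity
  · refine le_of_mul_le_mul_right ?_ h5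
    linarith

end StableData

/-! ### The error of the online estimates -/

/-- Rademacher-Menshov: a block is halved, the left half is compared with the end of the block
through its own end `m - 1`, and the right half is already compared with it. Each level of the
recursion costs one application of `H`, and the increments of `R` add up instead of multiplying. -/
theorem dyadic_sum_le {ι : Type*} (J : Finset ι) (g : ℕ → ℕ → ι → ℝ) (R : ℕ → ℝ) {K : ℝ}
    (hK : 0 ≤ K) (hR : Monotone R)
    (H : ∀ s e, s ≤ e → ∑ t ∈ Finset.range (s + 1), ∑ j ∈ J, (g s t j - g e t j) ^ 2 ≤
      K * (R e - R s)) (k : ℕ) : ∀ a,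
    ∑ t ∈ Finset.Ico a (a + 2 ^ k), ∑ j ∈ J, (g t t j - g (a + 2 ^ k - 1) t j) ^ 2 ≤
      (k + 1) ^ 2 * (K * (R (a + 2 ^ k - 1) - R a)) := by
  induction k with
  | zero => intro a; simp
  | succ k ih =>
    intro a
    have hp : 0 < 2 ^ k := by positivity
    set m := a + 2 ^ k with hm
    have he : a + 2 ^ (k + 1) = m + 2 ^ k := by rw [hm, pow_succ]; ring
    rw [he]
    have h1 := ih a
    have h2 := ih m
    have h3 := H (m - 1) (m + 2 ^ k - 1) (by omega)
    have r1 : R a ≤ R (m - 1) := hR (by omega)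
    have r2 : R (m - 1) ≤ R m := hR (by omega)
    have r3 : R m ≤ R (m + 2 ^ k - 1) := hR (by omega)
    rw [← Finset.sum_Ico_consecutive _ (show a ≤ m by omega) (show m ≤ m + 2 ^ k by omega)]
    set e := m + 2 ^ k - 1 with hedef
    have hk : (0 : ℝ) < k + 1 := by positivity
    -- The split is weighted so that (k+1)² grows only to (k+1)(k+2); an even split would double the
    -- constant at each level.
    have hpt : ∀ A B : ℝ, (A + B) ^ 2 ≤ (1 + 1 / (k + 1)) * A ^ 2 + (k + 2) * B ^ 2 := by
      intro A B
      have h : 0 ≤ (A - (k + 1) * B) ^ 2 / (k + 1) := by positivity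
      have h' : (A - (k + 1) * B) ^ 2 / (k + 1) =
          A ^ 2 / (k + 1) - 2 * A * B + (k + 1) * B ^ 2 := by field_simp; ring
      have h'' : (1 + 1 / ((k : ℝ) + 1)) * A ^ 2 = A ^ 2 + A ^ 2 / (k + 1) := by ring
      rw [h'']
      linarith
    have h4 : ∑ t ∈ Finset.Ico a m, ∑ j ∈ J, (g t t j - g e t j) ^ 2 ≤
        (1 + 1 / (k + 1)) * ∑ t ∈ Finset.Ico a m, ∑ j ∈ J, (g t t j - g (m - 1) t j) ^ 2 +
        (k + 2) * ∑ t ∈ Finset.Ico a m, ∑ j ∈ J, (g (m - 1) t j - g e t j) ^ 2 := by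
      simp only [Finset.mul_sum, ← Finset.sum_add_distrib]
      refine Finset.sum_le_sum fun t _ => Finset.sum_le_sum fun j _ => ?_
      have := hpt (g t t j - g (m - 1) t j) (g (m - 1) t j - g e t j)
      rwa [sub_add_sub_cancel] at this
    have h5 : ∑ t ∈ Finset.Ico a m, ∑ j ∈ J, (g (m - 1) t j - g e t j) ^ 2 ≤
        K * (R e - R (m - 1)) := by
      refine le_trans (Finset.sum_le_sum_of_subset_of_nonneg (fun t ht => ?_) fun t _ _ =>
        Finset.sum_nonneg fun j _ => sq_nonneg _) h3
      rw [Finset.mem_Ico] at ht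
      rw [Finset.mem_range]
      omega
    have h6 : (1 + 1 / ((k : ℝ) + 1)) *
        ∑ t ∈ Finset.Ico a m, ∑ j ∈ J, (g t t j - g (m - 1) t j) ^ 2 ≤
        (k + 2) * (k + 1) * (K * (R (m - 1) - R a)) := by
      refine (mul_le_mul_of_nonneg_left h1 (by positivity)).trans (le_of_eq ?_)
      field_simp
      ring
    have h7 := mul_le_mul_of_nonneg_left h5 (show (0 : ℝ) ≤ k + 2 by positivity)
    have k1 : 0 ≤ K * (R (m - 1) - R a) := mul_nonneg hK (by linarith)
    have k2 : 0 ≤ K * (R e - R m) := mul_nonneg hK (by linarith)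
    have k3 : 0 ≤ K * (R m - R (m - 1)) := mul_nonneg hK (by linarith)
    have hk0 : (0 : ℝ) ≤ k := Nat.cast_nonneg k
    push_cast
    nlinarith [mul_nonneg hk0 k1, mul_nonneg hk0 k2, mul_nonneg hk0 k3,
      mul_nonneg (mul_nonneg hk0 hk0) k3]

end RealRAM.FilterProg

namespace RealRAM.FilterProg

theorem sum_range_mul_eq (f : ℕ → ℝ) (d : ℕ) : ∀ m, ∑ p ∈ Finset.range (m * d), f p =
    ∑ t ∈ Finset.range m, ∑ j ∈ Finset.range d, f (t * d + j)
  | 0 => by simp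
  | m + 1 => by
    rw [Nat.succ_mul, Finset.sum_range_add, Finset.sum_range_succ, sum_range_mul_eq f d m]

/-- The unnormalized centred sums `c s p` are compared, because their differences between rounds are
exactly light sums. The diagonal is the final round, controlled by `normSq_offset_le`, plus the
dyadic differences. -/
theorem sum_sq_error_le {n T d : ℕ} (hn : 0 < n) (hT : 0 < T) {ε θ L h : ℝ} {x : ℕ → ℕ → ℝ}
    {μ : ℕ → ℝ} {G : Finset ℕ} (H : StableData n (T * d) G (2 * ε) L h x μ) (hL : 0 ≤ L)
    {Z : ℕ → ℕ → ℝ} {mode : ℕ → ℝ} (hz : ∀ t < T, Admissible n G ε (Z (t + 1)))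
    (ha : ∀ t < T, Accepts n ((t + 1) * d) ε θ x (Z (t + 1)) (mode (t + 1)))
    (hb : ∀ t < T, bound ε θ (mode (t + 1)) ≤ L) (hmono : ∀ t < T, ∀ i < n, Z t i ≤ Z (t + 1) i) :
    ∑ t ∈ Finset.range T, ∑ j ∈ Finset.range d,
      (wmean n x (Z (t + 1)) (t * d + j) - μ (t * d + j)) ^ 2 ≤
        4480 * (Nat.clog 2 T + 1) ^ 2 * (ε * L) := by
  have hn' : (0 : ℝ) < n := Nat.cast_pos.2 hn
  have hε : 0 ≤ ε := by linarith [(H 0).e_nonneg]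
  have hH : ∀ t < T, StableData n ((t + 1) * d) G (2 * ε) L h x μ := fun t ht =>
    H.restrict (Nat.mul_le_mul_right d ht)
  -- The weights are frozen after the last round and `g` below is zero for batches past `T`, so that
  -- the number of rounds may be taken as a power of two.
  set y : ℕ → ℕ → ℝ := fun s => Z (min s (T - 1) + 1) with hy
  have hyT : ∀ s < T, y s = Z (s + 1) := fun s hs => by
    rw [hy]; simp only; rw [min_eq_left (by omega)]
  have hlt : ∀ s, min s (T - 1) < T := fun s => by omega
  have hyadm : ∀ s, Admissible n G ε (y s) := fun s => hz _ (hlt s)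
  have hZmono : ∀ t ≤ T, ∀ s ≤ t, ∀ i < n, Z s i ≤ Z t i := by
    intro t
    induction t with
    | zero => intro _ s hs i _; rw [Nat.le_zero.1 hs]
    | succ t ih =>
      intro ht s hs i hi
      rcases Nat.le_succ_iff.1 hs with hs | rfl
      · exact (ih (by omega) s hs i hi).trans (hmono t (by omega) i hi)
      · exact le_rfl
  have hymono : ∀ s e, s ≤ e → ∀ i < n, y s i ≤ y e i := fun s e hse i hi =>
    hZmono _ (by have := hlt e; omega) _ (by omega) i hi
  set R : ℕ → ℝ := fun s => ∑ i ∈ Finset.range n, y s i with hR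
  have hRmono : Monotone R := fun s e hse => Finset.sum_le_sum fun i hi =>
    hymono s e hse i (Finset.mem_range.1 hi)
  set c : ℕ → ℕ → ℝ := fun s p => ∑ i ∈ Finset.range n, (1 - y s i) * (x i p - μ p) with hc
  set g : ℕ → ℕ → ℕ → ℝ := fun s t j => if t < T then c s (t * d + j) else 0 with hg
  have hdyad := dyadic_sum_le (Finset.range d) g R (K := 41 * L * n) (by positivity) hRmono
    (fun s e hse => ?_) (Nat.clog 2 T) 0
  swap
  · rcases lt_or_ge s T with hs | hs
    · have h1 := (hH s hs).normSq_light_sum_le hn hL (hz s hs) (ha s hs) (hb s hs)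
        (u := fun i => y e i - y s i) (fun i hi => by linarith [hymono s e hse i hi])
        (fun i hi => by rw [hyT s hs]; linarith [((hyadm e).mem i hi).2]) (by
          rw [Finset.sum_sub_distrib]
          have h2 := H.sum_le (hyadm e)
          have h3 : 0 ≤ ∑ i ∈ Finset.range n, y s i := Finset.sum_nonneg fun i hi =>
            ((hyadm s).mem i (Finset.mem_range.1 hi)).1
          linarith)
      rw [normSq, sum_range_mul_eq, Finset.sum_sub_distrib] at h1
      refine le_trans (le_of_eq ?_) h1
      refine Finset.sum_congr rfl fun t ht => Finset.sum_congr rfl fun j _ => ?_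
      rw [Finset.mem_range] at ht
      rw [hg]
      simp only [show t < T by omega, if_true, hc]
      rw [← Finset.sum_sub_distrib]
      congr 1
      exact Finset.sum_congr rfl fun i _ => by ring
    · have he : y e = y s := by
        rw [hy]; simp only; rw [min_eq_right (by omega), min_eq_right (by omega)]
      have hgg : g e = g s := by rw [hg]; simp only [hc, he]
      simp [hgg, hR, he]
  set k := Nat.clog 2 T with hk
  have hkT : T ≤ 2 ^ k := Nat.le_pow_clog (by norm_num) T
  set e := 0 + 2 ^ k - 1 with hedef
  have hye : y e = Z (T - 1 + 1) := by
    rw [hy]; simp only; rw [min_eq_right (by omega)]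
  have hT1 : T - 1 < T := by omega
  have hW : ∀ s, (n : ℝ) / 2 ≤ ∑ i ∈ Finset.range n, (1 - y s i) := fun s => H.half_le (hyadm s)
  have hcw : ∀ s p, c s p = (∑ i ∈ Finset.range n, (1 - y s i)) * (wmean n x (y s) p - μ p) := by
    intro s p
    have : ∑ i ∈ Finset.range n, (1 - y s i) ≠ 0 :=
      (lt_of_lt_of_le (by positivity) (hW s)).ne'
    rw [wmean, mul_sub, mul_div_cancel₀ _ this, Finset.sum_mul, ← Finset.sum_sub_distrib]
    exact Finset.sum_congr rfl fun i _ => by ring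
  have hWn : ∑ i ∈ Finset.range n, (1 - y e i) ≤ n := by
    calc ∑ i ∈ Finset.range n, (1 - y e i) ≤ ∑ i ∈ Finset.range n, (1 : ℝ) :=
          Finset.sum_le_sum fun i hi => by
            linarith [((hyadm e).mem i (Finset.mem_range.1 hi)).1]
      _ = n := by simp
  have hlast : ∑ t ∈ Finset.range T, ∑ j ∈ Finset.range d, g e t j ^ 2 ≤
      (n : ℝ) ^ 2 * (232 * (ε * L)) := by
    have h1 := (hH _ hT1).normSq_offset_le hn hL (hz _ hT1) (ha _ hT1) (hb _ hT1)
    rw [← hye, normSq, Nat.sub_add_cancel hT, sum_range_mul_eq] at h1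
    calc ∑ t ∈ Finset.range T, ∑ j ∈ Finset.range d, g e t j ^ 2
        ≤ ∑ t ∈ Finset.range T, ∑ j ∈ Finset.range d,
          (n : ℝ) ^ 2 * (wmean n x (y e) (t * d + j) - μ (t * d + j)) ^ 2 := by
          refine Finset.sum_le_sum fun t ht => Finset.sum_le_sum fun j _ => ?_
          rw [hg]
          simp only [Finset.mem_range.1 ht, if_true]
          rw [hcw, mul_pow]
          have h0 : 0 ≤ ∑ i ∈ Finset.range n, (1 - y e i) := le_trans (by positivity) (hW e)
          gcongr
      _ = (n : ℝ) ^ 2 * ∑ t ∈ Finset.range T, ∑ j ∈ Finset.range d,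
          (wmean n x (y e) (t * d + j) - μ (t * d + j)) ^ 2 := by
          simp only [Finset.mul_sum]
      _ ≤ _ := by gcongr
  have hRR : R e - R 0 ≤ 8 * ε * n := by
    have h2 := H.sum_le (hyadm e)
    have h3 : 0 ≤ ∑ i ∈ Finset.range n, y 0 i := Finset.sum_nonneg fun i hi =>
      ((hyadm 0).mem i (Finset.mem_range.1 hi)).1
    simp only [hR]
    linarith
  have hdy : ∑ t ∈ Finset.range T, ∑ j ∈ Finset.range d, (g t t j - g e t j) ^ 2 ≤
      ((k : ℝ) + 1) ^ 2 * (41 * L * n * (8 * ε * n)) := by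
    refine le_trans (Finset.sum_le_sum_of_subset_of_nonneg (fun t ht => ?_) fun t _ _ =>
        Finset.sum_nonneg fun j _ => sq_nonneg _) (hdyad.trans ?_)
    · rw [Finset.mem_range] at ht
      rw [Finset.mem_Ico]
      omega
    · gcongr
  have hdiag : ∑ t ∈ Finset.range T, ∑ j ∈ Finset.range d, g t t j ^ 2 ≤
      1120 * ((k : ℝ) + 1) ^ 2 * (n ^ 2 * (ε * L)) := by
    have h1 : ∑ t ∈ Finset.range T, ∑ j ∈ Finset.range d, g t t j ^ 2 ≤
        2 * ∑ t ∈ Finset.range T, ∑ j ∈ Finset.range d, (g t t j - g e t j) ^ 2 +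
        2 * ∑ t ∈ Finset.range T, ∑ j ∈ Finset.range d, g e t j ^ 2 := by
      simp only [Finset.mul_sum, ← Finset.sum_add_distrib]
      refine Finset.sum_le_sum fun t _ => Finset.sum_le_sum fun j _ => ?_
      nlinarith [sq_nonneg (g t t j - 2 * g e t j)]
    have h2 : (1 : ℝ) ≤ ((k : ℝ) + 1) ^ 2 := by
      have : (0 : ℝ) ≤ k := Nat.cast_nonneg k
      nlinarith
    have h3 : 0 ≤ (n : ℝ) ^ 2 * (ε * L) := by positivity
    nlinarith [mul_le_mul_of_nonneg_right h2 h3]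
  -- Normalization: the remaining weight is at least n/2, which turns 1120 = 2 · 41 · 8 + 2 · 232
  -- into 4480.
  have hfin : (n : ℝ) ^ 2 / 4 * ∑ t ∈ Finset.range T, ∑ j ∈ Finset.range d,
      (wmean n x (Z (t + 1)) (t * d + j) - μ (t * d + j)) ^ 2 ≤
      ∑ t ∈ Finset.range T, ∑ j ∈ Finset.range d, g t t j ^ 2 := by
    simp only [Finset.mul_sum]
    refine Finset.sum_le_sum fun t ht => Finset.sum_le_sum fun j _ => ?_
    rw [hg]
    have ht' := Finset.mem_range.1 ht
    simp only [ht', if_true]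
    rw [hcw, mul_pow, hyT t ht']
    gcongr
    have := hW t
    rw [hyT t ht'] at this
    calc (n : ℝ) ^ 2 / 4 = (n / 2) ^ 2 := by ring
      _ ≤ _ := by gcongr
  have hn2 : (0 : ℝ) < (n : ℝ) ^ 2 / 4 := by positivity
  refine le_of_mul_le_mul_left (hfin.trans (hdiag.trans (le_of_eq ?_))) hn2
  ring

theorem clog_add_one_le {T : ℕ} (hT : 0 < T) :
    (Nat.clog 2 T : ℝ) + 1 ≤ 2 * (1 + Real.log T) := by
  have hT' : (1 : ℝ) ≤ T := by exact_mod_cast hT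
  have h0 := Real.log_nonneg hT'
  rcases Nat.lt_or_ge 1 T with h | h
  · have h1 : 2 ^ (Nat.clog 2 T - 1) < T := by
      have := Nat.pow_pred_clog_lt_self (b := 2) (by norm_num) h
      simpa using this
    have h2 : ((Nat.clog 2 T - 1 : ℕ) : ℝ) * Real.log 2 ≤ Real.log T := by
      rw [← Real.log_pow]
      refine Real.log_le_log (by positivity) ?_
      exact_mod_cast h1.le
    have h3 := Real.log_two_gt_d9
    have h4 : 0 < Nat.clog 2 T := Nat.clog_pos (by norm_num) h
    rw [Nat.cast_sub (by omega), Nat.cast_one] at h2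
    by_cases h5 : (Nat.clog 2 T : ℝ) - 1 ≤ 0
    · linarith
    · nlinarith
  · have : T = 1 := by omega
    subst this
    simp

end RealRAM.FilterProg

/-! ### From stable samples in Euclidean space to the error of the program -/

namespace RealRAM.FilterProg

open OnlineMean

theorem Stable.smul {ι : Type*} [DecidableEq ι] {I G : Finset ι} {e s L h : ℝ} {a : ι → ℝ}
    (H : Stable I G e s L h a) (c : ℝ) :
    Stable I G e (c ^ 2 * s) (c ^ 2 * L) (c ^ 2 * h) fun i => c * a i where
  subset := H.subset
  compl := H.compl
  e_nonneg := H.e_nonneg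
  e_le := H.e_le
  L_nonneg := mul_nonneg (sq_nonneg c) H.L_nonneg
  h_nonneg := mul_nonneg (sq_nonneg c) H.h_nonneg
  he := by nlinarith [mul_le_mul_of_nonneg_left H.he (sq_nonneg c)]
  mean := by
    rw [← Finset.mul_sum]
    nlinarith [mul_le_mul_of_nonneg_left H.mean (sq_nonneg c)]
  upper := by
    simp only [mul_pow]
    rw [← Finset.mul_sum]
    nlinarith [mul_le_mul_of_nonneg_left H.upper (sq_nonneg c)]
  tail := by
    have : ∀ i, max 0 ((c * a i) ^ 2 - c ^ 2 * h) = c ^ 2 * max 0 (a i ^ 2 - h) := fun i => by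
      rw [mul_max_of_nonneg _ _ (sq_nonneg c), mul_zero]; congr 1; ring
    simp only [this]
    rw [← Finset.mul_sum]
    nlinarith [mul_le_mul_of_nonneg_left H.tail (sq_nonneg c)]
  lower := by
    simp only [mul_pow]
    rw [← Finset.mul_sum]
    nlinarith [mul_le_mul_of_nonneg_left H.lower (sq_nonneg c)]

theorem Stable.map_fin {n : ℕ} {G : Finset (Fin n)} {e s L h : ℝ} {a : Fin n → ℝ}
    (H : Stable Finset.univ G e s L h a) {a' : ℕ → ℝ} (ha : ∀ i : Fin n, a' i = a i) :
    Stable (Finset.range n) (G.map Fin.valEmbedding) e s L h a' := by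
  have hI : Finset.range n = Finset.univ.map (Fin.valEmbedding (n := n)) := by
    rw [Fin.map_valEmbedding_univ, Nat.Iio_eq_range]
  rw [hI]
  refine ⟨Finset.map_subset_map.2 H.subset, ?_, H.e_nonneg, H.e_le, H.L_nonneg, H.h_nonneg,
    H.he, ?_, ?_, ?_, ?_⟩
  · rw [← Finset.map_sdiff, Finset.card_map, Finset.card_map]
    exact H.compl
  · simpa only [Finset.card_map, Finset.sum_map, Fin.valEmbedding_apply, ha] using H.mean
  · simpa only [Finset.card_map, Finset.sum_map, Fin.valEmbedding_apply, ha] using H.upper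
  · simpa only [Finset.card_map, Finset.sum_map, Fin.valEmbedding_apply, ha] using H.tail
  · simpa only [Finset.card_map, Finset.sum_map, Fin.valEmbedding_apply, ha] using H.lower

theorem sum_batches {T d : ℕ} (f : ℕ → ℝ) : ∑ t ∈ Finset.range T, ∑ j ∈ Finset.range d,
    f (t * d + j) = ∑ p : Fin T × Fin d, f (p.1 * d + p.2) := by
  rw [Fintype.sum_prod_type, Finset.sum_range]
  exact Finset.sum_congr rfl fun t _ => Finset.sum_range _

/-- The samples in `G` are stable with respect to the mean `μ` in all directions. -/
def StableSample {n T d : ℕ} (G : Finset (Fin n)) (e L h : ℝ) (x : Fin n → Space T d)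
    (μ : Space T d) : Prop :=
  ∀ v : Space T d, ‖v‖ = 1 → Stable Finset.univ G e 1 L h fun i => inner ℝ v (x i - μ)

/-- Stability is homogeneous of degree two, so unit vectors suffice; the zero direction is a zero
multiple of any unit vector. -/
theorem StableSample.stableData {n T d : ℕ} (hT : 1 ≤ T) (hd : 1 ≤ d) {G : Finset (Fin n)}
    {e L h : ℝ} {x : Fin n → Space T d} {μ : Space T d} (H : StableSample G e L h x μ) :
    StableData n (T * d) (G.map Fin.valEmbedding) e L h (flatten x)
      (flatten (fun _ : Fin 1 => μ) 0) := by
  intro v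
  set w : Space T d := WithLp.toLp 2 fun p => v (p.1 * d + p.2) with hw
  have hnorm : normSq (T * d) v = ‖w‖ ^ 2 := by
    rw [normSq, sum_range_mul_eq, sum_batches fun p => v p ^ 2, EuclideanSpace.norm_sq_eq]
    exact Finset.sum_congr rfl fun p _ => by rw [Real.norm_eq_abs, sq_abs]
  have hproj : ∀ i : Fin n, proj (T * d) (flatten x) (flatten (fun _ : Fin 1 => μ) 0) v i =
      inner ℝ w (x i - μ) := by
    intro i
    rw [proj, sum_range_mul_eq, sum_batches fun p => v p * (flatten x i p -
      flatten (fun _ : Fin 1 => μ) 0 p), PiLp.inner_apply]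
    refine Finset.sum_congr rfl fun p _ => ?_
    have h1 := flatten_apply x i p.1 p.2
    have h2 := flatten_apply (fun _ : Fin 1 => μ) 0 p.1 p.2
    simp only [Fin.val_zero] at h2
    rw [h1, h2]
    simp [hw, mul_comm]
  have : Nonempty (Fin T × Fin d) := ⟨⟨0, hT⟩, ⟨0, hd⟩⟩
  obtain ⟨u, hu, hwu⟩ : ∃ u : Space T d, ‖u‖ = 1 ∧ w = ‖w‖ • u := by
    by_cases h0 : w = 0
    · obtain ⟨u, hu⟩ := exists_norm_eq (Space T d) zero_le_one
      exact ⟨u, hu, by simp [h0]⟩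
    · refine ⟨(‖w‖)⁻¹ • w, ?_, ?_⟩
      · rw [norm_smul, norm_inv, norm_norm, inv_mul_cancel₀ (norm_ne_zero_iff.2 h0)]
      · rw [smul_smul, mul_inv_cancel₀ (norm_ne_zero_iff.2 h0), one_smul]
  have := ((H u hu).smul ‖w‖).map_fin (a' := proj (T * d) (flatten x)
    (flatten (fun _ : Fin 1 => μ) 0) v) fun i => by
      rw [hproj i]
      nth_rewrite 1 [hwu]
      rw [real_inner_smul_left]
  rw [mul_one] at this
  rwa [hnorm, mul_comm L, mul_comm h]

theorem exists_run_of_invariant (q : ℚ) {n T d : ℕ} (hn : 1 ≤ n) (hT : 1 ≤ T) (hd : 1 ≤ d)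
    {ε L h : ℝ} (hL : 0 ≤ L) {x : Fin n → Space T d} {μ : Space T d} {G : Finset (Fin n)}
    (H : StableSample G (2 * ε) L h x μ) {P : (ℕ → ℝ) → ℝ → Prop}
    (hP : ∀ D ≤ T * d, FilterInvariant n D ε (baseLevel q n ε) (flatten x) P)
    (h0 : ∀ z, (∀ i, z i = 0) → P z 0)
    (hadm : ∀ z mode, P z mode → Admissible n (G.map Fin.valEmbedding) ε z ∧
      bound ε (baseLevel q n ε) mode ≤ L) :
    ∃ (y : Space T d) (m : ℕ), OnlineRun (program q) ε x y m ∧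
      ‖y - μ‖ ≤ 134 * (√(ε * L) * (1 + Real.log T)) := by
  obtain ⟨y, m, hrun, -, Z, mode, hZ, hmode, hround⟩ := onlineRun_program q hn hT hd ε x
  refine ⟨y, m, hrun, ?_⟩
  have hdim : ∀ t < T, (t + 1) * d ≤ T * d := fun t ht => Nat.mul_le_mul_right d ht
  have hinv : ∀ t ≤ T, P (Z t) (mode t) := by
    intro t
    induction t with
    | zero => intro _; rw [hmode]; exact h0 _ hZ
    | succ t ih =>
      intro ht
      exact ((hP _ (hdim t ht)).round (hround t ht).1 (ih (by omega))).1
  have hstep : ∀ t (ht : t < T), _ := fun t ht =>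
    ((hP _ (hdim t ht)).round (hround t ht).1 (hinv t (by omega))).2
  have herr := sum_sq_error_le hn hT (H.stableData hT hd) hL
    (fun t ht => (hadm _ _ (hinv (t + 1) ht)).1) (fun t ht => (hstep t ht).1)
    (fun t ht => (hadm _ _ (hinv (t + 1) ht)).2) fun t ht => (hstep t ht).2
  have hT' : (1 : ℝ) ≤ T := by exact_mod_cast hT
  have hlog := Real.log_nonneg hT'
  have hε : 0 ≤ ε := by linarith [(H.stableData hT hd 0).e_nonneg]
  have hclog := clog_add_one_le hT
  refine abs_le_of_sq_le_sq' ?_ (by positivity) |>.2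
  calc ‖y - μ‖ ^ 2 = ∑ t ∈ Finset.range T, ∑ j ∈ Finset.range d,
        (wmean n (flatten x) (Z (t + 1)) (t * d + j) -
          flatten (fun _ : Fin 1 => μ) 0 (t * d + j)) ^ 2 := by
        rw [EuclideanSpace.norm_sq_eq, Fintype.sum_prod_type, Finset.sum_range]
        refine Finset.sum_congr rfl fun t _ => ?_
        rw [Finset.sum_range]
        refine Finset.sum_congr rfl fun j _ => ?_
        have h2 := flatten_apply (fun _ : Fin 1 => μ) 0 t j
        simp only [Fin.val_zero] at h2
        rw [h2, ← (hround t t.2).2 t.2 j, Real.norm_eq_abs, sq_abs]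
        rfl
    _ ≤ 4480 * (Nat.clog 2 T + 1) ^ 2 * (ε * L) := herr
    _ ≤ 4480 * (2 * (1 + Real.log T)) ^ 2 * (ε * L) := by gcongr
    _ ≤ (134 * (√(ε * L) * (1 + Real.log T))) ^ 2 := by
        have h1 : √(ε * L) ^ 2 = ε * L := Real.sq_sqrt (by positivity)
        have h2 : 0 ≤ (ε * L) * (1 + Real.log T) ^ 2 := by positivity
        calc 4480 * (2 * (1 + Real.log T)) ^ 2 * (ε * L)
            = 17920 * ((ε * L) * (1 + Real.log T) ^ 2) := by ring
          -- 17956 is the square of 134.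
          _ ≤ 17956 * ((ε * L) * (1 + Real.log T) ^ 2) := by linarith
          _ = _ := by rw [mul_pow, mul_pow, h1]; ring

theorem exists_run_of_bounded (q : ℚ) {n T d : ℕ} (hn : 1 ≤ n) (hT : 1 ≤ T) (hd : 1 ≤ d)
    {ε : ℝ} {x : Fin n → Space T d} {μ : Space T d} {G : Finset (Fin n)}
    (H : StableSample G (2 * ε) 6 0 x μ) :
    ∃ (y : Space T d) (m : ℕ), OnlineRun (program q) ε x y m ∧
      ‖y - μ‖ ≤ 134 * (√(ε * 6) * (1 + Real.log T)) := by
  have hS := H.stableData hT hd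
  have hε : 0 ≤ ε := by linarith [(hS 0).e_nonneg]
  refine exists_run_of_invariant q hn hT hd (by norm_num) H
    (fun D hD => (hS.restrict hD).filterInvariant_bounded hn) (fun z hz => ?_) ?_
  · refine ⟨fun i _ => by simp [hz], Or.inl ⟨lt_irrefl _, ?_⟩⟩
    simp only [hz, Finset.sum_const_zero]
    positivity
  · rintro z mode ⟨h1, h2⟩
    have hbad := hS.sum_bad_le fun i hi => (h1 i hi).2
    have hbad0 : 0 ≤ ∑ i ∈ Finset.range n \ G.map Fin.valEmbedding, z i :=
      Finset.sum_nonneg fun i hi => (h1 i (Finset.mem_range.1 (Finset.sdiff_subset hi))).1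
    refine ⟨⟨h1, ?_⟩, ?_⟩
    · rcases h2 with h2 | h2
      · have := h2.2
        rw [(hS 0).sum_sdiff] at this
        have : 0 ≤ 2 * ε * n := by positivity
        linarith
      · linarith [h2.2]
    · rw [bound]
      split_ifs
      exacts [le_rfl, min_le_right _ _]

theorem exists_run_of_subgaussian (q : ℚ) {n T d : ℕ} (hn : 1 ≤ n) (hT : 1 ≤ T) (hd : 1 ≤ d)
    {ε : ℝ} (h0 : 0 < 2 * ε * baseLevel q n ε) (h6 : 2 * ε * baseLevel q n ε ≤ 6)
    {x : Fin n → Space T d} {μ : Space T d} {G : Finset (Fin n)}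
    (H : StableSample G (2 * ε) (2 * ε * baseLevel q n ε) (baseLevel q n ε) x μ) :
    ∃ (y : Space T d) (m : ℕ), OnlineRun (program q) ε x y m ∧
      ‖y - μ‖ ≤ 134 * (√(ε * (2 * ε * baseLevel q n ε)) * (1 + Real.log T)) := by
  have hS := H.stableData hT hd
  have hε : 0 ≤ ε := by linarith [(hS 0).e_nonneg]
  refine exists_run_of_invariant q hn hT hd h0.le H
    (fun D hD => (hS.restrict hD).filterInvariant_subgaussian hn h0 h6) (fun z hz => ?_) ?_
  · exact ⟨fun i _ => by simp [hz], lt_irrefl _, by simp [hz]⟩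
  · rintro z mode ⟨h1, h2, h3⟩
    have hbad := hS.sum_bad_le fun i hi => (h1 i hi).2
    have : 0 ≤ 2 * ε * n := by positivity
    refine ⟨⟨h1, by linarith⟩, ?_⟩
    rw [bound, if_neg h2]
    exact min_le_left _ _

end RealRAM.FilterProg

namespace OnlineMean

open RealRAM.FilterProg MeasureTheory ProbabilityTheory

/-! ### Stability under corruption -/

/-- Conditions on clean samples under which their corrupted versions have a stable subset. -/
structure CleanStable {n T d : ℕ} (G : Finset (Fin n)) (ε L h : ℝ) (c : Fin n → Space T d)
    (μ : Space T d) : Prop where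
  compl : ((Finset.univ \ G).card : ℝ) ≤ ε * n
  mean : ∀ v : Space T d, ‖v‖ = 1 → (∑ i ∈ G, inner ℝ v (c i - μ)) ^ 2 ≤ (n : ℝ) ^ 2 * (ε * L / 4)
  upper : ∀ v : Space T d, ‖v‖ = 1 → ∑ i ∈ G, inner ℝ v (c i - μ) ^ 2 ≤ n * (1 + L)
  tail : ∀ v : Space T d, ‖v‖ = 1 →
    ∑ i ∈ G, max 0 (inner ℝ v (c i - μ) ^ 2 - h) ≤ n * (L / 2 - ε * h)
  lower : ∀ v : Space T d, ‖v‖ = 1 → n * (1 - L / 2) ≤ ∑ i ∈ G, inner ℝ v (c i - μ) ^ 2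

/-- The stable set consists of the good clean samples that were not replaced, renumbered by the
permutation. The margins in `CleanStable` pay for the loss of up to εn samples. -/
theorem CleanStable.exists_stableSample {n T d : ℕ} {G : Finset (Fin n)} {ε L h h' : ℝ}
    {c x : Fin n → Space T d} {μ : Space T d} (H : CleanStable G ε L h c μ) (hε0 : 0 ≤ ε)
    (hε : ε ≤ 1 / 400) (hL : 0 ≤ L) (hh0 : 0 ≤ h) (hh : h ≤ h') (hhL : h' * (2 * ε) ≤ L)
    (hx : IsCorruption ε c x) : ∃ G', StableSample G' (2 * ε) L h' x μ := by
  obtain ⟨σ, hσ⟩ := hx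
  set B : Finset (Fin n) := Finset.univ.filter fun i => x i ≠ c (σ i) with hB
  set S : Finset (Fin n) := G.map σ.symm.toEmbedding with hS
  have hBc : (B.card : ℝ) ≤ ε * n := by
    have : ({i | x i ≠ c (σ i)} : Set (Fin n)).ncard = B.card := by
      rw [hB, Set.ncard_eq_toFinset_card']
      congr 1
      ext i
      simp
    rwa [this] at hσ
  have hSsum : ∀ f : Fin n → ℝ, ∑ i ∈ S, f (σ i) = ∑ i ∈ G, f i := fun f => by
    rw [hS, Finset.sum_map]; simp
  have hxc : ∀ i ∈ S \ B, x i = c (σ i) := fun i hi => by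
    by_contra hc
    exact (Finset.mem_sdiff.1 hi).2 (Finset.mem_filter.2 ⟨Finset.mem_univ _, hc⟩)
  refine ⟨S \ B, fun v hv => ?_⟩
  set a : Fin n → ℝ := fun i => inner ℝ v (c (σ i) - μ) with ha
  have hsum : ∀ f : ℝ → ℝ, ∑ i ∈ S \ B, f (inner ℝ v (x i - μ)) = ∑ i ∈ S \ B, f (a i) := fun f =>
    Finset.sum_congr rfl fun i hi => by rw [hxc i hi]
  have hn : (0 : ℝ) ≤ n := Nat.cast_nonneg n
  have hmean : (∑ i ∈ S, a i) ^ 2 ≤ (n : ℝ) ^ 2 * (ε * L / 4) := by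
    rw [hSsum fun i => inner ℝ v (c i - μ)]; exact H.mean v hv
  have hupper : ∑ i ∈ S, a i ^ 2 ≤ n * (1 + L) := by
    rw [hSsum fun i => inner ℝ v (c i - μ) ^ 2]; exact H.upper v hv
  have htail : ∑ i ∈ S, max 0 (a i ^ 2 - h) ≤ n * (L / 2 - ε * h) := by
    rw [hSsum fun i => max 0 (inner ℝ v (c i - μ) ^ 2 - h)]; exact H.tail v hv
  have hlower : n * (1 - L / 2) ≤ ∑ i ∈ S, a i ^ 2 := by
    rw [hSsum fun i => inner ℝ v (c i - μ) ^ 2]; exact H.lower v hv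
  have hint : ∀ f : Fin n → ℝ, ∑ i ∈ S, f i = ∑ i ∈ S \ B, f i + ∑ i ∈ S ∩ B, f i := fun f => by
      rw [← Finset.sum_sdiff (Finset.inter_subset_left (s₁ := S) (s₂ := B)),
        Finset.sdiff_inter_self_left]
  have hIc : ((S ∩ B).card : ℝ) ≤ ε * n :=
    le_trans (Nat.cast_le.2 (Finset.card_le_card Finset.inter_subset_right)) hBc
  -- Each lost sample costs `h` plus its tail; the term `ε * h` reserved in the tail condition
  -- cancels the first part.
  have hIsq : ∑ i ∈ S ∩ B, a i ^ 2 ≤ n * (L / 2) := by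
    calc ∑ i ∈ S ∩ B, a i ^ 2 ≤ ∑ i ∈ S ∩ B, (h + max 0 (a i ^ 2 - h)) :=
          Finset.sum_le_sum fun i _ => by linarith [le_max_right 0 (a i ^ 2 - h)]
      _ = h * (S ∩ B).card + ∑ i ∈ S ∩ B, max 0 (a i ^ 2 - h) := by
          rw [Finset.sum_add_distrib]; simp [mul_comm]
      _ ≤ h * (ε * n) + ∑ i ∈ S, max 0 (a i ^ 2 - h) := by
          gcongr
          exact Finset.inter_subset_left
      _ ≤ h * (ε * n) + n * (L / 2 - ε * h) := by gcongr
      _ = _ := by ring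
  have hImean : (∑ i ∈ S ∩ B, a i) ^ 2 ≤ (n : ℝ) ^ 2 * (ε * L / 2) := by
    have h1 := sq_sum_le_card_mul_sum_sq (s := S ∩ B) (f := a)
    calc _ ≤ _ := h1
      _ ≤ (ε * n) * (n * (L / 2)) := by gcongr
      _ = _ := by ring
  have hnn : ∀ i ∈ S, i ∉ S \ B → 0 ≤ a i ^ 2 := fun i _ _ => sq_nonneg _
  refine ⟨Finset.subset_univ _, ?_, by positivity, by linarith, hL, by linarith, hhL, ?_, ?_, ?_,
    ?_⟩
  · have h1 : Finset.univ \ (S \ B) ⊆ (Finset.univ \ S) ∪ B := by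
      intro i
      simp only [Finset.mem_sdiff, Finset.mem_union, Finset.mem_univ, true_and]
      tauto
    have h2 : (Finset.univ \ S).card = (Finset.univ \ G).card := by
      rw [← Finset.compl_eq_univ_sdiff, ← Finset.compl_eq_univ_sdiff, Finset.card_compl,
        Finset.card_compl, hS, Finset.card_map]
    have h3 := (Finset.card_le_card h1).trans (Finset.card_union_le _ _)
    rw [h2] at h3
    have h4 : ((Finset.univ \ (S \ B)).card : ℝ) ≤ (Finset.univ \ G).card + B.card := by
      exact_mod_cast h3
    have := H.compl
    simp only [Finset.card_univ, Fintype.card_fin]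
    linarith
  · rw [hsum fun t => t, Finset.card_univ, Fintype.card_fin]
    have h1 := hint a
    have h2 : ∑ i ∈ S \ B, a i = ∑ i ∈ S, a i - ∑ i ∈ S ∩ B, a i := by linarith
    rw [h2]
    -- In units of n²εL, 2 · 1/4 + 2 · 1/2 is below the permitted 2.
    nlinarith [sq_nonneg (∑ i ∈ S, a i + ∑ i ∈ S ∩ B, a i), mul_nonneg (sq_nonneg (n : ℝ))
      (mul_nonneg hε0 hL)]
  · rw [hsum fun t => t ^ 2, Finset.card_univ, Fintype.card_fin]
    exact (Finset.sum_le_sum_of_subset_of_nonneg Finset.sdiff_subset hnn).trans hupper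
  · rw [hsum fun t => max 0 (t ^ 2 - h'), Finset.card_univ, Fintype.card_fin]
    calc ∑ i ∈ S \ B, max 0 (a i ^ 2 - h') ≤ ∑ i ∈ S, max 0 (a i ^ 2 - h) := by
          refine (Finset.sum_le_sum fun i _ => ?_).trans
            (Finset.sum_le_sum_of_subset_of_nonneg Finset.sdiff_subset fun i _ _ =>
              le_max_left 0 (a i ^ 2 - h))
          exact max_le_max le_rfl (by linarith)
      _ ≤ n * (L / 2 - ε * h) := htail
      _ ≤ n * L := by
          have : 0 ≤ ε * h := by positivity
          gcongr
          linarith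
  · rw [hsum fun t => t ^ 2, Finset.card_univ, Fintype.card_fin]
    have := hint fun i => a i ^ 2
    nlinarith

end OnlineMean

namespace OnlineMean

open RealRAM.FilterProg MeasureTheory ProbabilityTheory

/-! ### Concentration of sums over independent samples -/

theorem measure_lt_le_of_integral_le {Ω : Type*} [MeasurableSpace Ω] {ν : Measure Ω}
    [IsProbabilityMeasure ν] {F : Ω → ℝ} (hF : Integrable F ν) (h0 : ∀ ω, 0 ≤ F ω) {t δ : ℝ}
    (ht : 0 < t) (h : ∫ ω, F ω ∂ν ≤ δ * t) : ν {ω | t < F ω} ≤ ENNReal.ofReal δ := by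
  have h1 := mul_meas_ge_le_integral_of_nonneg (Filter.Eventually.of_forall h0) hF t
  have h2 : ν.real {ω | t ≤ F ω} ≤ δ := by
    refine le_of_mul_le_mul_left ?_ ht
    linarith
  calc ν {ω | t < F ω} ≤ ν {ω | t ≤ F ω} := 
        measure_mono (Set.ofPred_subset_ofPred.2 fun ω hω => le_of_lt hω)
    _ = ENNReal.ofReal (ν.real {ω | t ≤ F ω}) := by rw [ofReal_measureReal]
    _ ≤ _ := ENNReal.ofReal_le_ofReal h2

variable {E : Type*} [MeasurableSpace E] {P : Measure E} [IsProbabilityMeasure P]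

theorem memLp_eval {n : ℕ} {f : E → ℝ} {p : ENNReal} (hf : MemLp f p P) (i : Fin n) :
    MemLp (fun c : Fin n → E => f (c i)) p (Measure.pi fun _ => P) :=
  hf.comp_measurePreserving (measurePreserving_eval (fun _ : Fin n => P) i)

theorem integral_sq_sum_sub_le {n : ℕ} {f : E → ℝ} (hf : MemLp f 2 P) :
    Integrable (fun c : Fin n → E => (∑ i, f (c i) - n * ∫ z, f z ∂P) ^ 2)
      (Measure.pi fun _ => P) ∧
    ∫ c : Fin n → E, (∑ i, f (c i) - n * ∫ z, f z ∂P) ^ 2 ∂(Measure.pi fun _ => P) ≤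
      n * ∫ z, f z ^ 2 ∂P := by
  have h1 : MemLp (fun c : Fin n → E => ∑ i, f (c i)) 2 (Measure.pi fun _ => P) :=
    memLp_finsetSum _ fun i _ => memLp_eval hf i
  have h2 : ∫ c : Fin n → E, ∑ i, f (c i) ∂(Measure.pi fun _ => P) = n * ∫ z, f z ∂P := by
    rw [integral_finsetSum _ fun i _ => (memLp_eval hf i).integrable one_le_two]
    simp [integral_comp_eval (μ := fun _ : Fin n => P) hf.aestronglyMeasurable]
  have h3 := variance_sum_pi (ι := Fin n) (μ := fun _ => P) (X := fun _ => f) fun _ => hf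
  have h4 : (∑ i : Fin n, fun c : Fin n → E => f (c i)) = fun c => ∑ i, f (c i) := by
    funext c; simp
  rw [h4, variance_eq_integral h1.aestronglyMeasurable.aemeasurable, h2] at h3
  refine ⟨(h1.sub (memLp_const _)).integrable_sq, ?_⟩
  rw [h3]
  simp only [Finset.sum_const, Finset.card_univ, Fintype.card_fin, nsmul_eq_mul]
  gcongr
  rw [variance_eq_sub hf]
  simp only [Pi.pow_apply]
  linarith [sq_nonneg (∫ z, f z ∂P)]

/-- Chebyshev for a whole vector of statistics at once. The dimension enters polynomially, which the
sample size allows. -/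
theorem measure_sum_sq_deviation_le {κ : Type*} [Fintype κ] {n : ℕ} {f : κ → E → ℝ}
    (hf : ∀ k, MemLp (f k) 2 P) {B t δ : ℝ} (hB : ∑ k, ∫ z, f k z ^ 2 ∂P ≤ B) (ht : 0 < t)
    (h : n * B ≤ δ * t) :
    Measure.pi (fun _ : Fin n => P)
      {c | t < ∑ k, (∑ i, f k (c i) - n * ∫ z, f k z ∂P) ^ 2} ≤ ENNReal.ofReal δ := by
  refine measure_lt_le_of_integral_le (integrable_finsetSum _ fun k _ =>
    (integral_sq_sum_sub_le (hf k)).1) (fun c => Finset.sum_nonneg fun k _ => sq_nonneg _) ht ?_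
  rw [integral_finsetSum _ fun k _ => (integral_sq_sum_sub_le (hf k)).1]
  calc _ ≤ ∑ k, n * ∫ z, f k z ^ 2 ∂P :=
        Finset.sum_le_sum fun k _ => (integral_sq_sum_sub_le (hf k)).2
    _ = n * ∑ k, ∫ z, f k z ^ 2 ∂P := by rw [Finset.mul_sum]
    _ ≤ n * B := by gcongr
    _ ≤ _ := h

end OnlineMean

namespace OnlineMean

open RealRAM.FilterProg MeasureTheory ProbabilityTheory

/-! ### Uniform concentration of linear and quadratic forms -/

variable {T d : ℕ} {P : Measure (Space T d)} [IsProbabilityMeasure P]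

theorem inner_eq_sum (v w : Space T d) : inner ℝ v w = ∑ p, v p * w p := by
  rw [PiLp.inner_apply]
  exact Finset.sum_congr rfl fun p _ => by simp [mul_comm]

theorem inner_sq_eq_sum (v w : Space T d) :
    inner ℝ v w ^ 2 = ∑ p : (Fin T × Fin d) × (Fin T × Fin d), v p.1 * v p.2 * (w p.1 * w p.2) := by
  rw [inner_eq_sum, sq, Finset.sum_mul_sum,
    Fintype.sum_prod_type (γ := ℝ) (f := fun p : (Fin T × Fin d) × (Fin T × Fin d) =>
      v p.1 * v p.2 * (w p.1 * w p.2))]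
  exact Finset.sum_congr rfl fun p _ => Finset.sum_congr rfl fun p' _ => by ring

theorem sum_sq_eq_norm_sq (v : Space T d) : ∑ p, v p ^ 2 = ‖v‖ ^ 2 := by
  rw [EuclideanSpace.norm_sq_eq]
  exact Finset.sum_congr rfl fun p _ => by rw [Real.norm_eq_abs, sq_abs]

theorem sq_linear_le {v : Space T d} (hv : ‖v‖ = 1) (s : Fin T × Fin d → ℝ) :
    (∑ p, v p * s p) ^ 2 ≤ ∑ p, s p ^ 2 := by
  have := Finset.sum_mul_sq_le_sq_mul_sq Finset.univ (fun p => v p) s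
  rwa [sum_sq_eq_norm_sq, hv, one_pow, one_mul] at this

theorem sq_quadratic_le {v : Space T d} (hv : ‖v‖ = 1)
    (s : (Fin T × Fin d) × (Fin T × Fin d) → ℝ) :
    (∑ p, v p.1 * v p.2 * s p) ^ 2 ≤ ∑ p, s p ^ 2 := by
  have := Finset.sum_mul_sq_le_sq_mul_sq Finset.univ
    (fun p : (Fin T × Fin d) × (Fin T × Fin d) => v p.1 * v p.2) s
  have h1 : ∑ p : (Fin T × Fin d) × (Fin T × Fin d), (v p.1 * v p.2) ^ 2 = 1 := by
    rw [Fintype.sum_prod_type]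
    simp only [mul_pow]
    rw [← Finset.sum_mul_sum, sum_sq_eq_norm_sq, hv]
    norm_num
  rwa [h1, one_mul] at this

/-- Uniformity in `v` is free: by Cauchy-Schwarz the deviation in any unit direction is bounded by
the Euclidean norm of the vector of coordinate deviations. -/
theorem measure_linear_deviation_le {n : ℕ} {Z : Space T d → Space T d}
    (hZ : ∀ p, MemLp (fun z => Z z p) 2 P) {B t δ : ℝ} (hB : ∑ p, ∫ z, Z z p ^ 2 ∂P ≤ B)
    (ht : 0 < t) (h : n * B ≤ δ * t) :
    Measure.pi (fun _ : Fin n => P) {c | ¬ ∀ v : Space T d, ‖v‖ = 1 →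
      (∑ i, inner ℝ v (Z (c i)) - n * ∫ z, inner ℝ v (Z z) ∂P) ^ 2 ≤ t} ≤ ENNReal.ofReal δ := by
  refine le_trans (measure_mono fun c hc => ?_) (measure_sum_sq_deviation_le hZ hB ht h)
  simp only [Set.mem_ofPred_eq] at hc ⊢
  by_contra! hle
  refine hc fun v hv => le_trans (le_of_eq ?_) ((sq_linear_le hv _).trans hle)
  congr 1
  simp only [inner_eq_sum]
  rw [integral_finsetSum _ fun p _ => ((hZ p).integrable one_le_two).const_mul _,
    Finset.sum_comm, Finset.mul_sum, ← Finset.sum_sub_distrib]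
  refine Finset.sum_congr rfl fun p _ => ?_
  rw [integral_const_mul, ← Finset.mul_sum]
  ring

/-- The same argument with the Frobenius norm of the matrix of deviations, as the products `v p * v
p'` form a vector of norm 1. -/
theorem measure_quadratic_deviation_le {n : ℕ} {Z : Space T d → Space T d}
    (hZ : ∀ p p', MemLp (fun z => Z z p * Z z p') 2 P) {B t δ : ℝ}
    (hB : ∑ p : (Fin T × Fin d) × (Fin T × Fin d), ∫ z, (Z z p.1 * Z z p.2) ^ 2 ∂P ≤ B)
    (ht : 0 < t) (h : n * B ≤ δ * t) :
    Measure.pi (fun _ : Fin n => P) {c | ¬ ∀ v : Space T d, ‖v‖ = 1 →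
      (∑ i, inner ℝ v (Z (c i)) ^ 2 - n * ∫ z, inner ℝ v (Z z) ^ 2 ∂P) ^ 2 ≤ t} ≤
        ENNReal.ofReal δ := by
  refine le_trans (measure_mono fun c hc => ?_) (measure_sum_sq_deviation_le
    (fun p : (Fin T × Fin d) × (Fin T × Fin d) => hZ p.1 p.2) hB ht h)
  simp only [Set.mem_ofPred_eq] at hc ⊢
  by_contra! hle
  refine hc fun v hv => le_trans (le_of_eq ?_) ((sq_quadratic_le hv _).trans hle)
  congr 1
  simp only [inner_sq_eq_sum]
  rw [integral_finsetSum _ fun p _ => ((hZ p.1 p.2).integrable one_le_two).const_mul _,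
    Finset.sum_comm, Finset.mul_sum, ← Finset.sum_sub_distrib]
  refine Finset.sum_congr rfl fun p _ => ?_
  rw [integral_const_mul, ← Finset.mul_sum]
  ring

/-! ### Moments of a distribution -/

theorem memLp_coord {P : Measure (Space T d)} (hP : MemLp id 2 P) (p : Fin T × Fin d) :
    MemLp (fun z : Space T d => z p) 2 P :=
  (EuclideanSpace.proj (𝕜 := ℝ) p).comp_memLp' hP

theorem mean_apply (hP : MemLp id 2 P) (p : Fin T × Fin d) : mean P p = ∫ z, z p ∂P :=
  ((EuclideanSpace.proj (𝕜 := ℝ) p).integral_comp_comm (hP.integrable one_le_two)).symm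

theorem memLp_centered (hP : MemLp id 2 P) (p : Fin T × Fin d) :
    MemLp (fun z : Space T d => (z - mean P) p) 2 P :=
  (memLp_coord hP p).sub (memLp_const _)

theorem integral_centered (hP : MemLp id 2 P) (v : Space T d) :
    ∫ z, inner ℝ v (z - mean P) ∂P = 0 := by
  simp only [inner_eq_sum]
  rw [integral_finsetSum _ fun p _ => ((memLp_centered hP p).integrable one_le_two).const_mul _]
  refine Finset.sum_eq_zero fun p _ => ?_
  rw [integral_const_mul]
  simp only [PiLp.sub_apply]
  rw [integral_sub ((memLp_coord hP p).integrable one_le_two) (integrable_const _)]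
  simp [mean_apply hP]

theorem integrable_centered_mul (hP : MemLp id 2 P) (p p' : Fin T × Fin d) :
    Integrable (fun z => (z - mean P) p * (z - mean P) p') P :=
  (memLp_centered hP p).integrable_mul (memLp_centered hP p')

theorem integral_centered_mul (hP : MemLp id 2 P) (p p' : Fin T × Fin d) :
    ∫ z, (z - mean P) p * (z - mean P) p' ∂P = covMatrix P p p' := by
  rw [covMatrix, Matrix.of_apply, covariance]
  simp only [PiLp.sub_apply, mean_apply hP]

theorem memLp_inner_centered (hP : MemLp id 2 P) (v : Space T d) :
    MemLp (fun z => inner ℝ v (z - mean P)) 2 P :=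
  (innerSL ℝ v).comp_memLp' (hP.sub (memLp_const _))

theorem integral_inner_sq (hP : MemLp id 2 P) (v : Space T d) :
    ∫ z, inner ℝ v (z - mean P) ^ 2 ∂P = ∑ p, ∑ p', v p * (covMatrix P p p' * v p') := by
  simp only [inner_sq_eq_sum]
  rw [integral_finsetSum _ fun p _ => (integrable_centered_mul hP p.1 p.2).const_mul _,
    Fintype.sum_prod_type]
  refine Finset.sum_congr rfl fun p _ => Finset.sum_congr rfl fun p' _ => ?_
  rw [integral_const_mul, integral_centered_mul hP]
  ring

theorem integral_inner_sq_le (hP : MemLp id 2 P) (hc : (1 - covMatrix P).PosSemidef)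
    (v : Space T d) : ∫ z, inner ℝ v (z - mean P) ^ 2 ∂P ≤ ‖v‖ ^ 2 := by
  have h := hc.dotProduct_mulVec_nonneg (fun p => v p)
  rw [integral_inner_sq hP, ← sum_sq_eq_norm_sq]
  rw [Matrix.sub_mulVec, Matrix.one_mulVec, dotProduct_sub] at h
  simp only [dotProduct, Matrix.mulVec, Finset.mul_sum, Pi.star_apply, star_trivial] at h
  simp only [sq]
  linarith

theorem integral_inner_sq_eq (hP : MemLp id 2 P) (hc : covMatrix P = 1) (v : Space T d) :
    ∫ z, inner ℝ v (z - mean P) ^ 2 ∂P = ‖v‖ ^ 2 := by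
  rw [integral_inner_sq hP, ← sum_sq_eq_norm_sq, hc]
  refine Finset.sum_congr rfl fun p _ => ?_
  simp [Matrix.one_apply, sq]

theorem integral_coord_sq_le (hP : MemLp id 2 P) (hc : (1 - covMatrix P).PosSemidef)
    (p : Fin T × Fin d) : ∫ z, (z - mean P) p ^ 2 ∂P ≤ 1 := by
  have := integral_inner_sq_le hP hc (EuclideanSpace.single p 1)
  simpa [EuclideanSpace.inner_single_left] using this

theorem integrable_centered_sq (hP : MemLp id 2 P) (p : Fin T × Fin d) :
    Integrable (fun z => (z - mean P) p ^ 2) P :=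
  (memLp_centered hP p).integrable_sq

theorem integrable_norm_sq (hP : MemLp id 2 P) :
    Integrable (fun z => ‖z - mean P‖ ^ 2) P := by
  simp only [← sum_sq_eq_norm_sq]
  exact integrable_finsetSum _ fun p _ => integrable_centered_sq hP p

theorem integral_norm_sq_le (hP : MemLp id 2 P) (hc : (1 - covMatrix P).PosSemidef) :
    ∫ z, ‖z - mean P‖ ^ 2 ∂P ≤ T * d := by
  simp only [← sum_sq_eq_norm_sq]
  rw [integral_finsetSum _ fun p _ => integrable_centered_sq hP p]
  calc _ ≤ ∑ p : Fin T × Fin d, (1 : ℝ) := Finset.sum_le_sum fun p _ => integral_coord_sq_le hP hc p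
    _ = _ := by simp

end OnlineMean

namespace OnlineMean

open RealRAM.FilterProg MeasureTheory ProbabilityTheory

/-! ### Stability of samples from a distribution of bounded covariance -/

variable {T d : ℕ}

open Classical in
/-- The vectors `z - μ`, those of squared norm above `R` being replaced by zero. -/
noncomputable def truncation (μ : Space T d) (R : ℝ) (z : Space T d) : Space T d :=
  if ‖z - μ‖ ^ 2 ≤ R then z - μ else 0

theorem measurable_truncation (μ : Space T d) (R : ℝ) : Measurable (truncation μ R) := by
  classical
  refine Measurable.ite ?_ (by fun_prop) (by fun_prop)
  exact measurableSet_le (by fun_prop) (by fun_prop)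

theorem norm_truncation_sq_le {μ : Space T d} {R : ℝ} (hR : 0 ≤ R) (z : Space T d) :
    ‖truncation μ R z‖ ^ 2 ≤ R := by
  rw [truncation]; split_ifs with h
  · exact h
  · simpa using hR

theorem norm_truncation_le (μ : Space T d) (R : ℝ) (z : Space T d) :
    ‖truncation μ R z‖ ^ 2 ≤ ‖z - μ‖ ^ 2 := by
  rw [truncation]; split_ifs
  · exact le_rfl
  · simp

theorem abs_coord_truncation_le {μ : Space T d} {R : ℝ} (hR : 0 ≤ R) (z : Space T d)
    (p : Fin T × Fin d) : |truncation μ R z p| ≤ √R := by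
  refine Real.abs_le_sqrt (le_trans ?_ (norm_truncation_sq_le (μ := μ) hR z))
  rw [← sum_sq_eq_norm_sq]
  exact Finset.single_le_sum (f := fun p => truncation μ R z p ^ 2) (fun p _ => sq_nonneg _)
    (Finset.mem_univ p)

theorem inner_truncation_sq_le (μ : Space T d) (R : ℝ) (v z : Space T d) :
    inner ℝ v (truncation μ R z) ^ 2 ≤ inner ℝ v (z - μ) ^ 2 := by
  rw [truncation]; split_ifs
  · exact le_rfl
  · simp [sq_nonneg]

variable {P : Measure (Space T d)} [IsProbabilityMeasure P]

theorem memLp_truncation {μ : Space T d} {R : ℝ} (hR : 0 ≤ R) (p : Fin T × Fin d) :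
    MemLp (fun z => truncation μ R z p) 2 P := by
  refine MemLp.of_bound ?_ (√R) (Filter.Eventually.of_forall fun z => ?_)
  · have := measurable_truncation μ R
    exact Measurable.aestronglyMeasurable (by fun_prop)
  · exact abs_coord_truncation_le hR z p

theorem memLp_truncation_mul {μ : Space T d} {R : ℝ} (hR : 0 ≤ R) (p p' : Fin T × Fin d) :
    MemLp (fun z => truncation μ R z p * truncation μ R z p') 2 P := by
  refine MemLp.of_bound ?_ (√R * √R) (Filter.Eventually.of_forall fun z => ?_)
  · have := measurable_truncation μ R
    exact Measurable.aestronglyMeasurable (by fun_prop)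
  · rw [Real.norm_eq_abs, abs_mul]
    have h1 := abs_coord_truncation_le (μ := μ) hR z p
    have h2 := abs_coord_truncation_le (μ := μ) hR z p'
    gcongr

theorem sum_integral_truncation_sq_le (hP : MemLp id 2 P) (hc : (1 - covMatrix P).PosSemidef)
    {R : ℝ} (hR : 0 ≤ R) :
    ∑ p, ∫ z, truncation (mean P) R z p ^ 2 ∂P ≤ T * d := by
  rw [← integral_finsetSum _ fun p _ => (memLp_truncation hR p).integrable_sq]
  refine (integral_mono (integrable_finsetSum _ fun p _ =>
    (memLp_truncation hR p).integrable_sq) (integrable_norm_sq hP) fun z => ?_).trans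
      (integral_norm_sq_le hP hc)
  simp only [sum_sq_eq_norm_sq]
  exact norm_truncation_le _ _ _

theorem sum_integral_truncation_mul_sq_le (hP : MemLp id 2 P)
    (hc : (1 - covMatrix P).PosSemidef) {R : ℝ} (hR : 0 ≤ R) :
    ∑ p : (Fin T × Fin d) × (Fin T × Fin d),
      ∫ z, (truncation (mean P) R z p.1 * truncation (mean P) R z p.2) ^ 2 ∂P ≤ R * (T * d) := by
  have hint : ∀ p : (Fin T × Fin d) × (Fin T × Fin d), Integrable (fun z =>
      (truncation (mean P) R z p.1 * truncation (mean P) R z p.2) ^ 2) P := fun p =>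
    (memLp_truncation_mul hR p.1 p.2).integrable_sq
  rw [← integral_finsetSum _ fun p _ => hint p]
  have h1 : ∫ z, R * ‖z - mean P‖ ^ 2 ∂P ≤ R * (T * d) := by
    rw [integral_const_mul]
    exact mul_le_mul_of_nonneg_left (integral_norm_sq_le hP hc) hR
  refine (integral_mono (integrable_finsetSum _ fun p _ => hint p)
    ((integrable_norm_sq hP).const_mul R) fun z => ?_).trans h1
  have h2 : ∑ p : (Fin T × Fin d) × (Fin T × Fin d),
      (truncation (mean P) R z p.1 * truncation (mean P) R z p.2) ^ 2 =
      ‖truncation (mean P) R z‖ ^ 2 * ‖truncation (mean P) R z‖ ^ 2 := by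
    rw [Fintype.sum_prod_type]
    simp only [mul_pow]
    rw [← Finset.sum_mul_sum, sum_sq_eq_norm_sq]
  simp only [h2]
  have h3 := norm_truncation_sq_le (μ := mean P) hR z
  have h4 := norm_truncation_le (mean P) R z
  gcongr

theorem integrable_inner_truncation {μ : Space T d} {R : ℝ} (hR : 0 ≤ R) (v : Space T d) :
    MemLp (fun z => inner ℝ v (truncation μ R z)) 2 P := by
  simp only [inner_eq_sum]
  exact memLp_finsetSum _ fun p _ => (memLp_truncation hR p).const_mul _

theorem integral_inner_truncation_sq_le (hP : MemLp id 2 P) (hc : (1 - covMatrix P).PosSemidef)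
    {R : ℝ} (hR : 0 ≤ R) {v : Space T d} (hv : ‖v‖ = 1) :
    ∫ z, inner ℝ v (truncation (mean P) R z) ^ 2 ∂P ≤ 1 := by
  have := integral_inner_sq_le hP hc v
  rw [hv, one_pow] at this
  exact (integral_mono (integrable_inner_truncation hR v).integrable_sq
    (memLp_inner_centered hP v).integrable_sq fun z => inner_truncation_sq_le _ _ _ _).trans this

/-- The bias of truncation is the mean of the discarded part. There |t| is at most αt²/2 + 1/(2α),
and the constant 1/(2α) is paid by the squared norm divided by `R`; each of the two integrals is at
most α/2. -/
theorem sq_integral_inner_truncation_le (hP : MemLp id 2 P) (hc : (1 - covMatrix P).PosSemidef)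
    {R : ℝ} (hR : 0 < R) {v : Space T d} (hv : ‖v‖ = 1) {α : ℝ} (hα : 0 < α)
    (hαR : T * d ≤ α ^ 2 * R) :
    (∫ z, inner ℝ v (truncation (mean P) R z) ∂P) ^ 2 ≤ α ^ 2 := by
  have hv1 := integral_inner_sq_le hP hc v
  rw [hv, one_pow] at hv1
  have i1 : Integrable (fun z => inner ℝ v (z - mean P)) P :=
    (memLp_inner_centered hP v).integrable one_le_two
  have i2 := (integrable_inner_truncation (P := P) (μ := mean P) hR.le v).integrable one_le_two
  have i3 := (memLp_inner_centered hP v).integrable_sq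
  have key : ∀ z, |inner ℝ v (truncation (mean P) R z) - inner ℝ v (z - mean P)| ≤
      α / 2 * inner ℝ v (z - mean P) ^ 2 + (2 * α * R)⁻¹ * ‖z - mean P‖ ^ 2 := by
    intro z
    rw [truncation]
    split_ifs with h
    · rw [sub_self, abs_zero (α := ℝ)]; positivity
    · rw [inner_zero_right, zero_sub, abs_neg]
      push Not at h
      have h1 : (2 * α)⁻¹ ≤ (2 * α * R)⁻¹ * ‖z - mean P‖ ^ 2 := by
        rw [mul_inv (2 * α) R, mul_assoc]
        refine le_mul_of_one_le_right (by positivity) ?_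
        rw [inv_mul_eq_div, one_le_div hR]
        exact h.le
      have h2 : |inner ℝ v (z - mean P)| ≤ α / 2 * inner ℝ v (z - mean P) ^ 2 + (2 * α)⁻¹ := by
        rw [← sq_abs]
        set s := |inner ℝ v (z - mean P)|
        have h3 : 0 ≤ (α * s - 1) ^ 2 / (2 * α) := by positivity
        have h4 : (α * s - 1) ^ 2 / (2 * α) = α / 2 * s ^ 2 + (2 * α)⁻¹ - s := by
          field_simp; ring
        linarith
      linarith
  have h1 : |∫ z, inner ℝ v (truncation (mean P) R z) ∂P| ≤ α := by
    have h2 : ∫ z, inner ℝ v (truncation (mean P) R z) ∂P =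
        ∫ z, (inner ℝ v (truncation (mean P) R z) - inner ℝ v (z - mean P)) ∂P := by
      rw [integral_sub i2 i1, integral_centered hP, sub_zero]
    rw [h2]
    have i4 : Integrable (fun z => α / 2 * inner ℝ v (z - mean P) ^ 2 +
        (2 * α * R)⁻¹ * ‖z - mean P‖ ^ 2) P :=
      (i3.const_mul _).add ((integrable_norm_sq hP).const_mul _)
    refine abs_integral_le_integral_abs.trans ((integral_mono (i2.sub i1).abs i4 key).trans ?_)
    rw [integral_add (i3.const_mul _) ((integrable_norm_sq hP).const_mul _), integral_const_mul,
      integral_const_mul]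
    have h3 : (2 * α * R)⁻¹ * ∫ z, ‖z - mean P‖ ^ 2 ∂P ≤ (2 * α * R)⁻¹ * (α ^ 2 * R) :=
      mul_le_mul_of_nonneg_left ((integral_norm_sq_le hP hc).trans hαR) (by positivity)
    have h4 : (2 * α * R)⁻¹ * (α ^ 2 * R) = α / 2 := by field_simp
    have h5 := mul_le_mul_of_nonneg_left hv1 (show 0 ≤ α / 2 by positivity)
    linarith
  rw [← sq_abs]
  gcongr

/-- The good set consists of the samples that truncation leaves unchanged. Sums over it are sums of
bounded vectors, so second-moment bounds apply although the distribution need not have fourth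
moments. With `L = 6` the lower condition is void. -/
theorem measure_not_cleanStable_bounded_le (hT : 1 ≤ T) (hd : 1 ≤ d) (hP : MemLp id 2 P)
    (hc : (1 - covMatrix P).PosSemidef) {ε : ℝ} (hε : 0 < ε) {n : ℕ}
    (hn : 1600 * ((T : ℝ) * d) ^ 2 ≤ n * ε) :
    Measure.pi (fun _ : Fin n => P) {c | ¬ ∃ G, CleanStable G ε 6 0 c (mean P)} ≤ 1 / 10 := by
  have hT' : (1 : ℝ) ≤ T := by exact_mod_cast hT
  have hd' : (1 : ℝ) ≤ d := by exact_mod_cast hd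
  set M : ℝ := T * d with hM
  have hM1 : 1 ≤ M := one_le_mul_of_one_le_of_one_le hT' hd'
  have hn0 : (0 : ℝ) < n := by
    have : 0 < n * ε := lt_of_lt_of_le (by positivity) hn
    exact pos_of_mul_pos_left this hε.le
  -- By Markov's inequality at most εn samples have squared norm above `R`, except with probability
  -- 1/40; three such events stay below 1/10. The quadratic event then needs `R * M ≤ n / 40`, the
  -- source of 1600.
  set R : ℝ := 40 * M / ε with hR
  have hR0 : 0 < R := by positivity
  have hRε : R * ε = 40 * M := by rw [hR]; field_simp
  have hM2 : M ≤ M ^ 2 := by nlinarith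
  have e1 := measure_linear_deviation_le (n := n) (P := P)
    (memLp_truncation (μ := mean P) hR0.le) (t := n ^ 2 * ε / 2) (δ := 1 / 40)
    (sum_integral_truncation_sq_le hP hc hR0.le) (by positivity) (by nlinarith)
  have e2 := measure_quadratic_deviation_le (n := n) (P := P)
    (memLp_truncation_mul (μ := mean P) hR0.le) (t := n ^ 2) (δ := 1 / 40)
    (sum_integral_truncation_mul_sq_le hP hc hR0.le) (by positivity) (by
      have : R * M ≤ n / 40 := by
        refine le_of_mul_le_mul_right ?_ hε
        nlinarith
      nlinarith)
  have e3 : Measure.pi (fun _ : Fin n => P)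
      {c | ε * n * R < ∑ i, ‖c i - mean P‖ ^ 2} ≤ ENNReal.ofReal (1 / 40) := by
    have hnorm : MemLp (fun z => ‖z - mean P‖ ^ 2) 1 P := memLp_one_iff_integrable.2
      (integrable_norm_sq hP)
    refine measure_lt_le_of_integral_le (integrable_finsetSum _ fun i _ =>
      memLp_one_iff_integrable.1 (memLp_eval hnorm i)) (fun c => Finset.sum_nonneg fun i _ =>
        sq_nonneg _) (by positivity) ?_
    rw [integral_finsetSum _ fun i _ => memLp_one_iff_integrable.1 (memLp_eval hnorm i)]
    have : ∀ i : Fin n, ∫ c : Fin n → Space T d, ‖c i - mean P‖ ^ 2 ∂(Measure.pi fun _ => P) =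
        ∫ z, ‖z - mean P‖ ^ 2 ∂P := fun i =>
      integral_comp_eval (μ := fun _ : Fin n => P) (f := fun z : Space T d => ‖z - mean P‖ ^ 2)
        hnorm.aestronglyMeasurable
    simp only [this, Finset.sum_const, Finset.card_univ, Fintype.card_fin, nsmul_eq_mul]
    have h1 := mul_le_mul_of_nonneg_left (integral_norm_sq_le hP hc) hn0.le
    rw [← hM] at h1
    nlinarith
  refine le_trans (measure_mono (t := (_ ∪ _) ∪ _) fun c hc' => ?_)
    ((measure_union_le _ _).trans (add_le_add ((measure_union_le _ _).trans (add_le_add e1 e2))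
      e3) |>.trans ?_)
  · by_contra hcon
    simp only [Set.mem_union, Set.mem_ofPred_eq, not_or, not_not, not_lt] at hcon
    obtain ⟨⟨c1, c2⟩, c3⟩ := hcon
    refine hc' ?_
    classical
    set G : Finset (Fin n) := Finset.univ.filter fun i => ‖c i - mean P‖ ^ 2 ≤ R with hG
    have hsum : ∀ (f : ℝ → ℝ), f 0 = 0 → ∀ v : Space T d,
        ∑ i ∈ G, f (inner ℝ v (c i - mean P)) =
          ∑ i, f (inner ℝ v (truncation (mean P) R (c i))) := by
      intro f hf v
      rw [hG, Finset.sum_filter]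
      refine Finset.sum_congr rfl fun i _ => ?_
      rw [truncation]
      split_ifs
      · rfl
      · rw [inner_zero_right, hf]
    have hsq : ∀ v : Space T d, ‖v‖ = 1 → ∑ i ∈ G, inner ℝ v (c i - mean P) ^ 2 ≤ n * 2 := by
      intro v hv
      rw [hsum (fun t => t ^ 2) (by simp) v]
      have h1 := (abs_le_of_sq_le_sq' (c2 v hv) hn0.le).2
      have h2 := mul_le_mul_of_nonneg_left (integral_inner_truncation_sq_le hP hc hR0.le hv) hn0.le
      linarith
    refine ⟨G, ?_, fun v hv => ?_, fun v hv => ?_, fun v hv => ?_, fun v hv => ?_⟩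
    · have h1 : R * (Finset.univ \ G).card ≤ ∑ i, ‖c i - mean P‖ ^ 2 := by
        calc R * (Finset.univ \ G).card = ∑ i ∈ Finset.univ \ G, R := by simp [mul_comm]
          _ ≤ ∑ i ∈ Finset.univ \ G, ‖c i - mean P‖ ^ 2 := by
              refine Finset.sum_le_sum fun i hi => ?_
              by_contra! hlt
              exact (Finset.mem_sdiff.1 hi).2 (Finset.mem_filter.2 ⟨Finset.mem_univ _, hlt.le⟩)
          _ ≤ _ := Finset.sum_le_sum_of_subset_of_nonneg (Finset.subset_univ _) fun i _ _ =>
              sq_nonneg _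
      refine le_of_mul_le_mul_left ?_ hR0
      linarith
    · rw [hsum (fun t => t) rfl v]
      have h1 := c1 v hv
      have hα : √(ε / 40) ^ 2 = ε / 40 := Real.sq_sqrt (by positivity)
      -- This choice gives α²R = M, so the truncation bias is of order √ε.
      have h2 := sq_integral_inner_truncation_le hP hc hR0 hv (α := √(ε / 40)) (by positivity)
        (by rw [hα]; linarith)
      rw [hα] at h2
      set I := ∫ z, inner ℝ v (truncation (mean P) R z) ∂P
      set S := ∑ i, inner ℝ v (truncation (mean P) R (c i))
      have h3 : (n : ℝ) ^ 2 * I ^ 2 ≤ n ^ 2 * (ε / 40) := by gcongr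
      have h4 : S ^ 2 ≤ 2 * (S - n * I) ^ 2 + 2 * (n ^ 2 * I ^ 2) := by
        nlinarith [sq_nonneg (S - 2 * n * I)]
      have h5 : 0 ≤ (n : ℝ) ^ 2 * ε := by positivity
      linarith
    · have := hsq v hv
      linarith
    · have := hsq v hv
      simp only [sub_zero, max_eq_right (sq_nonneg _)]
      linarith
    · have : 0 ≤ ∑ i ∈ G, inner ℝ v (c i - mean P) ^ 2 := Finset.sum_nonneg fun i _ => sq_nonneg _
      linarith
  · rw [← ENNReal.ofReal_add (by norm_num) (by norm_num), ← ENNReal.ofReal_add (by norm_num)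
      (by norm_num), show (1 : ENNReal) / 10 = ENNReal.ofReal (1 / 10) by
        rw [ENNReal.ofReal_div_of_pos (by norm_num)]; simp]
    exact ENNReal.ofReal_le_ofReal (by norm_num)

end OnlineMean

namespace OnlineMean

open RealRAM.FilterProg MeasureTheory ProbabilityTheory

/-! ### Exponential moments of sub-Gaussian distributions -/

/-- The tail bound says that the exponential exceeds `t` with probability at most 2t⁻². The layer
cake formula gives 1 on (0,1] and 2 beyond. -/
theorem lintegral_exp_sq_le {Ω : Type*} [MeasurableSpace Ω] {ν : Measure Ω}
    [IsProbabilityMeasure ν] {a : Ω → ℝ} (ha : Measurable a) {K : ℝ} (hK : 0 < K)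
    (h : ∀ q : ℝ, 0 < q → ν.real {ω | q < |a ω|} ≤ 2 * Real.exp (-q ^ 2 / (2 * K ^ 2))) :
    ∫⁻ ω, ENNReal.ofReal (Real.exp (a ω ^ 2 / (4 * K ^ 2))) ∂ν ≤ ENNReal.ofReal 3 := by
  rw [lintegral_eq_lintegral_meas_lt ν (Filter.Eventually.of_forall fun ω => (Real.exp_pos _).le)
    (by fun_prop)]
  have hsplit : Set.Ioi (0 : ℝ) = Set.Ioc 0 1 ∪ Set.Ioi 1 :=
    (Set.Ioc_union_Ioi_eq_Ioi zero_le_one).symm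
  rw [hsplit, lintegral_union measurableSet_Ioi Set.Ioc_disjoint_Ioi_same,
    show (3 : ℝ) = 1 + 2 by norm_num, ENNReal.ofReal_add (by norm_num) (by norm_num)]
  gcongr ?_ + ?_
  · calc _ ≤ ∫⁻ t in Set.Ioc (0 : ℝ) 1, 1 := lintegral_mono fun t => prob_le_one
      _ = _ := by simp
  · have h2 : ∫ t in Set.Ioi (1 : ℝ), 2 * t ^ (-2 : ℝ) = 2 := by
      rw [integral_const_mul, integral_Ioi_rpow_of_lt (by norm_num) one_pos]
      norm_num
    rw [← h2, ofReal_integral_eq_lintegral_ofReal]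
    · refine setLIntegral_mono' measurableSet_Ioi fun t ht => ?_
      have ht1 : (1 : ℝ) < t := ht
      have hlog := Real.log_pos ht1
      have hq : 0 < √(4 * K ^ 2 * Real.log t) := by positivity
      have hsq : √(4 * K ^ 2 * Real.log t) ^ 2 = 4 * K ^ 2 * Real.log t :=
        Real.sq_sqrt (by positivity)
      have h3 := h _ hq
      rw [hsq] at h3
      have h4 : Real.exp (-(4 * K ^ 2 * Real.log t) / (2 * K ^ 2)) = t ^ (-2 : ℝ) := by
        rw [Real.rpow_def_of_pos (by linarith)]
        congr 1
        field_simp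
        ring
      rw [h4] at h3
      have h5 : {ω | t < Real.exp (a ω ^ 2 / (4 * K ^ 2))} =
          {ω | √(4 * K ^ 2 * Real.log t) < |a ω|} := by
        ext ω
        simp only [Set.mem_ofPred_eq]
        rw [← Real.log_lt_iff_lt_exp (by linarith), lt_div_iff₀ (by positivity),
          ← Real.sqrt_sq_eq_abs, Real.sqrt_lt_sqrt_iff (by positivity), mul_comm (Real.log t)]
      rw [h5, ← ofReal_measureReal]
      exact ENNReal.ofReal_le_ofReal h3
    · exact (integrableOn_Ioi_rpow_of_lt (by norm_num) one_pos).const_mul 2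
    · refine (ae_restrict_iff' measurableSet_Ioi).2 (Filter.Eventually.of_forall fun t ht => ?_)
      have : (0 : ℝ) < t := lt_trans one_pos ht
      positivity

variable {T d : ℕ} {P : Measure (Space T d)} [IsProbabilityMeasure P] {K : ℝ}

theorem IsSubgaussian.exp_sq (hs : IsSubgaussian K P) (hK : 0 < K) {w : Space T d}
    (hw : ‖w‖ ≤ 1) :
    Integrable (fun z => Real.exp (inner ℝ w (z - mean P) ^ 2 / (4 * K ^ 2))) P ∧
      ∫ z, Real.exp (inner ℝ w (z - mean P) ^ 2 / (4 * K ^ 2)) ∂P ≤ 3 := by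
  have hm : Measurable fun z => Real.exp (inner ℝ w (z - mean P) ^ 2 / (4 * K ^ 2)) := by fun_prop
  have key : ∫⁻ z, ENNReal.ofReal (Real.exp (inner ℝ w (z - mean P) ^ 2 / (4 * K ^ 2))) ∂P ≤
      ENNReal.ofReal 3 := by
    rcases eq_or_ne w 0 with rfl | h0
    · simp
    · have hu : ‖(‖w‖)⁻¹ • w‖ = 1 := by
        rw [norm_smul, norm_inv, norm_norm, inv_mul_cancel₀ (norm_ne_zero_iff.2 h0)]
      refine (lintegral_mono fun z => ENNReal.ofReal_le_ofReal ?_).trans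
        (lintegral_exp_sq_le (a := fun z => inner ℝ ((‖w‖)⁻¹ • w) (z - mean P)) (by fun_prop) hK
          (hs _ hu))
      rw [real_inner_smul_left, mul_pow]
      refine Real.exp_le_exp.2 (div_le_div_of_nonneg_right ?_ (by positivity))
      refine le_mul_of_one_le_left (sq_nonneg _) (one_le_pow₀ ?_)
      exact one_le_inv_iff₀.2 ⟨norm_pos_iff.2 h0, hw⟩
  have hint : Integrable (fun z => Real.exp (inner ℝ w (z - mean P) ^ 2 / (4 * K ^ 2))) P := by
    refine ⟨hm.aestronglyMeasurable, ?_⟩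
    rw [hasFiniteIntegral_iff_ofReal (Filter.Eventually.of_forall fun z => (Real.exp_pos _).le)]
    exact key.trans_lt ENNReal.ofReal_lt_top
  refine ⟨hint, ?_⟩
  rw [← ofReal_integral_eq_lintegral_ofReal hint
    (Filter.Eventually.of_forall fun z => (Real.exp_pos _).le)] at key
  exact (ENNReal.ofReal_le_ofReal_iff (by norm_num)).1 key

theorem pow_four_le_exp {K : ℝ} (hK : 0 < K) (a : ℝ) :
    a ^ 4 ≤ 32 * K ^ 4 * Real.exp (a ^ 2 / (4 * K ^ 2)) := by
  have h1 := Real.quadratic_le_exp_of_nonneg (x := a ^ 2 / (4 * K ^ 2)) (by positivity)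
  have h2 : 0 ≤ a ^ 2 / (4 * K ^ 2) := by positivity
  have h3 : (a ^ 2 / (4 * K ^ 2)) ^ 2 / 2 ≤ Real.exp (a ^ 2 / (4 * K ^ 2)) := by linarith
  calc a ^ 4 = 32 * K ^ 4 * ((a ^ 2 / (4 * K ^ 2)) ^ 2 / 2) := by field_simp; ring
    _ ≤ _ := by gcongr

theorem IsSubgaussian.coord_mul (hs : IsSubgaussian K P) (hK : 0 < K) (hP : MemLp id 2 P)
    (p p' : Fin T × Fin d) : MemLp (fun z => (z - mean P) p * (z - mean P) p') 2 P ∧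
      ∫ z, ((z - mean P) p * (z - mean P) p') ^ 2 ∂P ≤ 96 * K ^ 4 := by
  have h1 : ∀ p : Fin T × Fin d,
      Integrable (fun z => Real.exp ((z - mean P) p ^ 2 / (4 * K ^ 2))) P ∧
      ∫ z, Real.exp ((z - mean P) p ^ 2 / (4 * K ^ 2)) ∂P ≤ 3 := fun p => by
    have := hs.exp_sq hK (w := EuclideanSpace.single p 1) (by simp)
    simpa [EuclideanSpace.inner_single_left] using this
  set D : Space T d → ℝ := fun z => 16 * K ^ 4 * Real.exp ((z - mean P) p ^ 2 / (4 * K ^ 2)) +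
    16 * K ^ 4 * Real.exp ((z - mean P) p' ^ 2 / (4 * K ^ 2)) with hD
  have hDi : Integrable D P := ((h1 p).1.const_mul _).add ((h1 p').1.const_mul _)
  have hle : ∀ z, ((z - mean P) p * (z - mean P) p') ^ 2 ≤ D z := fun z => by
    have h2 := pow_four_le_exp hK ((z - mean P) p)
    have h3 := pow_four_le_exp hK ((z - mean P) p')
    rw [hD]
    simp only
    nlinarith [sq_nonneg ((z - mean P) p ^ 2 - (z - mean P) p' ^ 2)]
  have hmeas : AEStronglyMeasurable (fun z => (z - mean P) p * (z - mean P) p') P :=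
    (integrable_centered_mul hP p p').aestronglyMeasurable
  have hsq : Integrable (fun z => ((z - mean P) p * (z - mean P) p') ^ 2) P :=
    hDi.mono (hmeas.pow 2) (Filter.Eventually.of_forall fun z => by
      rw [Real.norm_eq_abs, abs_of_nonneg (sq_nonneg _)]
      exact (hle z).trans (le_abs_self _))
  refine ⟨(memLp_two_iff_integrable_sq hmeas).2 hsq, (integral_mono hsq hDi hle).trans ?_⟩
  rw [hD, integral_add ((h1 p).1.const_mul _) ((h1 p').1.const_mul _), integral_const_mul,
    integral_const_mul]
  have h4 := mul_le_mul_of_nonneg_left (h1 p).2 (show 0 ≤ 16 * K ^ 4 by positivity)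
  have h5 := mul_le_mul_of_nonneg_left (h1 p').2 (show 0 ≤ 16 * K ^ 4 by positivity)
  linarith

/-- Chernoff with λ = 1/(4K²). The exponential of the truncated square is at most 1 + ε exp(λa²), so
its mean is at most exp(3ε), while the threshold contributes at least exp(4εn); a factor exp(-εn)
remains. -/
theorem IsSubgaussian.measure_tail_le (hs : IsSubgaussian K P) (hK : 0 < K) {w : Space T d}
    (hw : ‖w‖ ≤ 1) (n : ℕ) {h b ε : ℝ} (hh : Real.exp (-(h / (4 * K ^ 2))) ≤ ε)
    (hb : 4 * ε ≤ b / (4 * K ^ 2)) :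
    Measure.pi (fun _ : Fin n => P)
      {c | n * b < ∑ i, max 0 (inner ℝ w (c i - mean P) ^ 2 - h)} ≤
        ENNReal.ofReal (Real.exp (-(n * ε))) := by
  set lam : ℝ := 1 / (4 * K ^ 2) with hlam
  have hlam0 : 0 < lam := by positivity
  obtain ⟨hi, h3⟩ := hs.exp_sq hK hw
  set φ : Space T d → ℝ := fun z =>
    Real.exp (lam * max 0 (inner ℝ w (z - mean P) ^ 2 - h)) with hφ
  have hφm : Measurable φ := by fun_prop
  have hε : 0 ≤ ε := (Real.exp_pos _).le.trans hh
  have hle : ∀ z, φ z ≤ 1 + ε * Real.exp (inner ℝ w (z - mean P) ^ 2 / (4 * K ^ 2)) := by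
    intro z
    rw [hφ]
    simp only
    rcases max_cases 0 (inner ℝ w (z - mean P) ^ 2 - h) with ⟨h1, _⟩ | ⟨h1, _⟩
    · rw [h1, mul_zero, Real.exp_zero]
      have : 0 ≤ ε * Real.exp (inner ℝ w (z - mean P) ^ 2 / (4 * K ^ 2)) := by positivity
      linarith
    · rw [h1, show lam * (inner ℝ w (z - mean P) ^ 2 - h) =
        -(h / (4 * K ^ 2)) + inner ℝ w (z - mean P) ^ 2 / (4 * K ^ 2) by rw [hlam]; ring,
        Real.exp_add]
      have := mul_le_mul_of_nonneg_right hh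
        (Real.exp_pos (inner ℝ w (z - mean P) ^ 2 / (4 * K ^ 2))).le
      linarith
  have hDi : Integrable (fun z => 1 + ε * Real.exp (inner ℝ w (z - mean P) ^ 2 / (4 * K ^ 2))) P :=
    (integrable_const _).add (hi.const_mul _)
  have hφi : Integrable φ P := hDi.mono hφm.aestronglyMeasurable
    (Filter.Eventually.of_forall fun z => by
      rw [Real.norm_eq_abs, abs_of_nonneg (Real.exp_pos _).le]
      exact (hle z).trans (le_abs_self _))
  have hφ1 : ∫ z, φ z ∂P ≤ Real.exp (3 * ε) := by
    refine (integral_mono hφi hDi hle).trans ?_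
    rw [integral_add (integrable_const _) (hi.const_mul _), integral_const_mul]
    simp only [integral_const, probReal_univ, smul_eq_mul, one_mul]
    have := Real.add_one_le_exp (3 * ε)
    nlinarith
  have hφ0 : 0 ≤ ∫ z, φ z ∂P := integral_nonneg fun z => (Real.exp_pos _).le
  have hprod : ∀ c : Fin n → Space T d, ∏ i, φ (c i) =
      Real.exp (lam * ∑ i, max 0 (inner ℝ w (c i - mean P) ^ 2 - h)) := fun c => by
    rw [Finset.mul_sum, Real.exp_sum]
  have hset : {c : Fin n → Space T d | n * b < ∑ i, max 0 (inner ℝ w (c i - mean P) ^ 2 - h)} =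
      {c | Real.exp (lam * (n * b)) < ∏ i, φ (c i)} := by
    ext c
    simp only [Set.mem_ofPred_eq]
    rw [hprod, Real.exp_lt_exp, mul_lt_mul_iff_right₀ hlam0]
  rw [hset]
  refine measure_lt_le_of_integral_le (Integrable.fintype_prod fun _ => hφi)
    (fun c => Finset.prod_nonneg fun i _ => (Real.exp_pos _).le) (Real.exp_pos _) ?_
  rw [integral_fintype_prod_eq_pow (ι := Fin n) φ, Fintype.card_fin, ← Real.exp_add]
  calc (∫ z, φ z ∂P) ^ n ≤ Real.exp (3 * ε) ^ n := by gcongr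
    _ = Real.exp (n * (3 * ε)) := by rw [← Real.exp_nat_mul]
    _ ≤ _ := by
      refine Real.exp_le_exp.2 ?_
      have h1 : (n : ℝ) * (4 * ε) ≤ n * (b / (4 * K ^ 2)) := by gcongr
      have h2 : lam * (n * b) = n * (b / (4 * K ^ 2)) := by rw [hlam]; ring
      linarith

/-! ### A net of the unit sphere -/

/-- Rounding is towards zero, so that grid points near unit vectors stay in the unit ball, where the
exponential moment bound applies. -/
theorem exists_int_div_near {N : ℕ} (hN : 0 < N) {r : ℝ} (hr : |r| ≤ 1) :
    ∃ k ∈ Finset.Icc (-N : ℤ) N, |(k : ℝ) / N| ≤ |r| ∧ |r - k / N| ≤ 1 / N := by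
  have hN' : (0 : ℝ) < N := Nat.cast_pos.2 hN
  have main : ∀ r : ℝ, 0 ≤ r → r ≤ 1 →
      ∃ k : ℕ, k ≤ N ∧ (k : ℝ) / N ≤ r ∧ r - k / N ≤ 1 / N := by
    intro r h0 h1
    have h2 := Nat.floor_le (mul_nonneg h0 hN'.le)
    have h3 := (Nat.lt_floor_add_one (r * N)).le
    refine ⟨⌊r * N⌋₊, ?_, ?_, ?_⟩
    · have : (⌊r * N⌋₊ : ℝ) ≤ N := h2.trans (mul_le_of_le_one_left hN'.le h1)
      exact_mod_cast this
    · rwa [div_le_iff₀ hN']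
    · rw [sub_le_iff_le_add, ← add_div, le_div_iff₀ hN']
      linarith
  rcases le_total 0 r with h | h
  · obtain ⟨k, hk, h1, h2⟩ := main r h ((le_abs_self r).trans hr)
    refine ⟨k, Finset.mem_Icc.2 ⟨by omega, by omega⟩, ?_, ?_⟩
    · rw [Int.cast_natCast, abs_of_nonneg (by positivity), abs_of_nonneg h]; exact h1
    · rw [Int.cast_natCast, abs_of_nonneg (by linarith)]; exact h2
  · obtain ⟨k, hk, h1, h2⟩ := main (-r) (by linarith) ((neg_le_abs r).trans hr)
    refine ⟨-k, Finset.mem_Icc.2 ⟨by omega, by omega⟩, ?_, ?_⟩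
    · push_cast
      rw [neg_div, abs_neg, abs_of_nonneg (by positivity), abs_of_nonpos h]; exact h1
    · push_cast
      rw [neg_div, sub_neg_eq_add, abs_of_nonpos (by linarith)]
      linarith

/-- The point with coordinates `k p / N`. -/
noncomputable def gridPoint (N : ℕ) (k : Fin T × Fin d → ℤ) : Space T d :=
  WithLp.toLp 2 fun p => (k p : ℝ) / N

/-- The indices of the points of the grid. -/
noncomputable def gridIndices (T d N : ℕ) : Finset (Fin T × Fin d → ℤ) :=
  Fintype.piFinset fun _ => Finset.Icc (-N : ℤ) N

theorem card_gridIndices (T d N : ℕ) : (gridIndices T d N).card = (2 * N + 1) ^ (T * d) := by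
  rw [gridIndices, Fintype.card_piFinset]
  simp
  congr 1
  omega

theorem exists_gridPoint_near {N : ℕ} (hN : 0 < N) {v : Space T d} (hv : ‖v‖ ≤ 1) :
    ∃ k ∈ gridIndices T d N, ‖gridPoint N k‖ ≤ 1 ∧
      ‖v - gridPoint N k‖ ^ 2 ≤ T * d / (N : ℝ) ^ 2 := by
  have hp : ∀ p, |v p| ≤ 1 := fun p => (PiLp.norm_apply_le v p).trans hv
  choose k hk h1 h2 using fun p => exists_int_div_near hN (hp p)
  refine ⟨k, Fintype.mem_piFinset.2 hk, ?_, ?_⟩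
  · refine le_trans (abs_le_of_sq_le_sq' ?_ (norm_nonneg v)).2 hv
    rw [← sum_sq_eq_norm_sq, ← sum_sq_eq_norm_sq]
    exact Finset.sum_le_sum fun p _ => sq_le_sq.2 (h1 p)
  · rw [← sum_sq_eq_norm_sq]
    calc _ ≤ ∑ p : Fin T × Fin d, (1 / (N : ℝ)) ^ 2 := Finset.sum_le_sum fun p _ => by
          rw [← sq_abs]
          exact pow_le_pow_left₀ (abs_nonneg _) (h2 p) 2
      _ = _ := by simp; ring

end OnlineMean

namespace OnlineMean

open RealRAM.FilterProg MeasureTheory ProbabilityTheory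

/-! ### Stability of samples from a sub-Gaussian distribution -/

variable {T d : ℕ} {P : Measure (Space T d)} [IsProbabilityMeasure P] {K : ℝ}

theorem card_mul_exp_le {M : ℕ} {N n : ℕ} {ε : ℝ} (h : 2 * N * M + 4 ≤ n * ε) :
    ((2 * N + 1) ^ M : ℝ) * Real.exp (-(n * ε)) ≤ 1 / 40 := by
  -- The size of the grid is at most exp(2NM), so the hypothesis leaves exp(-4), which is below
  -- 1/40.
  have h1 : (2 * N + 1 : ℝ) ≤ Real.exp (2 * N) := Real.add_one_le_exp _
  have h4 : Real.exp (-4) ≤ 1 / 40 := by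
    rw [Real.exp_neg, inv_le_comm₀ (Real.exp_pos _) (by norm_num)]
    have h5 : (2.7 : ℝ) ≤ Real.exp 1 := by linarith [Real.exp_one_gt_d9]
    calc (1 / 40 : ℝ)⁻¹ ≤ 2.7 ^ 4 := by norm_num
      _ ≤ Real.exp 1 ^ 4 := by gcongr
      _ = Real.exp 4 := by rw [← Real.exp_nat_mul]; norm_num
  calc ((2 * N + 1) ^ M : ℝ) * Real.exp (-(n * ε)) ≤ Real.exp (2 * N) ^ M * Real.exp (-(n * ε)) := by
        gcongr
    _ = Real.exp (M * (2 * N) + -(n * ε)) := by rw [Real.exp_add, ← Real.exp_nat_mul]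
    _ ≤ Real.exp (-4) := Real.exp_le_exp.2 (by linarith)
    _ ≤ _ := h4

theorem IsSubgaussian.measure_grid_tail_le (hs : IsSubgaussian K P) (hK : 0 < K) {n N : ℕ}
    {h b ε : ℝ} (hh : Real.exp (-(h / (4 * K ^ 2))) ≤ ε) (hb : 4 * ε ≤ b / (4 * K ^ 2))
    (hN : 2 * N * ((T : ℝ) * d) + 4 ≤ n * ε) :
    Measure.pi (fun _ : Fin n => P) {c | ¬ ∀ k ∈ gridIndices T d N, ‖(gridPoint N k : Space T d)‖ ≤ 1 →
      ∑ i, max 0 (inner ℝ (gridPoint N k) (c i - mean P) ^ 2 - h) ≤ n * b} ≤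
        ENNReal.ofReal (1 / 40) := by
  classical
  set S := (gridIndices T d N).filter fun k => ‖(gridPoint N k : Space T d)‖ ≤ 1 with hS
  calc _ ≤ Measure.pi (fun _ : Fin n => P) (⋃ k ∈ S,
        {c | n * b < ∑ i, max 0 (inner ℝ (gridPoint N k) (c i - mean P) ^ 2 - h)}) := by
        refine measure_mono fun c hc => ?_
        simp only [Set.mem_ofPred_eq] at hc
        push Not at hc
        obtain ⟨k, hk, h1, h2⟩ := hc
        simp only [Set.mem_iUnion]
        exact ⟨k, Finset.mem_filter.2 ⟨hk, h1⟩, h2⟩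
    _ ≤ ∑ k ∈ S, Measure.pi (fun _ : Fin n => P)
        {c | n * b < ∑ i, max 0 (inner ℝ (gridPoint N k) (c i - mean P) ^ 2 - h)} :=
        measure_biUnion_finset_le _ _
    _ ≤ ∑ k ∈ S, ENNReal.ofReal (Real.exp (-(n * ε))) := Finset.sum_le_sum fun k hk =>
        hs.measure_tail_le hK (Finset.mem_filter.1 hk).2 n hh hb
    _ = ENNReal.ofReal (S.card * Real.exp (-(n * ε))) := by
        rw [Finset.sum_const, nsmul_eq_mul, ENNReal.ofReal_mul (Nat.cast_nonneg _),
          ENNReal.ofReal_natCast]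
    _ ≤ _ := by
        refine ENNReal.ofReal_le_ofReal (le_trans ?_ (card_mul_exp_le (M := T * d) (N := N)
          (by push_cast; exact hN)))
        have : (S.card : ℝ) ≤ (2 * N + 1) ^ (T * d) := by
          have := Finset.card_filter_le (gridIndices T d N)
            fun k => ‖(gridPoint N k : Space T d)‖ ≤ 1
          rw [card_gridIndices] at this
          exact_mod_cast this
        gcongr

/-- Passing from a grid point to a nearby direction doubles the cutoff and costs only the squared
distance times the total squared norm. -/
theorem sum_max_sq_sub_le {n : ℕ} (y : Fin n → Space T d) (v w : Space T d) {h : ℝ} :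
    ∑ i, max 0 (inner ℝ v (y i) ^ 2 - 2 * h) ≤
      2 * ∑ i, max 0 (inner ℝ w (y i) ^ 2 - h) + 2 * ‖v - w‖ ^ 2 * ∑ i, ‖y i‖ ^ 2 := by
  rw [Finset.mul_sum, Finset.mul_sum, ← Finset.sum_add_distrib]
  refine Finset.sum_le_sum fun i _ => max_le (by positivity) ?_
  have h1 : inner ℝ v (y i) = inner ℝ w (y i) + inner ℝ (v - w) (y i) := by
    rw [← inner_add_left, add_sub_cancel]
  have h2 : inner ℝ (v - w) (y i) ^ 2 ≤ ‖v - w‖ ^ 2 * ‖y i‖ ^ 2 := by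
    rw [← mul_pow, ← sq_abs]
    exact pow_le_pow_left₀ (abs_nonneg _) (abs_real_inner_le_norm _ _) 2
  have h3 := le_max_right 0 (inner ℝ w (y i) ^ 2 - h)
  rw [h1]
  nlinarith [sq_nonneg (inner ℝ w (y i) - inner ℝ (v - w) (y i))]

theorem sum_max_sq_sub_le_of_near {n : ℕ} {y : Fin n → Space T d} {h b B r : ℝ}
    {v w : Space T d} (h2 : ‖v - w‖ ^ 2 ≤ r) (h3 : ∑ i, max 0 (inner ℝ w (y i) ^ 2 - h) ≤ b)
    (hB : ∑ i, ‖y i‖ ^ 2 ≤ B) (hr : 0 ≤ r) :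
    ∑ i, max 0 (inner ℝ v (y i) ^ 2 - 2 * h) ≤ 2 * b + 2 * r * B := by
  refine (sum_max_sq_sub_le y v w).trans ?_
  have h0 : 0 ≤ ∑ i, ‖y i‖ ^ 2 := Finset.sum_nonneg fun _ _ => sq_nonneg _
  gcongr

theorem sum_max_sq_sub_le_of_grid {n N : ℕ} (hN : 0 < N) {y : Fin n → Space T d} {h b B : ℝ}
    (hgrid : ∀ k ∈ gridIndices T d N, ‖(gridPoint N k : Space T d)‖ ≤ 1 →
      ∑ i, max 0 (inner ℝ (gridPoint N k) (y i) ^ 2 - h) ≤ b)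
    (hB : ∑ i, ‖y i‖ ^ 2 ≤ B) {v : Space T d} (hv : ‖v‖ = 1) :
    ∑ i, max 0 (inner ℝ v (y i) ^ 2 - 2 * h) ≤ 2 * b + 2 * (T * d / (N : ℝ) ^ 2) * B := by
  obtain ⟨k, hk, h1, h2⟩ := exists_gridPoint_near hN hv.le
  exact sum_max_sq_sub_le_of_near h2 (hgrid k hk h1) hB (by positivity)

theorem sum_norm_sq_le {n : ℕ} {y : Fin n → Space T d} {b : ℝ}
    (h : ∀ v : Space T d, ‖v‖ = 1 → ∑ i, inner ℝ v (y i) ^ 2 ≤ b) :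
    ∑ i, ‖y i‖ ^ 2 ≤ T * d * b := by
  simp only [← sum_sq_eq_norm_sq]
  rw [Finset.sum_comm]
  calc _ ≤ ∑ p : Fin T × Fin d, b := by
        refine Finset.sum_le_sum fun p _ => ?_
        have h1 := h (EuclideanSpace.single p 1) (by simp)
        simpa only [EuclideanSpace.inner_single_left, map_one, one_mul] using h1
    _ = _ := by simp

/-- No sample is discarded here. Mean and covariance concentrate by finite fourth moments; the tail
must hold at the finer scale `L`, for which a Chernoff bound and a grid are used. -/
theorem measure_not_cleanStable_subgaussian_le (hT : 1 ≤ T) (hd : 1 ≤ d) (hP : MemLp id 2 P)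
    (hc : covMatrix P = 1) (hK : 0 < K) (hs : IsSubgaussian K P) {ε l Q : ℝ} (hε : 0 < ε)
    (hε1 : ε ≤ 1) (hl : 1 ≤ l) (hle : Real.exp (-l) ≤ ε) (hQ : 1 ≤ Q) (hQK : 128 * K ^ 2 ≤ Q)
    (hL : 2 * ε * (Q * l) ≤ 6) {n : ℕ} (hn : 200 * ((T : ℝ) * d) ^ 2 ≤ n * ε ^ 2) :
    Measure.pi (fun _ : Fin n => P)
      {c | ¬ CleanStable Finset.univ ε (2 * ε * (Q * l)) (8 * K ^ 2 * l) c (mean P)} ≤ 1 / 10 := by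
  have hT' : (1 : ℝ) ≤ T := by exact_mod_cast hT
  have hd' : (1 : ℝ) ≤ d := by exact_mod_cast hd
  set M : ℝ := T * d with hM
  have hM1 : 1 ≤ M := one_le_mul_of_one_le_of_one_le hT' hd'
  have hM2 : M ≤ M ^ 2 := by nlinarith
  have hn0 : (0 : ℝ) < n := by
    have : 0 < n * ε ^ 2 := lt_of_lt_of_le (by positivity) hn
    exact pos_of_mul_pos_left this (by positivity)
  set L : ℝ := 2 * ε * (Q * l) with hLdef
  have hQl : 1 ≤ Q * l := one_le_mul_of_one_le_of_one_le hQ hl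
  have hLε : 2 * ε ≤ L := le_mul_of_one_le_right (by positivity) hQl
  have hL0 : 0 < L := by linarith
  have hKl : 128 * K ^ 2 * l ≤ Q * l := by gcongr
  have hKL : 256 * K ^ 2 * ε ≤ L := by
    calc 256 * K ^ 2 * ε = 2 * ε * (128 * K ^ 2 * 1) := by ring
      _ ≤ 2 * ε * (128 * K ^ 2 * l) := by gcongr
      _ ≤ _ := by rw [hLdef]; gcongr
  -- The lower bound makes the discretization error at most nL/8; the upper bound keeps the exponent
  -- of the union bound within nε.
  obtain ⟨N, hN1, hN2⟩ : ∃ N : ℕ, 11 * M / ε ≤ N ∧ (N : ℝ) ≤ 12 * M / ε := by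
    refine ⟨⌈11 * M / ε⌉₊, Nat.le_ceil _, ?_⟩
    have h1 := (Nat.ceil_lt_add_one (show 0 ≤ 11 * M / ε by positivity)).le
    have h2 : 1 ≤ M / ε := by rw [one_le_div hε]; linarith
    calc (⌈11 * M / ε⌉₊ : ℝ) ≤ 11 * M / ε + 1 := h1
      _ ≤ 11 * M / ε + M / ε := by linarith
      _ = _ := by ring
  have hN0 : 0 < N := by
    have : (0 : ℝ) < N := lt_of_lt_of_le (by positivity) hN1
    exact_mod_cast this
  have hpsd : (1 - covMatrix P).PosSemidef := by rw [hc, sub_self]; exact Matrix.PosSemidef.zero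
  have e1 := measure_linear_deviation_le (n := n) (P := P) (Z := fun z => z - mean P)
    (memLp_centered hP) (B := M) (t := n ^ 2 * (ε * L / 4)) (δ := 1 / 40)
    (by
      calc _ ≤ ∑ p : Fin T × Fin d, (1 : ℝ) :=
            Finset.sum_le_sum fun p _ => integral_coord_sq_le hP hpsd p
        _ = _ := by simp [hM])
    (by positivity) (by
      have h1 : M ≤ n * (ε * L) / 160 := by
        have h2 : (n : ℝ) * (ε * (2 * ε)) ≤ n * (ε * L) := by gcongr
        nlinarith
      calc (n : ℝ) * M ≤ n * (n * (ε * L) / 160) := by gcongr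
        _ = _ := by ring)
  have e2 := measure_quadratic_deviation_le (n := n) (P := P) (Z := fun z => z - mean P)
    (fun p p' => (hs.coord_mul hK hP p p').1) (B := 96 * K ^ 4 * M ^ 2) (t := (n * (L / 2)) ^ 2)
    (δ := 1 / 40)
    (by
      calc _ ≤ ∑ p : (Fin T × Fin d) × (Fin T × Fin d), 96 * K ^ 4 :=
            Finset.sum_le_sum fun p _ => (hs.coord_mul hK hP p.1 p.2).2
        _ = _ := by simp [hM]; ring)
    (by positivity) (by
      have h1 : 96 * K ^ 4 * M ^ 2 ≤ n * L ^ 2 / 160 := by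
        have h2 : (n : ℝ) * (256 * K ^ 2 * ε) ^ 2 ≤ n * L ^ 2 := by gcongr
        have h3 : K ^ 4 * (200 * M ^ 2) ≤ K ^ 4 * (n * ε ^ 2) := by gcongr
        have h4 : 0 ≤ K ^ 4 * M ^ 2 := by positivity
        nlinarith
      calc (n : ℝ) * (96 * K ^ 4 * M ^ 2) ≤ n * (n * L ^ 2 / 160) := by gcongr
        _ = _ := by ring)
  -- The cutoff is where the exponential factor falls to exp(-l), hence to at most ε. Moving off the
  -- grid doubles both the cutoff and `b`.
  have e3 := hs.measure_grid_tail_le hK (n := n) (N := N) (h := 4 * K ^ 2 * l) (b := L / 16)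
    (ε := ε) (by rwa [mul_div_cancel_left₀ _ (by positivity)]) (by
      rw [le_div_iff₀ (by positivity)]; linarith) (by
      have h1 : 2 * (N : ℝ) * M ≤ 2 * (12 * M / ε) * M := by gcongr
      have h2 : (2 * (12 * M / ε) * M + 4) * ε ≤ n * ε * ε := by
        have : (2 * (12 * M / ε) * M + 4) * ε = 24 * M ^ 2 + 4 * ε := by field_simp; ring
        rw [this]
        nlinarith
      have h3 := le_of_mul_le_mul_right h2 hε
      linarith)
  refine le_trans (measure_mono (t := (_ ∪ _) ∪ _) fun c hc' => ?_)
    ((measure_union_le _ _).trans (add_le_add ((measure_union_le _ _).trans (add_le_add e1 e2))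
      e3) |>.trans ?_)
  · by_contra hcon
    simp only [Set.mem_union, Set.mem_ofPred_eq, not_or, not_not] at hcon
    obtain ⟨⟨c1, c2⟩, c3⟩ := hcon
    refine hc' ?_
    have hsq : ∀ v : Space T d, ‖v‖ = 1 →
        |∑ i, inner ℝ v (c i - mean P) ^ 2 - n| ≤ n * (L / 2) := by
      intro v hv
      have h1 := c2 v hv
      rw [integral_inner_sq_eq hP hc, hv, one_pow, mul_one] at h1
      exact abs_le_of_sq_le_sq h1 (by positivity)
    have hnorm := sum_norm_sq_le (y := fun i => c i - mean P) (b := 4 * n) fun v hv => by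
      have h1 := (abs_le.1 (hsq v hv)).2
      nlinarith
    have htail : ∀ v : Space T d, ‖v‖ = 1 →
        ∑ i, max 0 (inner ℝ v (c i - mean P) ^ 2 - 2 * (4 * K ^ 2 * l)) ≤ n * (L / 4) := by
      intro v hv
      refine (sum_max_sq_sub_le_of_grid hN0 c3 hnorm hv).trans ?_
      have h5 : 2 * (M / (N : ℝ) ^ 2) * (M * (4 * n)) ≤ n * L / 8 := by
        calc _ ≤ 2 * (M / (11 * M / ε) ^ 2) * (M * (4 * n)) := by gcongr
          _ = 8 / 121 * n * (ε * ε) := by field_simp; ring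
          _ ≤ 8 / 121 * n * (1 * ε) := by gcongr
          _ ≤ n * L / 8 := by nlinarith
      linarith
    refine ⟨by simp; positivity, fun v hv => ?_, fun v hv => ?_, fun v hv => ?_, fun v hv => ?_⟩
    · have h1 := c1 v hv
      rwa [integral_centered hP, mul_zero, sub_zero] at h1
    · have h1 := (abs_le.1 (hsq v hv)).2
      nlinarith
    · rw [show 8 * K ^ 2 * l = 2 * (4 * K ^ 2 * l) by ring]
      refine (htail v hv).trans ?_
      have h6 : ε * (2 * (4 * K ^ 2 * l)) ≤ L / 32 := by
        have := mul_le_mul_of_nonneg_left hKl hε.le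
        rw [hLdef]
        linarith
      gcongr
      linarith
    · have h1 := (abs_le.1 (hsq v hv)).1
      linarith
  · rw [← ENNReal.ofReal_add (by norm_num) (by norm_num), ← ENNReal.ofReal_add (by norm_num)
      (by norm_num), show (1 : ENNReal) / 10 = ENNReal.ofReal (1 / 10) by
        rw [ENNReal.ofReal_div_of_pos (by norm_num)]; simp]
    exact ENNReal.ofReal_le_ofReal (by norm_num)

/-! ### The score level -/

/-- Comparison of the sum with the integral of 1/x: each term dominates the next increment of the
logarithm. -/
theorem log_add_sub_log_le {n : ℕ} {a : ℝ} (ha : 0 < a) :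
    Real.log (n + a) - Real.log a ≤ ∑ j ∈ Finset.range n, 1 / (j + a) := by
  induction n with
  | zero => simp
  | succ n ih =>
    rw [Finset.sum_range_succ]
    have hp : 0 < n + a := by positivity
    have h1 : Real.log ((n + 1 + a) / (n + a)) ≤ (n + 1 + a) / (n + a) - 1 :=
      Real.log_le_sub_one_of_pos (by positivity)
    rw [Real.log_div (by positivity) (by positivity)] at h1
    have h2 : (n + 1 + a) / (n + a) - 1 = 1 / (n + a) := by field_simp; ring
    push_cast
    linarith

theorem sum_one_div_add_le {n : ℕ} {a : ℝ} (ha : 0 < a) :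
    ∑ j ∈ Finset.range (n + 1), 1 / (j + a) ≤ 1 / a + (Real.log (n + a) - Real.log a) := by
  induction n with
  | zero => simp
  | succ n ih =>
    rw [Finset.sum_range_succ]
    have hp : 0 < n + a := by positivity
    have h1 : 1 - ((n + 1 + a) / (n + a))⁻¹ ≤ Real.log ((n + 1 + a) / (n + a)) :=
      Real.one_sub_inv_le_log_of_pos (by positivity)
    rw [Real.log_div (by positivity) (by positivity)] at h1
    have h2 : 1 - ((n + 1 + a) / (n + a))⁻¹ = 1 / (n + 1 + a) := by
      have : 0 < n + 1 + a := by positivity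
      field_simp; ring
    push_cast
    linarith

/-- The sum is comparable to log((n+nε)/(nε)). Thus log(1/ε) is available up to a constant through
field operations alone; the lower bound has constant 1 because exp(-l) ≤ ε is needed. -/
theorem harmonic_level_bounds {n : ℕ} {ε : ℝ} (hε : 0 < ε) (hε1 : ε ≤ 1 / 400)
    (hn : 1 ≤ n * ε) :
    Real.log (1 / ε) ≤ ∑ j ∈ Finset.range n, 1 / (j + n * ε) ∧
      ∑ j ∈ Finset.range n, 1 / (j + n * ε) ≤ 4 * Real.log (1 / ε) ∧
        1 ≤ Real.log (1 / ε) := by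
  have hn0 : (0 : ℝ) < n := pos_of_mul_pos_left (lt_of_lt_of_le one_pos hn) hε.le
  have ha : 0 < n * ε := by positivity
  have h400 : (400 : ℝ) ≤ 1 / ε := by rw [le_div_iff₀ hε]; linarith
  have hlog1 : 1 ≤ Real.log (1 / ε) := by
    rw [Real.le_log_iff_exp_le (by positivity)]
    linarith [Real.exp_one_lt_d9]
  refine ⟨?_, ?_, hlog1⟩
  · refine le_trans ?_ (log_add_sub_log_le ha)
    rw [← Real.log_div (by positivity) (by positivity)]
    refine Real.log_le_log (by positivity) ?_
    rw [div_le_div_iff₀ hε ha]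
    nlinarith
  · obtain ⟨m, rfl⟩ : ∃ m, n = m + 1 := ⟨n - 1, by
      have : 0 < n := by exact_mod_cast hn0
      omega⟩
    refine (sum_one_div_add_le ha).trans ?_
    have h1 : 1 / (((m + 1 : ℕ) : ℝ) * ε) ≤ 1 := by rw [div_le_one ha]; exact hn
    have h2 : Real.log (m + ((m + 1 : ℕ) : ℝ) * ε) - Real.log (((m + 1 : ℕ) : ℝ) * ε) ≤
        Real.log ((1 / ε) ^ 2) := by
      rw [← Real.log_div (by positivity) (by positivity)]
      refine Real.log_le_log (by positivity) ?_
      rw [div_le_iff₀ ha]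
      push_cast
      have h3 : (1 / ε) ^ 2 * ((m + 1) * ε) = (1 / ε) * (m + 1) := by field_simp
      rw [h3]
      have h4 : (m + 1 : ℝ) * 400 ≤ (m + 1) * (1 / ε) := by gcongr
      have h5 : (m + 1 : ℝ) * ε ≤ (m + 1) * (1 / 400) := by gcongr
      linarith
    rw [Real.log_pow] at h2
    push_cast at h1 h2 ⊢
    linarith

end OnlineMean

namespace OnlineMean

open RealRAM.FilterProg MeasureTheory ProbabilityTheory

/-! ### The estimation guarantees -/

variable {T d : ℕ} {P : Measure (Space T d)} [IsProbabilityMeasure P]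

/-- The exceptional event concerns the clean samples alone; outside it the run succeeds
deterministically against every corruption. -/
theorem estimatesMean_bounded (q : ℚ) (hT : 1 ≤ T) (hd : 1 ≤ d) (hP : MemLp id 2 P)
    (hc : (1 - covMatrix P).PosSemidef) {ε : ℝ} (hε : 0 < ε) (hε1 : ε ≤ 1 / 400) {n : ℕ}
    (hn1 : 1 ≤ n) (hn : 1600 * ((T : ℝ) * d) ^ 2 ≤ n * ε) {err : ℝ}
    (herr : 134 * (√(ε * 6) * (1 + Real.log T)) ≤ err) :
    EstimatesMean (program q) n ε P err (1 / 10) := by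
  refine (measure_mono (Set.ofPred_subset_ofPred.2 fun c hc' hG => ?_)).trans
    (measure_not_cleanStable_bounded_le hT hd hP hc hε hn)
  refine hc' fun x hx => ?_
  obtain ⟨G, hG⟩ := hG
  obtain ⟨G', hG'⟩ := hG.exists_stableSample hε.le hε1 (by norm_num) le_rfl le_rfl (by norm_num) hx
  obtain ⟨y, m, hrun, hy⟩ := exists_run_of_bounded q hn1 hT hd hG'
  exact ⟨y, m, hrun, hy.trans herr⟩

theorem estimatesMean_subgaussian {q : ℚ} (hT : 1 ≤ T) (hd : 1 ≤ d) (hP : MemLp id 2 P)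
    (hc : covMatrix P = 1) {K : ℝ} (hK : 0 < K) (hs : IsSubgaussian K P) (hq : (1 : ℝ) ≤ q)
    (hqK : 128 * K ^ 2 ≤ q) {ε : ℝ} (hε : 0 < ε) (hε1 : ε ≤ 1 / 400) {n : ℕ} (hn1 : 1 ≤ n)
    (hn : 1600 * ((T : ℝ) * d) ^ 2 ≤ n * ε ^ 2) {err : ℝ}
    (herr : 134 * √(8 * q) * (ε * √(Real.log (1 / ε)) * (1 + Real.log T)) ≤ err) :
    EstimatesMean (program q) n ε P err (1 / 10) := by
  have hT' : (1 : ℝ) ≤ T := by exact_mod_cast hT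
  have hd' : (1 : ℝ) ≤ d := by exact_mod_cast hd
  have hM1 : 1 ≤ (T : ℝ) * d := one_le_mul_of_one_le_of_one_le hT' hd'
  have hn' : 1600 * ((T : ℝ) * d) ^ 2 ≤ n * ε := by
    refine hn.trans ?_
    have : ε ^ 2 ≤ ε := by nlinarith
    gcongr
  have hnε : 1 ≤ n * ε := by nlinarith
  obtain ⟨hl1, hl2, hlog⟩ := harmonic_level_bounds hε hε1 hnε
  have hθ : baseLevel q n ε = q * ∑ j ∈ Finset.range n, 1 / (j + n * ε) := rfl
  set l := ∑ j ∈ Finset.range n, 1 / (j + n * ε) with hl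
  have hlogT := Real.log_nonneg hT'
  have hbound : 134 * (√(ε * (2 * ε * (q * l))) * (1 + Real.log T)) ≤ err := by
    refine le_trans ?_ herr
    have h1 : √(ε * (2 * ε * (q * l))) ≤ √(8 * q) * (ε * √(Real.log (1 / ε))) := by
      refine Real.sqrt_le_iff.2 ⟨by positivity, ?_⟩
      rw [mul_pow, mul_pow, Real.sq_sqrt (by positivity), Real.sq_sqrt (by linarith)]
      have : 2 * ε ^ 2 * q * l ≤ 2 * ε ^ 2 * q * (4 * Real.log (1 / ε)) := by gcongr
      linarith
    calc 134 * (√(ε * (2 * ε * (q * l))) * (1 + Real.log T))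
        ≤ 134 * (√(8 * q) * (ε * √(Real.log (1 / ε))) * (1 + Real.log T)) := by gcongr
      _ = _ := by ring
  -- If 2εθ exceeds 6, the desired error is larger than the one for bounded covariance, and identity
  -- covariance is a special case of that.
  rcases le_or_gt (2 * ε * (q * l)) 6 with h6 | h6
  · refine (measure_mono (Set.ofPred_subset_ofPred.2 fun c hc' hG => ?_)).trans
      (measure_not_cleanStable_subgaussian_le hT hd hP hc hK hs hε (by linarith)
        (hlog.trans hl1) ?_ hq hqK h6 (n := n) (by nlinarith))
    · refine hc' fun x hx => ?_
      have hl0 : 0 < l := by linarith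
      obtain ⟨G', hG'⟩ := hG.exists_stableSample (h' := q * l) hε.le hε1 (by positivity)
        (by positivity) (by gcongr; linarith [sq_nonneg K]) (by linarith) hx
      rw [← hθ] at hG' h6 hbound
      obtain ⟨y, m, hrun, hy⟩ := exists_run_of_subgaussian q hn1 hT hd
        (by rw [hθ]; positivity) h6 hG'
      exact ⟨y, m, hrun, hy.trans hbound⟩
    · calc Real.exp (-l) ≤ Real.exp (-Real.log (1 / ε)) := Real.exp_le_exp.2 (by linarith)
        _ = ε := by rw [one_div, Real.log_inv, neg_neg, Real.exp_log hε]
  · refine estimatesMean_bounded q hT hd hP (by rw [hc, sub_self]; exact Matrix.PosSemidef.zero)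
      hε hε1 hn1 hn' (le_trans ?_ hbound)
    gcongr

theorem sq_le_mul_of_le {M ε C : ℝ} {n k : ℕ} (hM : 1 ≤ M) (hε : 0 < ε) (hε1 : ε ≤ 1)
    (hC : 1600 ≤ C) (hn : C * (M / ε) ^ (k + 2) ≤ n) : 1600 * M ^ 2 ≤ n * ε ^ 2 := by
  have h1 : 1 ≤ M / ε := by rw [one_le_div hε]; linarith
  have h2 : 1600 * (M / ε) ^ 2 ≤ n := by
    refine le_trans ?_ hn
    have := pow_le_pow_right₀ h1 (show 2 ≤ k + 2 by omega)
    gcongr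
  calc 1600 * M ^ 2 = 1600 * (M / ε) ^ 2 * ε ^ 2 := by field_simp
    _ ≤ _ := by gcongr

end OnlineMean

theorem theorem1p3 :
    ∃ ε₀ : ℝ, 0 < ε₀ ∧ ∃ C : ℝ, 0 < C ∧ ∃ k : ℕ, ∀ K : ℝ, 0 < K →
    ∃ C_K : ℝ, 0 < C_K ∧ ∃ prog : RealRAM.Cmd,
      -- polynomial running time, on every input
      (∀ n T d : ℕ, 1 ≤ n → 1 ≤ T → 1 ≤ d → ∀ ε : ℝ, 0 < ε → ε ≤ ε₀ →
        ∀ x : Fin n → OnlineMean.Space T d, ∃ (y : OnlineMean.Space T d) (m : ℕ),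
          OnlineMean.OnlineRun prog ε x y m ∧
            (m : ℝ) ≤ C * ((n : ℝ) * ((T : ℝ) * (d : ℝ)) / ε) ^ k) ∧
      -- sample complexity and error
      (∀ T d : ℕ, 1 ≤ T → 1 ≤ d → ∀ ε : ℝ, 0 < ε → ε ≤ ε₀ →
        ∀ (P : MeasureTheory.Measure (OnlineMean.Space T d))
          [MeasureTheory.IsProbabilityMeasure P], MeasureTheory.MemLp id 2 P →
          ((1 - OnlineMean.covMatrix P).PosSemidef →
            ∀ n : ℕ, C * (((T : ℝ) * (d : ℝ)) / ε) ^ k ≤ (n : ℝ) →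
              OnlineMean.EstimatesMean prog n ε P
                (C * (√ε * (1 + Real.log T))) (1 / 10)) ∧
          (OnlineMean.covMatrix P = 1 → OnlineMean.IsSubgaussian K P →
            ∀ n : ℕ, C_K * (((T : ℝ) * (d : ℝ)) / ε) ^ k ≤ (n : ℝ) →
              OnlineMean.EstimatesMean prog n ε P
                (C_K * (ε * √(Real.log (1 / ε)) * (1 + Real.log T))) (1 / 10))) := by
  obtain ⟨C₀, k₀, hrun⟩ := OnlineMean.exists_running_time_bound
  -- With ε ≤ 1/400 the fraction 2ε is at most 1/200, as stability demands. The constant 1600 covers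
  -- both the sample size and the error factor 134√6, and the exponent is at least 2 for the sample
  -- size.
  refine ⟨1 / 400, by norm_num, C₀ + 1600, by positivity, k₀ + 2, fun K hK => ?_⟩
  -- The program may contain rational constants only, so 128K² is rounded up; the summand 1 ensures
  -- that `q` is at least 1.
  set q : ℚ := ((⌈128 * K ^ 2⌉₊ + 1 : ℕ) : ℚ) with hq
  have hq1 : (1 : ℝ) ≤ q := by
    rw [hq]; push_cast
    linarith [(Nat.cast_nonneg ⌈128 * K ^ 2⌉₊ : (0 : ℝ) ≤ _)]
  have hqK : 128 * K ^ 2 ≤ (q : ℝ) := by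
    rw [hq]; push_cast
    linarith [Nat.le_ceil (128 * K ^ 2)]
  refine ⟨134 * √(8 * q) + 1600, by positivity, RealRAM.FilterProg.program q, ?_, ?_⟩
  · intro n T d hn hT hd ε hε hε1 x
    obtain ⟨y, m, hy, hm, -⟩ := OnlineMean.onlineRun_program q hn hT hd ε x
    refine ⟨y, m, hy, ?_⟩
    have h1 := hm.trans (hrun (k₀ + 2) (by omega) q n T d hn hT hd)
    have h2 : (m : ℝ) ≤ C₀ * (n * (T * d)) ^ (k₀ + 2) := by exact_mod_cast h1
    refine h2.trans ?_
    have h3 : (n : ℝ) * (T * d) ≤ n * (T * d) / ε :=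
      le_div_self (by positivity) hε (by linarith)
    gcongr
    linarith
  · intro T d hT hd ε hε hε1 P _ hP
    have hT' : (1 : ℝ) ≤ T := by exact_mod_cast hT
    have hd' : (1 : ℝ) ≤ d := by exact_mod_cast hd
    have hM1 : 1 ≤ (T : ℝ) * d := one_le_mul_of_one_le_of_one_le hT' hd'
    have hlogT := Real.log_nonneg hT'
    have hC₀ : (0 : ℝ) ≤ C₀ := Nat.cast_nonneg _
    have hn1 : ∀ n : ℕ, 1600 * ((T : ℝ) * d) ^ 2 ≤ n * ε ^ 2 → 1 ≤ n := fun n hn => by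
      by_contra! h0
      have : n = 0 := by omega
      subst this
      have : 0 < 1600 * ((T : ℝ) * d) ^ 2 := by positivity
      simp only [Nat.cast_zero, zero_mul] at hn
      linarith
    refine ⟨fun hc n hn => ?_, fun hc hs n hn => ?_⟩
    · have hn2 := OnlineMean.sq_le_mul_of_le hM1 hε (by linarith) (by linarith) hn
      refine OnlineMean.estimatesMean_bounded q hT hd hP hc hε hε1 (hn1 n hn2)
        (hn2.trans ?_) ?_
      · have : ε ^ 2 ≤ ε := by nlinarith
        gcongr
      · rw [Real.sqrt_mul hε.le, ← mul_assoc, ← mul_assoc, ← mul_assoc]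
        gcongr ?_ * _
        have h6 : √6 ≤ 3 := Real.sqrt_le_iff.2 ⟨by norm_num, by norm_num⟩
        have := mul_le_mul_of_nonneg_left h6 (Real.sqrt_nonneg ε)
        nlinarith [mul_nonneg hC₀ (Real.sqrt_nonneg ε), Real.sqrt_nonneg ε]
    · have h8 : 0 ≤ 134 * √(8 * (q : ℝ)) := by positivity
      have hn2 := OnlineMean.sq_le_mul_of_le hM1 hε (by linarith) (by linarith) hn
      refine OnlineMean.estimatesMean_subgaussian hT hd hP hc hK hs hq1 hqK hε hε1 (hn1 n hn2)
        hn2 ?_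
      gcongr
      linarith
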